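/- Fix real numbers $d\ge 1$ and $\theta\ge 0$. *Mean field model.* For each $n$, give the edges of the complete graph $K_n$ the lengths $(nX_e)^{1/d}$, where the $X_e$ are independent exponential variables of mean $1$. A partial matching of $K_n$ has diluted cost equal to the total length of its edges plus $\theta/2$ for each unmatched vertex. Let $q_n$ be the proportion of vertices that are not matched in the optimum diluted matching, that is, a partial matching of minimum diluted cost (if there are several, chosen in any way whatsoever). *The $d$-PWIT and Graph Exploration.* The $d$-PWIT is the infinite rooted tree in which each vertex has countably many children and the lengths of the edges to the children of each vertex are the $1/d$-th powers of the points of a rate $1$ Poisson process on the positive reals, independently for all vertices. Its $\theta$-cluster consists of the vertices that can be reached from the root by downward paths of edges of length at most $\theta$. In Graph Exploration, Alice and Bob alternately choose the next edge of a self-avoiding walk from the root, Alice starting; the player who moves either pays the length of the chosen edge to the opponent and continues, or terminates the game by paying $\theta/2$ to the opponent. A valuation is a real function $f$ on the vertices of the $\theta$-cluster such that for every vertex $v$ $$f(v)=\min\bigl(\theta/2,\ l_i-f(v_i)\bigr),$$ the minimum being over $\theta/2$ and all $l_i-f(v_i)$, where $v_i$ ranges over the children of $v$ in the cluster and $l_i$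 is the length of the edge from $v$ to $v_i$. Here $f(v)$ is the value of having just moved to $v$; under $f$, Alice terminates the game immediately exactly when $f(\mathrm{root})=\theta/2$. *Integral operator.* For an integrable function $F$ on $[-\theta/2,\theta/2]$ let $$(V_\theta F)(x)=\exp\left(-d\int_0^{\theta/2+x}l^{d-1}F(l-x)\,dl\right),\qquad -\theta/2\le x\le\theta/2 .$$ **Proposition.** Almost surely there is exactly one valuation $f$ of the $\theta$-cluster of the $d$-PWIT, and $V_\theta$ has exactly one integrable fixed point $F$. Let $q=P(f(\mathrm{root})=\theta/2)$, the probability that Alice quits immediately in Graph Exploration on the $d$-PWIT. Then $q=F(\theta/2)$ and, as $n\to\infty$, $q_n$ converges in probability to $q$. -/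

import Mathlib

open MeasureTheory ProbabilityTheory Set Filter Topology

noncomputable section

namespace DilutedMatching

/-! ### The diluted matching problem on a finite graph -/

open Classical in
/-- The cost, for the penalty parameter `θ`, of a partial matching `M` of a finite graph `G` with
edge lengths `ℓ`: the sum of the lengths of the edges of `M` plus `θ / 2` for each vertex that is
not matched. -/
def cost {V : Type*} [Fintype V] {G : SimpleGraph V} (θ : ℝ) (ℓ : G.edgeSet → ℝ)
    (M : G.Subgraph) : ℝ :=
  (∑ e : G.edgeSet, if e.1 ∈ M.edgeSet then ℓ e else 0) + θ / 2 * (M.vertsᶜ.ncard : ℝ)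

/-- `M` is a partial matching of `G` of minimum diluted cost. (In `SimpleGraph.Subgraph.IsMatching`
each vertex of the subgraph has exactly one neighbour in it; the vertices of the subgraph are the
matched ones.) -/
def IsOptimal {V : Type*} [Fintype V] {G : SimpleGraph V} (θ : ℝ) (ℓ : G.edgeSet → ℝ)
    (M : G.Subgraph) : Prop :=
  M.IsMatching ∧ ∀ M' : G.Subgraph, M'.IsMatching → cost θ ℓ M ≤ cost θ ℓ M'

/-- The proportion of the vertices that are not matched by `M`. -/
def unmatchedFraction {V : Type*} [Fintype V] {G : SimpleGraph V} (M : G.Subgraph) : ℝ :=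
  (M.vertsᶜ.ncard : ℝ) / (Fintype.card V : ℝ)

/-! ### The mean field model of pseudo-dimension `d` -/

/-- The edge lengths `(n X)^(1/d)` of the complete graph on `n` vertices, computed from the
underlying variables `X` (independent exponential variables of mean 1 in the model). -/
def meanFieldLength (d : ℝ) (n : ℕ) (X : (⊤ : SimpleGraph (Fin n)).edgeSet → ℝ) :
    (⊤ : SimpleGraph (Fin n)).edgeSet → ℝ :=
  fun e => ((n : ℝ) * X e) ^ (1 / d)

/-! ### The `d`-PWIT and valuations

The vertices of the infinite tree are the finite sequences of natural numbers, the root is `[]`,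
and the children of `v` are `i :: v` for `i : ℕ`. -/

/-- The length of the edge from `v` to its child `i :: v` in the `d`-PWIT, computed from the gaps
`E v 0, E v 1, …` (independent exponential variables of mean 1 in the model): their partial sums are
the points, in increasing order, of a rate 1 Poisson process on the positive reals, and these points
are raised to the power `1 / d`. -/
def pwitLength (d : ℝ) (E : List ℕ → ℕ → ℝ) (v : List ℕ) (i : ℕ) : ℝ :=
  (∑ j ∈ Finset.range (i + 1), E v j) ^ (1 / d)

/-- The vertices of the `θ`-cluster: those that can be reached from the root by downward paths
of edges of length at most `θ`. -/
inductive InCluster (θ : ℝ) (ℓ : List ℕ → ℕ → ℝ) : List ℕ → Prop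
  | root : InCluster θ ℓ []
  | child (v : List ℕ) (i : ℕ) : InCluster θ ℓ v → ℓ v i ≤ θ → InCluster θ ℓ (i :: v)

/-- `f` is a valuation of the `θ`-cluster: at each vertex `v` the value `f v` is the minimum of
`θ / 2` and of the numbers `l_i - f(v_i)`, for the children `v_i` of `v` in the cluster, where
`l_i` is the length of the edge from `v` to `v_i`. -/
def IsValuation (θ : ℝ) (ℓ : List ℕ → ℕ → ℝ) (f : {v : List ℕ // InCluster θ ℓ v} → ℝ) : Prop :=
  ∀ v : {v : List ℕ // InCluster θ ℓ v},
    IsLeast (insert (θ / 2)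
      {x : ℝ | ∃ (i : ℕ) (h : InCluster θ ℓ (i :: v.1)), x = ℓ v.1 i - f ⟨i :: v.1, h⟩}) (f v)

/-! ### The integral operator -/

/-- The operator `V_θ` on functions on the interval `[-θ/2, θ/2]`. For `x` in the interval only the
values of `F` on the interval are used. -/
def V (d θ : ℝ) (F : ℝ → ℝ) (x : ℝ) : ℝ :=
  Real.exp (-d * ∫ l in (0 : ℝ)..(θ / 2 + x), l ^ (d - 1) * F (l - x))

/-- `F` is an integrable function on `[-θ/2, θ/2]` which is fixed by `V_θ`. -/
def IsFixedPoint (d θ : ℝ) (F : ℝ → ℝ) : Prop :=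
  IntegrableOn F (Icc (-(θ / 2)) (θ / 2)) ∧ EqOn (V d θ F) F (Icc (-(θ / 2)) (θ / 2))

end DilutedMatching

end

/-! Everything is compared with Graph Exploration stopped after `k` moves, the last mover then
receiving `h = θ / 2`. The recursion reverses order in the values of the children, so even
truncations decrease, odd ones increase, and every solution is trapped between them. This applies to
valuations on the tree (`IsValuation.between`), to fixed points of `V_θ` against the tails of the
truncated root values (`IsFixedPoint.between`), and, on a finite graph, to the increase of the
minimum diluted cost caused by one vertex (`costIncrement_between`).

On the tree, the edges at the root together with the values of the children form a marked Poisson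
process. A void probability gives P(x ≤ f_{k+1}) = exp(-E (x + f_k)_+^d), so the tails of the
truncated values evolve under `V_θ` (`measureReal_le_treeValue_succ`, `truncTail_succ`). Let A ≥ B
be the limits of the even and odd truncations at the root. Each has the tail that the recursion
produces from the other, and integrating minus the logarithm of the tail of A against A itself gives
E (A + B')_+^d = 1 - exp(-E (h + B)_+^d), with B' an independent copy of B. Exchanging A and B does
not change the left side, hence E (h + A)_+^d = E (h + B)_+^d, and A ≥ B forces A = B almost surely
(`ae_eq_of_mutual_tails`). So the valuation is unique, and the only fixed point of `V_θ` is the tail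
of the root value, which at `θ / 2` is the probability that Alice quits at once.

On the complete graph, a vertex left unmatched by an optimum has even truncated values equal to `θ /
2`, and a matched one has odd truncated values below `θ / 2`, apart from ties of probability zero.
Hence the unmatched proportion lies between two proportions that depend on bounded-depth games only.
For fixed depth these obey a law of large numbers with the limits found on the tree
(`exists_tailFraction_rate`), proved by induction on the depth with second moments: given the graph
without a vertex, its value is at least `y` with probability exp(-`hazard`), where `hazard` is an
average that concentrates, and two vertices decouple because deleting one of them changes the
other's truncated value with probability O(1/n). Letting `n` and then the depth tend to infinity
finishes the proof. -/

namespace DilutedMatching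

/-! ### The exponential law of mean 1. -/

section Exponential

instance isProbabilityMeasure_expMeasure_one : IsProbabilityMeasure (expMeasure 1) :=
  isProbabilityMeasure_expMeasure one_pos

theorem expMeasure_one_eq_withDensity :
    expMeasure 1 = volume.withDensity (exponentialPDF 1) := rfl

theorem expMeasure_one_singleton (x : ℝ) : expMeasure 1 {x} = 0 :=
  withDensity_absolutelyContinuous volume (exponentialPDF 1) (by simp)

instance nullSingletonClass_expMeasure_one : NullSingletonClass (expMeasure 1) := ⟨expMeasure_one_singleton⟩

theorem expMeasure_one_real_Iic {x : ℝ} (hx : 0 ≤ x) :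
    (expMeasure 1).real (Iic x) = 1 - Real.exp (-x) := by
  rw [← cdf_eq_real, cdf_expMeasure_eq one_pos, if_pos hx, one_mul]

theorem expMeasure_one_real_Iic_le {x : ℝ} (hx : 0 ≤ x) :
    (expMeasure 1).real (Iic x) ≤ x := by
  rw [expMeasure_one_real_Iic hx]
  linarith [Real.add_one_le_exp (-x)]

theorem expMeasure_one_Iic_zero : expMeasure 1 (Iic 0) = 0 := by
  rw [← measureReal_eq_zero_iff, expMeasure_one_real_Iic le_rfl]
  simp

theorem expMeasure_one_real_Ici (x : ℝ) :
    (expMeasure 1).real (Ici x) = Real.exp (-(max x 0)) := by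
  have h1 : (expMeasure 1).real (Ici x) = 1 - (expMeasure 1).real (Iic x) := by
    rw [← measureReal_congr Ioi_ae_eq_Ici, ← compl_Iic, probReal_compl_eq_one_sub measurableSet_Iic]
  rw [h1, ← cdf_eq_real, cdf_expMeasure_eq one_pos]
  split_ifs with h
  · simp [max_eq_left h]
  · simp [max_eq_right (le_of_not_ge h)]

theorem ae_expMeasure_one_pos : ∀ᵐ x ∂(expMeasure 1), 0 < x := by
  rw [ae_iff]
  convert expMeasure_one_Iic_zero using 2
  ext; simp

theorem integral_expMeasure_one (g : ℝ → ℝ) :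
    ∫ u, g u ∂(expMeasure 1) = ∫ u in Ioi (0 : ℝ), Real.exp (-u) * g u := by
  rw [expMeasure_one_eq_withDensity, integral_withDensity_eq_integral_toReal_smul,
    ← integral_Ici_eq_integral_Ioi, ← integral_indicator measurableSet_Ici]
  · congr 1
    ext u
    by_cases hu : 0 ≤ u
    · simp [exponentialPDF_of_nonneg hu, indicator_of_mem (mem_Ici.2 hu),
        ENNReal.toReal_ofReal (Real.exp_pos _).le]
    · simp [exponentialPDF_of_neg (not_le.1 hu), hu]
  · exact (measurable_exponentialPDFReal 1).ennreal_ofReal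
  · exact ae_of_all _ fun x => ENNReal.ofReal_lt_top

end Exponential

/-! ### Independence of blocks, and random thresholds. -/

section Independence

variable {ι Ω : Type*} [MeasurableSpace Ω] {μ : Measure Ω} {β : ι → Type*}
  [∀ i, MeasurableSpace (β i)] {X : ∀ i, Ω → β i}

/-- The subfamilies of an independent family indexed by two disjoint sets are independent. -/
theorem indepFun_of_disjoint_sets (hX : ∀ i, Measurable (X i)) (h : iIndepFun X μ)
    {S T : Set ι} (hST : Disjoint S T) :
    IndepFun (fun ω (i : S) => X i ω) (fun ω (i : T) => X i ω) μ := by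
  have key : ∀ S : Set ι, MeasurableSpace.comap (fun ω (i : S) => X i ω) MeasurableSpace.pi
      = ⨆ i ∈ S, MeasurableSpace.comap (X i) inferInstance := by
    intro S
    simp only [MeasurableSpace.pi, MeasurableSpace.comap_iSup, MeasurableSpace.comap_comp,
      Function.comp_def]
    rw [iSup_subtype']
  rw [IndepFun_iff_Indep, key, key]
  exact indep_iSup_of_disjoint (fun i => (hX i).comap_le) ((iIndepFun_iff_iIndep _ _ _).1 h) hST

/-- Disjoint blocks of an independent family are independent. -/
theorem iIndepFun_blocks {α ι' Ω' β' : Type*} {κ : α → Type*} [MeasurableSpace Ω'] {μ : Measure Ω'}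
    [IsProbabilityMeasure μ] [MeasurableSpace β'] {X : ι' → Ω' → β'}
    (hX : ∀ i, Measurable (X i)) (h : iIndepFun X μ) {f : (Σ a, κ a) → ι'}
    (hf : Function.Injective f) :
    iIndepFun (fun a ω (k : κ a) => X (f ⟨a, k⟩) ω) μ := by
  have h' := h.precomp hf
  have hm : ∀ p, Measurable ((X ∘ f) p) := fun p => hX _
  have e1 := (iIndepFun_iff_map_fun_eq_infinitePi_map hm).1 h'
  have hp : ∀ i j, IsProbabilityMeasure (μ.map (X (f ⟨i, j⟩))) := fun i j =>
    Measure.isProbabilityMeasure_map (hX _).aemeasurable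
  rw [iIndepFun_iff_map_fun_eq_infinitePi_map (fun a => by fun_prop)]
  -- Independence means a product law, and currying turns a product over pairs into a product of
  -- products.
  have e2 : μ.map (fun ω a (k : κ a) => X (f ⟨a, k⟩) ω) =
      Measure.infinitePi fun a => Measure.infinitePi fun k => μ.map (X (f ⟨a, k⟩)) := by
    rw [← Measure.infinitePi_map_piCurry (fun a k => μ.map (X (f ⟨a, k⟩)))]
    have : (Measure.infinitePi fun p : (Σ a, κ a) => μ.map (X (f ⟨p.1, p.2⟩)))
      = μ.map (fun ω p => (X ∘ f) p ω) := e1.symm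
    rw [this, Measure.map_map (by fun_prop) (by fun_prop)]
    rfl
  rw [e2]
  congr 1
  ext1 a
  have h3 : iIndepFun (fun k => X (f ⟨a, k⟩)) μ :=
    h.precomp (g := fun k => f ⟨a, k⟩) (fun k k' hk => by simpa using hf hk)
  exact ((iIndepFun_iff_map_fun_eq_infinitePi_map (fun k => hX _)).1 h3).symm

/-- For independent exponential variables and thresholds that are independent of them, the
probability that every variable exceeds its threshold. -/
theorem measureReal_forall_threshold_le {κ ι' Ω' β' : Type*} [Fintype κ] [MeasurableSpace Ω']
    {μ : Measure Ω'} [IsProbabilityMeasure μ] [MeasurableSpace β'] {X : ι' → Ω' → ℝ}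
    (hX : ∀ i, Measurable (X i)) (hlaw : ∀ i, μ.map (X i) = expMeasure 1) (h : iIndepFun X μ)
    {σ : κ → ι'} (hσ : Function.Injective σ) {Y : Ω' → β'} (hY : Measurable Y)
    (hXY : IndepFun (fun ω k => X (σ k) ω) Y μ) {a : κ → β' → ℝ} (ha : ∀ k, Measurable (a k)) :
    μ.real {ω | ∀ k, a k (Y ω) ≤ X (σ k) ω}
      = ∫ ω, Real.exp (-∑ k, max (a k (Y ω)) 0) ∂μ := by
  set Z : Ω' → κ → ℝ := fun ω k => X (σ k) ω with hZ
  have hZm : Measurable Z := by fun_prop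
  have hmap : μ.map (fun ω => (Y ω, Z ω)) = (μ.map Y).prod (Measure.pi fun _ => expMeasure 1) := by
    rw [(indepFun_iff_map_prod_eq_prod_map_map hY.aemeasurable hZm.aemeasurable).1 hXY.symm]
    congr 1
    have := (iIndepFun_iff_map_fun_eq_pi_map (fun k => (hX (σ k)).aemeasurable)).1
      (h.precomp hσ)
    simpa [hlaw, Function.comp_def] using this
  have : IsProbabilityMeasure (μ.map Y) := Measure.isProbabilityMeasure_map hY.aemeasurable
  set s : Set (β' × (κ → ℝ)) := {p | ∀ k, a k p.1 ≤ p.2 k} with hs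
  have hsm : MeasurableSet s := by
    rw [hs, Set.ofPred_forall]
    exact MeasurableSet.iInter fun k =>
      measurableSet_le ((ha k).comp measurable_fst) ((measurable_pi_apply k).comp measurable_snd)
  have e1 : μ.real {ω | ∀ k, a k (Y ω) ≤ X (σ k) ω} =
      (μ.map (fun ω => (Y ω, Z ω))).real s := by
    rw [map_measureReal_apply (hY.prodMk hZm) hsm]; rfl
  -- With the thresholds frozen the factors separate; a negative threshold is exceeded almost
  -- surely, hence the `max` with 0.
  have e2 : ∀ y, (Measure.pi fun _ : κ => expMeasure 1).real (Prod.mk y ⁻¹' s)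
      = Real.exp (-∑ k, max (a k y) 0) := by
    intro y
    have : Prod.mk y ⁻¹' s = Set.pi univ fun k => Ici (a k y) := by
      ext z; simp [hs, Pi.le_def]
    rw [this, measureReal_def, Measure.pi_pi, ENNReal.toReal_prod, ← Finset.sum_neg_distrib,
      Real.exp_sum]
    exact Finset.prod_congr rfl fun k _ => expMeasure_one_real_Ici _
  rw [e1, hmap, measureReal_def, Measure.prod_apply hsm, ← integral_map (φ := Y)
    (f := fun y => Real.exp (-∑ k, max (a k y) 0)) hY.aemeasurable, ← integral_toReal]
  · exact integral_congr_ae (ae_of_all _ fun y => e2 y)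
  · exact (measurable_measure_prodMk_left hsm).aemeasurable
  · exact ae_of_all _ fun y => measure_lt_top _ _
  · exact Measurable.aestronglyMeasurable (by fun_prop)

end Independence

/-! ### The renewal equation for void probabilities. -/

section Renewal

/-- The probability that each of the first `N` points of a rate 1 Poisson process, shifted by `s`,
is at least its threshold, the thresholds being independent with distribution function `G`. -/
noncomputable def renewalProb (G : ℝ → ℝ) : ℕ → ℝ → ℝ
  | 0, _ => 1
  | N + 1, s => ∫ u, G (s + u) * renewalProb G N (s + u) ∂(expMeasure 1)

/-- The void probability of a rate 1 Poisson process thinned by `1 - G`, shifted by `s`. -/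
noncomputable def voidProb (G : ℝ → ℝ) (R s : ℝ) : ℝ := Real.exp (-∫ t in s..R, (1 - G t))

variable {ν : Measure ℝ} {R : ℝ}

theorem cdf_eq_one_of_le [IsProbabilityMeasure ν] (hν : ν (Ioi R) = 0) {t : ℝ} (ht : R ≤ t) : cdf ν t = 1 := by
  rw [cdf_eq_real, ← sub_eq_zero, ← neg_eq_zero, neg_sub,
    ← probReal_compl_eq_one_sub measurableSet_Iic, compl_Iic, measureReal_eq_zero_iff]
  exact measure_mono_null (Ioi_subset_Ioi ht) hν

theorem intervalIntegrable_one_sub_cdf (a b : ℝ) :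
    IntervalIntegrable (fun t => 1 - cdf ν t) volume a b :=
  intervalIntegrable_const.sub (monotone_cdf ν).intervalIntegrable

theorem voidProb_pos (G : ℝ → ℝ) (R s : ℝ) : 0 < voidProb G R s := Real.exp_pos _

theorem voidProb_cdf_eq_one [IsProbabilityMeasure ν] (hν : ν (Ioi R) = 0) {s : ℝ} (hs : R ≤ s) :
    voidProb (cdf ν) R s = 1 := by
  have : ∫ t in s..R, (1 - cdf ν t) = 0 := by
    rw [intervalIntegral.integral_symm, neg_eq_zero]
    apply intervalIntegral.integral_zero_ae
    refine ae_of_all _ fun t ht => ?_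
    rw [uIoc_of_le hs] at ht
    rw [cdf_eq_one_of_le hν ht.1.le, sub_self]
  rw [voidProb, this, neg_zero, Real.exp_zero]

theorem voidProb_cdf_le_one [IsProbabilityMeasure ν] (hν : ν (Ioi R) = 0) (s : ℝ) : voidProb (cdf ν) R s ≤ 1 := by
  rcases le_total R s with h | h
  · exact (voidProb_cdf_eq_one hν h).le
  · rw [voidProb, Real.exp_le_one_iff, neg_nonpos]
    exact intervalIntegral.integral_nonneg h fun t _ => sub_nonneg.2 (cdf_le_one ν t)

theorem continuous_voidProb_cdf : Continuous (voidProb (cdf ν) R) := by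
  have : voidProb (cdf ν) R = fun s => Real.exp (∫ t in R..s, (1 - cdf ν t)) := by
    ext s; rw [voidProb, intervalIntegral.integral_symm, neg_neg]
  rw [this]
  exact (intervalIntegral.continuous_primitive (fun a b => intervalIntegrable_one_sub_cdf a b)
    R).rexp

/-- A distribution function is only right continuous, so only a right derivative is available; the
fundamental theorem of calculus used below asks for no more. -/
theorem hasDerivWithinAt_voidProb_cdf (s : ℝ) :
    HasDerivWithinAt (voidProb (cdf ν) R) (voidProb (cdf ν) R s * (1 - cdf ν s)) (Ioi s) s := by
  have h1 : HasDerivWithinAt (fun u => ∫ t in u..R, (1 - cdf ν t)) (-(1 - cdf ν s)) (Ioi s) s := by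
    refine (intervalIntegral.integral_hasDerivWithinAt_left (t := Ioi s)
      (intervalIntegrable_one_sub_cdf s R) ?_ ?_).mono Ioi_subset_Ici_self
    · exact (measurable_const.sub (monotone_cdf ν).measurable).stronglyMeasurable
        |>.stronglyMeasurableAtFilter
    · exact continuousWithinAt_const.sub
        (((cdf ν).right_continuous s).mono Ioi_subset_Ici_self)
  simpa using! h1.neg.exp

/-- The void probability `p` solves the equation that defines `renewalProb`: the integrand with its
exponential density is the right derivative of `-(exp (-u) * p (s + u))`, which vanishes at infinity
because `p ≤ 1`. -/
theorem integral_cdf_mul_voidProb [IsProbabilityMeasure ν] (hν : ν (Ioi R) = 0) (s : ℝ) :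
    ∫ u, cdf ν (s + u) * voidProb (cdf ν) R (s + u) ∂(expMeasure 1) = voidProb (cdf ν) R s := by
  rw [integral_expMeasure_one]
  set p := voidProb (cdf ν) R with hp
  set g : ℝ → ℝ := fun u => Real.exp (-u) * (cdf ν (s + u) * p (s + u)) with hg
  have hpc : Continuous p := continuous_voidProb_cdf
  have hgm : Measurable g := by
    have := (monotone_cdf ν).measurable
    have := hpc.measurable
    fun_prop
  have hgb : ∀ u, ‖g u‖ ≤ Real.exp (-u) := fun u => by
    rw [hg, Real.norm_eq_abs, abs_of_nonneg (mul_nonneg (Real.exp_pos _).le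
      (mul_nonneg (cdf_nonneg ν _) (voidProb_pos _ _ _).le))]
    refine mul_le_of_le_one_right (Real.exp_pos _).le ?_
    exact mul_le_one₀ (cdf_le_one ν _) (voidProb_pos _ _ _).le (voidProb_cdf_le_one hν _)
  have hgi : IntegrableOn g (Ioi 0) := by
    refine Integrable.mono' (integrableOn_exp_neg_Ioi 0) hgm.aestronglyMeasurable
      (ae_of_all _ hgb)
  have hfin : ∀ b : ℝ, 0 ≤ b →
      ∫ u in (0 : ℝ)..b, g u = p s - Real.exp (-b) * p (s + b) := by
    intro b hb
    have hd : ∀ u ∈ Ioo 0 b,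
        HasDerivWithinAt (fun u => -(Real.exp (-u) * p (s + u))) (g u) (Ioi u) u := by
      intro u _
      have h1 : HasDerivWithinAt (fun u => p (s + u)) (p (s + u) * (1 - cdf ν (s + u)))
          (Ioi u) u := by
        have := (hasDerivWithinAt_voidProb_cdf (ν := ν) (R := R) (s + u))
        have h2 : HasDerivWithinAt (fun u : ℝ => s + u) 1 (Ioi u) u :=
          ((hasDerivAt_id u).const_add s).hasDerivWithinAt
        simpa using! this.comp u h2 (fun v hv => by simpa using! hv)
      have h3 : HasDerivWithinAt (fun u : ℝ => Real.exp (-u)) (-Real.exp (-u)) (Ioi u) u := by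
        simpa using (hasDerivAt_neg u).exp.hasDerivWithinAt
      refine (h3.mul h1).neg.congr_deriv ?_
      simp only [hg]; ring
    rw [intervalIntegral.integral_eq_sub_of_hasDeriv_right_of_le hb _ hd]
    · simp; ring
    · exact (intervalIntegrable_iff_integrableOn_Ioc_of_le hb).2
        (hgi.mono_set Ioc_subset_Ioi_self)
    · exact Continuous.continuousOn (by fun_prop)
  have hlim := intervalIntegral_tendsto_integral_Ioi 0 hgi tendsto_id
  refine tendsto_nhds_unique hlim ?_
  have h0 : Tendsto (fun b => p s - Real.exp (-b) * p (s + b)) atTop (𝓝 (p s - 0)) := by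
    refine tendsto_const_nhds.sub ?_
    refine squeeze_zero (fun b => mul_nonneg (Real.exp_pos _).le (voidProb_pos _ _ _).le)
      (fun b => mul_le_of_le_one_right (Real.exp_pos _).le (voidProb_cdf_le_one hν _))
      Real.tendsto_exp_neg_atTop_nhds_zero
  rw [sub_zero] at h0
  refine h0.congr' ?_
  filter_upwards [eventually_ge_atTop 0] with b hb using (hfin b hb).symm

theorem renewalProb_measurable (N : ℕ) : Measurable (renewalProb (cdf ν) N) := by
  induction N with
  | zero => exact measurable_const
  | succ N ih =>
    have h1 := (monotone_cdf ν).measurable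
    have : StronglyMeasurable (fun q : ℝ × ℝ =>
      cdf ν (q.1 + q.2) * renewalProb (cdf ν) N (q.1 + q.2)) :=
      Measurable.stronglyMeasurable (by fun_prop)
    exact this.integral_prod_right.measurable

theorem renewalProb_mem_Icc (N : ℕ) (s : ℝ) : renewalProb (cdf ν) N s ∈ Icc (0 : ℝ) 1 := by
  induction N generalizing s with
  | zero => simp [renewalProb]
  | succ N ih =>
    refine ⟨integral_nonneg fun u => mul_nonneg (cdf_nonneg ν _) (ih _).1, ?_⟩
    have : ∫ u, cdf ν (s + u) * renewalProb (cdf ν) N (s + u) ∂(expMeasure 1)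
        ≤ ∫ _, (1 : ℝ) ∂(expMeasure 1) :=
      integral_mono_of_nonneg (ae_of_all _ fun u => mul_nonneg (cdf_nonneg ν _) (ih _).1)
        (integrable_const _) (ae_of_all _ fun u => mul_le_one₀ (cdf_le_one ν _) (ih _).1 (ih _).2)
    simpa [renewalProb] using this

theorem renewalProb_eq_one [IsProbabilityMeasure ν] (hν : ν (Ioi R) = 0) (N : ℕ) {s : ℝ} (hs : R ≤ s) :
    renewalProb (cdf ν) N s = 1 := by
  induction N generalizing s with
  | zero => rfl
  | succ N ih =>
    have : ∫ u, cdf ν (s + u) * renewalProb (cdf ν) N (s + u) ∂(expMeasure 1)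
        = ∫ _, (1 : ℝ) ∂(expMeasure 1) := by
      refine integral_congr_ae ?_
      filter_upwards [ae_expMeasure_one_pos] with u hu
      rw [cdf_eq_one_of_le hν (by linarith), ih (by linarith), one_mul]
    simpa [renewalProb] using this

/-- Both functions equal 1 from `R` on, so one application of the renewal equation passes the error
on only if the gap is at most `R`. This has probability `1 - exp (-R)`, which is the contraction
factor. -/
theorem abs_renewalProb_sub_voidProb_le [IsProbabilityMeasure ν] (hR : 0 ≤ R) (hν : ν (Ioi R) = 0) (N : ℕ) {s : ℝ}
    (hs : 0 ≤ s) :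
    |renewalProb (cdf ν) N s - voidProb (cdf ν) R s| ≤ (1 - Real.exp (-R)) ^ N := by
  have hρ : 0 ≤ 1 - Real.exp (-R) := by
    rw [sub_nonneg, Real.exp_le_one_iff]; linarith
  induction N generalizing s with
  | zero =>
    have := voidProb_pos (cdf ν) R s
    have := voidProb_cdf_le_one hν s
    simp only [renewalProb, pow_zero, abs_le]
    constructor <;> linarith
  | succ N ih =>
    have hGm := (monotone_cdf ν).measurable
    have hpm := (continuous_voidProb_cdf (ν := ν) (R := R)).measurable
    have hrm := renewalProb_measurable (ν := ν) N
    have hint : ∀ f : ℝ → ℝ, Measurable f → (∀ t, f t ∈ Icc (0 : ℝ) 1) →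
        Integrable (fun u => cdf ν (s + u) * f (s + u)) (expMeasure 1) := by
      intro f hf hfb
      refine Integrable.of_bound (Measurable.aestronglyMeasurable (by fun_prop)) 1
        (ae_of_all _ fun u => ?_)
      rw [Real.norm_eq_abs, abs_of_nonneg (mul_nonneg (cdf_nonneg ν _) (hfb _).1)]
      exact mul_le_one₀ (cdf_le_one ν _) (hfb _).1 (hfb _).2
    rw [renewalProb, ← integral_cdf_mul_voidProb hν s, ← integral_sub
      (hint _ hrm (renewalProb_mem_Icc N))
      (hint _ hpm fun t => ⟨(voidProb_pos _ _ _).le, voidProb_cdf_le_one hν t⟩), ← Real.norm_eq_abs]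
    have hbound : ∫ u, (Iic R).indicator (fun _ => (1 - Real.exp (-R)) ^ N) u ∂(expMeasure 1)
        = (1 - Real.exp (-R)) ^ (N + 1) := by
      rw [integral_indicator measurableSet_Iic, setIntegral_const, expMeasure_one_real_Iic hR,
        smul_eq_mul, pow_succ, mul_comm]
    rw [← hbound]
    refine norm_integral_le_of_norm_le ((integrable_const _).indicator measurableSet_Iic) ?_
    filter_upwards [ae_expMeasure_one_pos] with u hu
    rw [← mul_sub, norm_mul, Real.norm_eq_abs, Real.norm_eq_abs, abs_of_nonneg (cdf_nonneg ν _)]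
    by_cases h : u ≤ R
    · rw [indicator_of_mem (mem_Iic.2 h)]
      exact (mul_le_of_le_one_left (abs_nonneg _) (cdf_le_one ν _)).trans (ih (by linarith))
    · rw [renewalProb_eq_one hν N (by linarith), voidProb_cdf_eq_one hν (by linarith)]
      simp [h]

theorem tendsto_renewalProb [IsProbabilityMeasure ν] (hR : 0 ≤ R) (hν : ν (Ioi R) = 0) {s : ℝ} (hs : 0 ≤ s) :
    Tendsto (fun N => renewalProb (cdf ν) N s) atTop (𝓝 (voidProb (cdf ν) R s)) := by
  rw [tendsto_iff_norm_sub_tendsto_zero]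
  refine squeeze_zero (fun _ => norm_nonneg _)
    (fun N => abs_renewalProb_sub_voidProb_le hR hν N hs) ?_
  refine tendsto_pow_atTop_nhds_zero_of_lt_one ?_ ?_
  · rw [sub_nonneg, Real.exp_le_one_iff]; linarith
  · linarith [Real.exp_pos (-R)]

/-- The mean of a nonnegative variable is the integral of its tail, and here the tail vanishes
beyond `R`. -/
theorem voidProb_cdf_zero [IsProbabilityMeasure ν] (hR : 0 ≤ R) (h0 : ν (Iio 0) = 0) (hν : ν (Ioi R) = 0) :
    voidProb (cdf ν) R 0 = Real.exp (-∫ x, x ∂ν) := by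
  have hb : ∀ᵐ x ∂ν, 0 ≤ x ∧ x ≤ R := by
    have a1 : ∀ᵐ x ∂ν, ¬ x < 0 := measure_eq_zero_iff_ae_notMem.1 h0
    have a2 : ∀ᵐ x ∂ν, ¬ R < x := measure_eq_zero_iff_ae_notMem.1 hν
    filter_upwards [a1, a2] with x h1 h2 using ⟨not_lt.1 h1, not_lt.1 h2⟩
  have hi : Integrable (fun x : ℝ => x) ν := by
    refine Integrable.of_bound measurable_id.aestronglyMeasurable R ?_
    filter_upwards [hb] with x hx
    rw [Real.norm_eq_abs, abs_of_nonneg hx.1]; exact hx.2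
  have hi2 : ∀ t, ν.real {a | t < a} = 1 - cdf ν t := fun t => by
    rw [cdf_eq_real, ← probReal_compl_eq_one_sub measurableSet_Iic, compl_Iic]; rfl
  rw [voidProb, hi.integral_eq_integral_meas_lt (hb.mono fun x hx => hx.1),
    intervalIntegral.integral_of_le hR]
  congr 2
  simp_rw [hi2]
  refine setIntegral_eq_of_subset_of_forall_sdiff_eq_zero measurableSet_Ioi
    Ioc_subset_Ioi_self ?_ |>.symm
  intro t ht
  have : R < t := by
    by_contra h
    exact ht.2 ⟨ht.1, not_lt.1 h⟩
  rw [cdf_eq_one_of_le hν this.le, sub_self]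

end Renewal

/-! ### Void probability of a thinned Poisson process. -/

section PoissonVoid

variable {Ω : Type*} [MeasurableSpace Ω] {μ : Measure Ω} [IsProbabilityMeasure μ]

theorem measureReal_eq_integral_of_indepFun {α β : Type*} [MeasurableSpace α] [MeasurableSpace β]
    {U : Ω → α} {W : Ω → β} (hU : Measurable U) (hW : Measurable W) (h : IndepFun U W μ)
    {s : Set (α × β)} (hs : MeasurableSet s) :
    μ.real {ω | (U ω, W ω) ∈ s} = ∫ u, μ.real {ω | (u, W ω) ∈ s} ∂(μ.map U) := by
  have : IsProbabilityMeasure (μ.map W) := Measure.isProbabilityMeasure_map hW.aemeasurable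
  have e1 : μ.real {ω | (U ω, W ω) ∈ s} = (μ.map (fun ω => (U ω, W ω))).real s := by
    rw [map_measureReal_apply (hU.prodMk hW) hs]; rfl
  rw [e1, (indepFun_iff_map_prod_eq_prod_map_map hU.aemeasurable hW.aemeasurable).1 h,
    measureReal_def, Measure.prod_apply hs, ← integral_toReal]
  · refine integral_congr_ae (ae_of_all _ fun u => ?_)
    change (μ.map W).real _ = _
    rw [map_measureReal_apply hW (measurable_prodMk_left hs)]
    rfl
  · exact (measurable_measure_prodMk_left hs).aemeasurable
  · exact ae_of_all _ fun y => measure_lt_top _ _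

/-- Splitting off the first gap restarts the process at `s + u 0`, which is why the starting point
is kept general. -/
theorem forall_le_partialSum_succ_iff (N : ℕ) (s : ℝ) (u a : ℕ → ℝ) :
    (∀ i < N + 1, a i ≤ s + ∑ j ∈ Finset.range (i + 1), u j) ↔
      a 0 ≤ s + u 0 ∧
        ∀ i < N, a (i + 1) ≤ s + u 0 + ∑ j ∈ Finset.range (i + 1), u (j + 1) := by
  rw [Nat.forall_lt_succ_left']
  simp only [Finset.sum_range_succ' u]
  simp [add_assoc, add_comm]

/-- Induction by conditioning on the first gap. Given it, the first threshold contributes a factor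
`cdf ν` and is independent of the other gaps and thresholds, which form a configuration of the same
kind started later. -/
theorem measureReal_forall_le_partialSum {ν : Measure ℝ} (N : ℕ) :
    ∀ (s : ℝ) (U a : ℕ → Ω → ℝ), (∀ i, Measurable (U i)) → (∀ i, Measurable (a i)) →
      (∀ i, μ.map (U i) = expMeasure 1) → (∀ i, μ.map (a i) = ν) →
      iIndepFun (fun p : ℕ ⊕ ℕ => Sum.elim U a p) μ →
      μ.real {ω | ∀ i < N, a i ω ≤ s + ∑ j ∈ Finset.range (i + 1), U j ω}
        = renewalProb (cdf ν) N s := by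
  induction N with
  | zero => intros; simp [renewalProb]
  | succ N ih =>
    intro s U a hU ha hUl hal hind
    have hm : ∀ p : ℕ ⊕ ℕ, Measurable (Sum.elim U a p) := by rintro (p | p) <;> simp [hU, ha]
    let T : Set (ℕ ⊕ ℕ) := {p | p ≠ .inl 0 ∧ p ≠ .inr 0}
    have hT1 : ∀ i, Sum.inl (i + 1) ∈ T := fun i => by simp [T]
    have hT2 : ∀ i, Sum.inr (i + 1) ∈ T := fun i => by simp [T]
    let W : Ω → (ℕ → ℝ) × (ℕ → ℝ) := fun ω => (fun i => U (i + 1) ω, fun i => a (i + 1) ω)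
    have hW : Measurable W := by fun_prop
    have hind1 : IndepFun (U 0) (fun ω => (a 0 ω, W ω)) μ := by
      have := indepFun_of_disjoint_sets hm hind (S := {.inl 0}) (T := {.inl 0}ᶜ)
        disjoint_compl_right
      exact this.comp (φ := fun x : ({.inl 0} : Set (ℕ ⊕ ℕ)) → ℝ => x ⟨.inl 0, rfl⟩)
        (ψ := fun x : ({.inl 0}ᶜ : Set (ℕ ⊕ ℕ)) → ℝ => (x ⟨.inr 0, by simp⟩,
          (fun i => x ⟨.inl (i + 1), by simp⟩, fun i => x ⟨.inr (i + 1), by simp⟩)))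
        (by fun_prop) (by fun_prop)
    have hind2 : IndepFun (a 0) W μ := by
      have := indepFun_of_disjoint_sets hm hind (S := {.inr 0}) (T := {.inr 0}ᶜ)
        disjoint_compl_right
      exact this.comp (φ := fun x : ({.inr 0} : Set (ℕ ⊕ ℕ)) → ℝ => x ⟨.inr 0, rfl⟩)
        (ψ := fun x : ({.inr 0}ᶜ : Set (ℕ ⊕ ℕ)) → ℝ => (fun i => x ⟨.inl (i + 1), by simp⟩, fun i => x ⟨.inr (i + 1), by simp⟩))
        (by fun_prop) (by fun_prop)
    let B : Set (ℝ × ((ℕ → ℝ) × (ℕ → ℝ))) :=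
      {q | ∀ i < N, q.2.2 i ≤ q.1 + ∑ j ∈ Finset.range (i + 1), q.2.1 j}
    have hB : MeasurableSet B := by
      have : B = ⋂ i, ⋂ (_ : i < N), {q | q.2.2 i ≤ q.1 + ∑ j ∈ Finset.range (i + 1), q.2.1 j} := by
        ext; simp [B]
      rw [this]
      refine MeasurableSet.iInter fun i => MeasurableSet.iInter fun _ => ?_
      exact measurableSet_le (by fun_prop) (by fun_prop)
    let C : Set (ℝ × ℝ × ((ℕ → ℝ) × (ℕ → ℝ))) := {q | q.2.1 ≤ s + q.1 ∧ (s + q.1, q.2.2) ∈ B}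
    have hC : MeasurableSet C := by
      have h1 : MeasurableSet {q : ℝ × ℝ × ((ℕ → ℝ) × (ℕ → ℝ)) | q.2.1 ≤ s + q.1} :=
        measurableSet_le (by fun_prop) (by fun_prop)
      refine h1.inter ?_
      exact (show Measurable fun q : ℝ × ℝ × ((ℕ → ℝ) × (ℕ → ℝ)) => (s + q.1, q.2.2)
        by fun_prop) hB
    have e1 : {ω | ∀ i < N + 1, a i ω ≤ s + ∑ j ∈ Finset.range (i + 1), U j ω}
        = {ω | (U 0 ω, (a 0 ω, W ω)) ∈ C} := by
      ext ω
      exact forall_le_partialSum_succ_iff N s (fun i => U i ω) (fun i => a i ω)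
    rw [e1, measureReal_eq_integral_of_indepFun (hU 0) ((ha 0).prodMk hW) hind1 hC, hUl,
      renewalProb]
    refine integral_congr_ae (ae_of_all _ fun u => ?_)
    have hBs : MeasurableSet (Prod.mk (s + u) ⁻¹' B) := measurable_prodMk_left hB
    have e2 : {ω | (u, (a 0 ω, W ω)) ∈ C} = a 0 ⁻¹' Iic (s + u) ∩ W ⁻¹' (Prod.mk (s + u) ⁻¹' B) :=
      rfl
    have : IsProbabilityMeasure ν := hal 0 ▸ Measure.isProbabilityMeasure_map (ha 0).aemeasurable
    beta_reduce
    rw [e2, measureReal_def, hind2.measure_inter_preimage_eq_mul _ _ measurableSet_Iic hBs,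
      ENNReal.toReal_mul]
    congr 1
    · rw [cdf_eq_real, ← hal 0, map_measureReal_apply (ha 0) measurableSet_Iic]
      rfl
    · refine ih (s + u) (fun i => U (i + 1)) (fun i => a (i + 1)) (fun i => hU _) (fun i => ha _)
        (fun i => hUl _) (fun i => hal _) ?_
      have := hind.precomp (g := Sum.map Nat.succ Nat.succ)
        (Nat.succ_injective.sumMap Nat.succ_injective)
      convert! this using 2 with p
      rcases p with p | p <;> rfl

/-- The probability that the points of a rate 1 Poisson process all exceed their independent
identically distributed bounded thresholds. -/
theorem measureReal_forall_le_poissonPoint {ν : Measure ℝ} {R : ℝ} (hR : 0 ≤ R)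
    (h0 : ν (Iio 0) = 0) (hν : ν (Ioi R) = 0) {U a : ℕ → Ω → ℝ} (hU : ∀ i, Measurable (U i))
    (ha : ∀ i, Measurable (a i)) (hUl : ∀ i, μ.map (U i) = expMeasure 1)
    (hal : ∀ i, μ.map (a i) = ν) (hind : iIndepFun (fun p : ℕ ⊕ ℕ => Sum.elim U a p) μ) :
    μ.real {ω | ∀ i, a i ω ≤ ∑ j ∈ Finset.range (i + 1), U j ω} = Real.exp (-∫ x, x ∂ν) := by
  have : IsProbabilityMeasure ν := hal 0 ▸ Measure.isProbabilityMeasure_map (ha 0).aemeasurable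
  rw [← voidProb_cdf_zero hR h0 hν]
  refine tendsto_nhds_unique ?_ (tendsto_renewalProb hR hν le_rfl)
  simp_rw [← measureReal_forall_le_partialSum (μ := μ) _ 0 U a hU ha hUl hal hind, zero_add]
  have e : {ω | ∀ i, a i ω ≤ ∑ j ∈ Finset.range (i + 1), U j ω} =
      ⋂ N, {ω | ∀ i < N, a i ω ≤ ∑ j ∈ Finset.range (i + 1), U j ω} := by
    ext ω
    simp only [mem_ofPred_eq, mem_iInter]
    exact ⟨fun h N i _ => h i, fun h i => h (i + 1) i (Nat.lt_succ_self i)⟩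
  rw [e]
  have := tendsto_measure_iInter_atTop (μ := μ)
    (s := fun N => {ω | ∀ i < N, a i ω ≤ ∑ j ∈ Finset.range (i + 1), U j ω}) ?_ ?_
    ⟨0, measure_ne_top _ _⟩
  · exact (ENNReal.tendsto_toReal (measure_ne_top _ _)).comp this
  · intro N
    refine MeasurableSet.nullMeasurableSet ?_
    have : {ω | ∀ i < N, a i ω ≤ ∑ j ∈ Finset.range (i + 1), U j ω} =
      ⋂ i, ⋂ (_ : i < N), {ω | a i ω ≤ ∑ j ∈ Finset.range (i + 1), U j ω} := by ext; simp
    rw [this]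
    exact MeasurableSet.iInter fun i => MeasurableSet.iInter fun _ =>
      measurableSet_le (ha i) (by fun_prop)
  · intro N M hNM ω h i hi
    exact h i (hi.trans_le hNM)

end PoissonVoid

/-! ### Powers of the positive part. -/

section PosPartPow

/-- The `d`-th power of the positive part. -/
noncomputable def posPow (d x : ℝ) : ℝ := max x 0 ^ d

theorem posPow_nonneg (d x : ℝ) : 0 ≤ posPow d x := Real.rpow_nonneg (le_max_right _ _) _

theorem posPow_mono {d : ℝ} (hd : 0 ≤ d) : Monotone (posPow d) := fun _ _ h =>
  Real.rpow_le_rpow (le_max_right _ _) (max_le_max_right 0 h) hd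

theorem posPow_of_nonneg {d x : ℝ} (hx : 0 ≤ x) : posPow d x = x ^ d := by
  rw [posPow, max_eq_left hx]

theorem posPow_of_nonpos {d x : ℝ} (hd : 0 < d) (hx : x ≤ 0) : posPow d x = 0 := by
  rw [posPow, max_eq_right hx, Real.zero_rpow hd.ne']

theorem continuous_posPow {d : ℝ} (hd : 0 ≤ d) : Continuous (posPow d) :=
  (continuous_id.max continuous_const).rpow_const fun _ => Or.inr hd

/-- Turns a lower bound on an edge length of the `d`-PWIT into a threshold for the Poisson point
behind it. For `a ≤ 0` both sides hold. -/
theorem le_rpow_one_div_iff {d a t : ℝ} (hd : 0 < d) (ht : 0 ≤ t) :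
    a ≤ t ^ (1 / d) ↔ posPow d a ≤ t := by
  rw [one_div]
  rcases le_total a 0 with h | h
  · rw [posPow_of_nonpos hd h]
    exact ⟨fun _ => ht, fun _ => h.trans (Real.rpow_nonneg ht _)⟩
  · rw [posPow_of_nonneg h, Real.le_rpow_inv_iff_of_pos h ht hd]

end PosPartPow

/-! ### Truncated games and valuations on a tree with given lengths. -/

section Tree

/-- Truncation of a real number to the interval `[-h, h]`. -/
def clamp (h x : ℝ) : ℝ := max (-h) (min h x)

theorem clamp_le {h : ℝ} (hh : 0 ≤ h) (x : ℝ) : clamp h x ≤ h :=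
  max_le (by linarith) (min_le_left _ _)

theorem neg_le_clamp (h x : ℝ) : -h ≤ clamp h x := le_max_left _ _

theorem clamp_mono (h : ℝ) : Monotone (clamp h) := fun _ _ hxy =>
  max_le_max_left _ (min_le_min_left _ hxy)

theorem continuous_clamp (h : ℝ) : Continuous (clamp h) :=
  continuous_const.max (continuous_const.min continuous_id)

theorem clamp_of_neg_le {h x : ℝ} (hh : 0 ≤ h) (hx : -h ≤ x) : clamp h x = min h x :=
  max_eq_right (le_min (by linarith) hx)

theorem clamp_of_le {h x : ℝ} (hh : 0 ≤ h) (hx : h ≤ x) : clamp h x = h := by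
  rw [clamp_of_neg_le hh (by linarith), min_eq_left hx]

/-- The value of Graph Exploration at `v` when the game is stopped after `k` moves and the player
who made the last move then receives `h`; the values are truncated to `[-h, h]`. -/
noncomputable def treeValue (h : ℝ) (ℓ : List ℕ → ℕ → ℝ) : ℕ → List ℕ → ℝ
  | 0, _ => h
  | k + 1, v => ⨅ i, clamp h (ℓ v i - treeValue h ℓ k (i :: v))

variable {h : ℝ} {ℓ : List ℕ → ℕ → ℝ}

theorem bddBelow_range_clamp (h : ℝ) (z : ℕ → ℝ) : BddBelow (range fun i => clamp h (z i)) :=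
  ⟨-h, by rintro _ ⟨i, rfl⟩; exact neg_le_clamp h _⟩

theorem treeValue_le (hh : 0 ≤ h) (k : ℕ) (v : List ℕ) : treeValue h ℓ k v ≤ h := by
  cases k with
  | zero => exact le_rfl
  | succ k => exact (ciInf_le (bddBelow_range_clamp h _) 0).trans (clamp_le hh _)

theorem neg_le_treeValue (hh : 0 ≤ h) (k : ℕ) (v : List ℕ) : -h ≤ treeValue h ℓ k v := by
  cases k with
  | zero => exact (by linarith : -h ≤ h)
  | succ k => exact le_ciInf fun i => neg_le_clamp h _

/-- The source of the alternation: the recursion reverses order, so a bound at one depth gives the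
opposite bound at the next. -/
theorem treeValue_succ_le_of_le {j k : ℕ} (hjk : ∀ v, treeValue h ℓ j v ≤ treeValue h ℓ k v)
    (v : List ℕ) : treeValue h ℓ (k + 1) v ≤ treeValue h ℓ (j + 1) v :=
  ciInf_mono (bddBelow_range_clamp h _) fun i => clamp_mono h (by linarith [hjk (i :: v)])

theorem treeValue_even_odd_step (hh : 0 ≤ h) (k : ℕ) :
    (∀ v, treeValue h ℓ (2 * k + 2) v ≤ treeValue h ℓ (2 * k) v) ∧
      (∀ v, treeValue h ℓ (2 * k + 1) v ≤ treeValue h ℓ (2 * k + 3) v) ∧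
      (∀ v, treeValue h ℓ (2 * k + 1) v ≤ treeValue h ℓ (2 * k) v) := by
  induction k with
  | zero =>
    have h0 : ∀ v, treeValue h ℓ 2 v ≤ treeValue h ℓ 0 v := fun v => treeValue_le hh _ _
    exact ⟨h0, treeValue_succ_le_of_le h0, fun v => treeValue_le hh _ _⟩
  | succ k ih =>
    have h1 := treeValue_succ_le_of_le ih.2.1
    have h2 := treeValue_succ_le_of_le ih.2.2
    exact ⟨h1, treeValue_succ_le_of_le h1, treeValue_succ_le_of_le h2⟩

theorem antitone_treeValue_even (hh : 0 ≤ h) (v : List ℕ) :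
    Antitone fun k => treeValue h ℓ (2 * k) v :=
  antitone_nat_of_succ_le fun k => (treeValue_even_odd_step hh k).1 v

theorem monotone_treeValue_odd (hh : 0 ≤ h) (v : List ℕ) :
    Monotone fun k => treeValue h ℓ (2 * k + 1) v :=
  monotone_nat_of_le_succ fun k => (treeValue_even_odd_step hh k).2.1 v

theorem treeValue_odd_le_even (hh : 0 ≤ h) (j k : ℕ) (v : List ℕ) :
    treeValue h ℓ (2 * j + 1) v ≤ treeValue h ℓ (2 * k) v :=
  (monotone_treeValue_odd hh v (le_max_left j k)).trans
    (((treeValue_even_odd_step hh (max j k)).2.2 v).trans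
      (antitone_treeValue_even hh v (le_max_right j k)))

/-- The limit of the upper bounds `treeValue h ℓ (2 * k)`. -/
noncomputable def upperValue (h : ℝ) (ℓ : List ℕ → ℕ → ℝ) (v : List ℕ) : ℝ :=
  ⨅ k, treeValue h ℓ (2 * k) v

/-- The limit of the lower bounds `treeValue h ℓ (2 * k + 1)`. -/
noncomputable def lowerValue (h : ℝ) (ℓ : List ℕ → ℕ → ℝ) (v : List ℕ) : ℝ :=
  ⨆ k, treeValue h ℓ (2 * k + 1) v

theorem bddBelow_treeValue_even (hh : 0 ≤ h) (v : List ℕ) :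
    BddBelow (range fun k => treeValue h ℓ (2 * k) v) :=
  ⟨-h, by rintro _ ⟨i, rfl⟩; exact neg_le_treeValue hh _ _⟩

theorem bddAbove_treeValue_odd (hh : 0 ≤ h) (v : List ℕ) :
    BddAbove (range fun k => treeValue h ℓ (2 * k + 1) v) :=
  ⟨h, by rintro _ ⟨i, rfl⟩; exact treeValue_le hh _ _⟩

theorem tendsto_treeValue_even (hh : 0 ≤ h) (v : List ℕ) :
    Tendsto (fun k => treeValue h ℓ (2 * k) v) atTop (𝓝 (upperValue h ℓ v)) :=
  tendsto_atTop_ciInf (antitone_treeValue_even hh v) (bddBelow_treeValue_even hh v)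

theorem tendsto_treeValue_odd (hh : 0 ≤ h) (v : List ℕ) :
    Tendsto (fun k => treeValue h ℓ (2 * k + 1) v) atTop (𝓝 (lowerValue h ℓ v)) :=
  tendsto_atTop_ciSup (monotone_treeValue_odd hh v) (bddAbove_treeValue_odd hh v)

theorem upperValue_le_even (hh : 0 ≤ h) (k : ℕ) (v : List ℕ) :
    upperValue h ℓ v ≤ treeValue h ℓ (2 * k) v := ciInf_le (bddBelow_treeValue_even hh v) k

theorem odd_le_lowerValue (hh : 0 ≤ h) (k : ℕ) (v : List ℕ) :
    treeValue h ℓ (2 * k + 1) v ≤ lowerValue h ℓ v := le_ciSup (bddAbove_treeValue_odd hh v) k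

theorem lowerValue_le_upperValue (hh : 0 ≤ h) (v : List ℕ) :
    lowerValue h ℓ v ≤ upperValue h ℓ v :=
  ciSup_le fun j => le_ciInf fun k => treeValue_odd_le_even hh j k v

theorem upperValue_le (hh : 0 ≤ h) (v : List ℕ) : upperValue h ℓ v ≤ h :=
  upperValue_le_even hh 0 v

theorem neg_le_lowerValue (hh : 0 ≤ h) (v : List ℕ) : -h ≤ lowerValue h ℓ v :=
  (neg_le_treeValue hh _ v).trans (odd_le_lowerValue hh 0 v)

/-- The infima over depths and over children can be exchanged without any attainment: one inequality
passes to the limit through the continuous `clamp`, the other uses that odd values lie below their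
limit. -/
theorem upperValue_eq_iInf (hh : 0 ≤ h) (v : List ℕ) :
    upperValue h ℓ v = ⨅ i, clamp h (ℓ v i - lowerValue h ℓ (i :: v)) := by
  apply le_antisymm
  · refine le_ciInf fun i => ?_
    have ht : Tendsto (fun k => clamp h (ℓ v i - treeValue h ℓ (2 * k + 1) (i :: v))) atTop
        (𝓝 (clamp h (ℓ v i - lowerValue h ℓ (i :: v)))) :=
      ((continuous_clamp h).tendsto _).comp (tendsto_const_nhds.sub (tendsto_treeValue_odd hh _))
    exact ge_of_tendsto' ht fun k => (upperValue_le_even hh (k + 1) v).trans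
      (ciInf_le (bddBelow_range_clamp h _) i)
  · refine le_ciInf fun k => ?_
    cases k with
    | zero => exact (ciInf_le (bddBelow_range_clamp h _) 0).trans (clamp_le hh _)
    | succ k =>
      exact ciInf_mono (bddBelow_range_clamp h _) fun i =>
        clamp_mono h (sub_le_sub_left (odd_le_lowerValue (ℓ := ℓ) hh k (i :: v)) _)

theorem treeValue_append (h : ℝ) (ℓ : List ℕ → ℕ → ℝ) (k : ℕ) (u v : List ℕ) :
    treeValue h (fun u => ℓ (u ++ v)) k u = treeValue h ℓ k (u ++ v) := by
  induction k generalizing u with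
  | zero => rfl
  | succ k ih => simp only [treeValue, ih]; rfl

/-- Every valuation lies between the truncated game values. -/
theorem IsValuation.between {θ : ℝ} (hθ : 0 ≤ θ) (hℓ : ∀ v i, 0 ≤ ℓ v i)
    {f : {v : List ℕ // InCluster θ ℓ v} → ℝ} (hf : IsValuation θ ℓ f) (k : ℕ) :
    (∀ v, f v ≤ treeValue (θ / 2) ℓ (2 * k) v.1) ∧
      (∀ v, treeValue (θ / 2) ℓ (2 * k + 1) v.1 ≤ f v) := by
  have hh : 0 ≤ θ / 2 := by linarith
  have step1 : ∀ k, (∀ v, f v ≤ treeValue (θ / 2) ℓ k v.1) →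
      ∀ v, treeValue (θ / 2) ℓ (k + 1) v.1 ≤ f v := by
    intro k hk v
    rcases (hf v).1 with h1 | ⟨i, hi, h1⟩
    · rw [h1]; exact treeValue_le hh _ _
    · have h2 := hk ⟨i :: v.1, hi⟩
      refine (ciInf_le (bddBelow_range_clamp _ _) i).trans ?_
      have h3 := treeValue_le (ℓ := ℓ) hh k (i :: v.1)
      -- Nonnegative lengths and child values at most `θ / 2` keep the difference above `-(θ / 2)`,
      -- so the lower truncation is inactive.
      rw [clamp_of_neg_le hh (by linarith [hℓ v.1 i]), h1]
      exact (min_le_right _ _).trans (sub_le_sub_left h2 _)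
  have step2 : ∀ k, (∀ v, treeValue (θ / 2) ℓ k v.1 ≤ f v) →
      ∀ v, f v ≤ treeValue (θ / 2) ℓ (k + 1) v.1 := by
    intro k hk v
    refine le_ciInf fun i => ?_
    have h0 : f v ≤ θ / 2 := (hf v).2 (mem_insert _ _)
    by_cases hi : ℓ v.1 i ≤ θ
    · have hc : InCluster θ ℓ (i :: v.1) := .child _ _ v.2 hi
      have h1 : f v ≤ ℓ v.1 i - f ⟨i :: v.1, hc⟩ := (hf v).2 (mem_insert_of_mem _ ⟨i, hc, rfl⟩)
      have h2 := hk ⟨i :: v.1, hc⟩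
      exact le_max_of_le_right (le_min h0 (by simp only at h2; linarith))
    -- A child outside the cluster has length above `θ`, so its term is truncated to `θ / 2` and
    -- does not affect the minimum.
    · rw [clamp_of_le hh (by linarith [treeValue_le (ℓ := ℓ) hh k (i :: v.1), not_le.1 hi])]
      exact h0
  induction k with
  | zero =>
    have h0 : ∀ v, f v ≤ treeValue (θ / 2) ℓ 0 v.1 := fun v => (hf v).2 (mem_insert _ _)
    exact ⟨h0, step1 0 h0⟩
  | succ k ih =>
    have h1 := step2 _ ih.2
    exact ⟨h1, step1 _ h1⟩

/-- When the two limits agree, `upperValue_eq_iInf` is the valuation recursion. A least element also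
requires the infimum to be attained: the lengths tend to infinity, so only finitely many children
offer less than `θ / 2`. -/
theorem isValuation_upperValue {θ : ℝ} (hθ : 0 ≤ θ) (hℓ : ∀ v i, 0 ≤ ℓ v i)
    (hlim : ∀ v, Tendsto (ℓ v) atTop atTop)
    (heq : ∀ v, upperValue (θ / 2) ℓ v = lowerValue (θ / 2) ℓ v) :
    IsValuation θ ℓ fun v => upperValue (θ / 2) ℓ v.1 := by
  have hh : 0 ≤ θ / 2 := by linarith
  intro v
  have hrec := upperValue_eq_iInf (ℓ := ℓ) hh v.1
  simp only [← heq] at hrec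
  have hz : ∀ i, -(θ / 2) ≤ ℓ v.1 i - upperValue (θ / 2) ℓ (i :: v.1) := fun i => by
    linarith [hℓ v.1 i, upperValue_le (ℓ := ℓ) hh (i :: v.1)]
  constructor
  · by_cases hlt : upperValue (θ / 2) ℓ v.1 = θ / 2
    · exact Or.inl hlt
    right
    have hlt' := lt_of_le_of_ne (upperValue_le hh v.1) hlt
    set z : ℕ → ℝ := fun i => clamp (θ / 2) (ℓ v.1 i - upperValue (θ / 2) ℓ (i :: v.1)) with hzdef
    have hfin : {i | z i < θ / 2}.Finite := by
      obtain ⟨N, hN⟩ := eventually_atTop.1 ((hlim v.1).eventually_ge_atTop θ)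
      refine (finite_lt_nat N).subset fun i hi => ?_
      by_contra hNi
      have h1 := hN i (not_lt.1 hNi)
      have h2 := upperValue_le (ℓ := ℓ) hh (i :: v.1)
      have : z i = θ / 2 := clamp_of_le hh (by linarith)
      rw [mem_ofPred_eq, this] at hi
      exact lt_irrefl _ hi
    have hne : {i | z i < θ / 2}.Nonempty := by
      rw [hrec] at hlt'
      obtain ⟨i, hi⟩ := exists_lt_of_ciInf_lt hlt'
      exact ⟨i, hi⟩
    obtain ⟨i, hi, hmin⟩ := exists_min_image _ z hfin hne
    have hzi : upperValue (θ / 2) ℓ v.1 = z i := by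
      rw [hrec]
      refine le_antisymm (ciInf_le (bddBelow_range_clamp _ _) i) (le_ciInf fun j => ?_)
      by_cases hj : z j < θ / 2
      · exact hmin j hj
      · exact (le_of_lt hi).trans (not_lt.1 hj)
    have hzi2 : z i = ℓ v.1 i - upperValue (θ / 2) ℓ (i :: v.1) := by
      have h1 : z i = min (θ / 2) (ℓ v.1 i - upperValue (θ / 2) ℓ (i :: v.1)) :=
        clamp_of_neg_le hh (hz i)
      have h2 : z i < θ / 2 := hi
      rcases min_choice (θ / 2) (ℓ v.1 i - upperValue (θ / 2) ℓ (i :: v.1)) with h3 | h3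
      · rw [h1, h3] at h2; exact absurd h2 (lt_irrefl _)
      · rw [h1, h3]
    refine ⟨i, .child _ _ v.2 ?_, hzi.trans hzi2⟩
    have h2 : z i < θ / 2 := hi
    linarith [upperValue_le (ℓ := ℓ) hh (i :: v.1)]
  · rintro x (rfl | ⟨i, hi, rfl⟩)
    · exact upperValue_le hh _
    · refine (hrec.trans_le (ciInf_le (bddBelow_range_clamp _ _) i)).trans ?_
      rw [clamp_of_neg_le hh (hz i)]
      exact min_le_right _ _

theorem IsValuation.eq_upperValue {θ : ℝ} (hθ : 0 ≤ θ) (hℓ : ∀ v i, 0 ≤ ℓ v i)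
    (heq : ∀ v, upperValue (θ / 2) ℓ v = lowerValue (θ / 2) ℓ v)
    {f : {v : List ℕ // InCluster θ ℓ v} → ℝ} (hf : IsValuation θ ℓ f) :
    f = fun v => upperValue (θ / 2) ℓ v.1 := by
  ext v
  refine le_antisymm (le_ciInf fun k => (hf.between hθ hℓ k).1 v) ?_
  rw [heq]
  exact ciSup_le fun k => (hf.between hθ hℓ k).2 v

end Tree

/-! ### The law of the truncated values on the `d`-PWIT. -/

section TreeLaw

/-- The gaps of the Poisson processes of the `d`-PWIT, as a point of the canonical space. -/
noncomputable def pwitMeasure : Measure (List ℕ × ℕ → ℝ) :=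
  Measure.infinitePi fun _ => expMeasure 1

instance isProbabilityMeasure_pwitMeasure : IsProbabilityMeasure pwitMeasure := by
  unfold pwitMeasure; infer_instance

/-- The edge lengths of the `d`-PWIT on the canonical space. -/
noncomputable def canonicalLength (d : ℝ) (e : List ℕ × ℕ → ℝ) : List ℕ → ℕ → ℝ :=
  pwitLength d fun v i => e (v, i)

/-- The gaps in the subtree of descendants of `v`. -/
def subtree (v : List ℕ) (e : List ℕ × ℕ → ℝ) : List ℕ × ℕ → ℝ := fun p => e (p.1 ++ v, p.2)

theorem measurable_subtree (v : List ℕ) : Measurable (subtree v) := by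
  unfold subtree; fun_prop

theorem map_subtree (v : List ℕ) : pwitMeasure.map (subtree v) = pwitMeasure := by
  have hinj : Function.Injective fun p : List ℕ × ℕ => (p.1 ++ v, p.2) := by
    rintro ⟨a, b⟩ ⟨a', b'⟩ hab
    simpa using hab
  exact Measure.map_infinitePi_infinitePi_of_inj (P := fun _ => expMeasure 1) hinj

theorem map_eval_pwitMeasure (p : List ℕ × ℕ) :
    pwitMeasure.map (fun e => e p) = expMeasure 1 :=
  Measure.infinitePi_map_eval (fun _ => expMeasure 1) p

theorem treeValue_subtree (d h : ℝ) (k : ℕ) (v : List ℕ) (e : List ℕ × ℕ → ℝ) :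
    treeValue h (canonicalLength d (subtree v e)) k [] = treeValue h (canonicalLength d e) k v :=
  treeValue_append h (canonicalLength d e) k [] v

theorem measurable_treeValue (d h : ℝ) (k : ℕ) (v : List ℕ) :
    Measurable fun e => treeValue h (canonicalLength d e) k v := by
  induction k generalizing v with
  | zero => exact measurable_const
  | succ k ih =>
    refine Measurable.iInf fun i => (continuous_clamp h).measurable.comp (Measurable.sub ?_ (ih _))
    unfold canonicalLength pwitLength
    fun_prop

theorem ae_pos_pwitMeasure : ∀ᵐ e ∂pwitMeasure, ∀ p, 0 < e p := by
  rw [ae_all_iff]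
  intro p
  have := ae_expMeasure_one_pos
  rw [← map_eval_pwitMeasure p] at this
  exact ae_of_ae_map (measurable_pi_apply p).aemeasurable this

theorem iIndepFun_eval_pwitMeasure :
    iIndepFun (fun (p : List ℕ × ℕ) (e : List ℕ × ℕ → ℝ) => e p) pwitMeasure :=
  iIndepFun_infinitePi (P := fun _ => expMeasure 1) (X := fun _ x => x) (by fun_prop)

/-- The gaps at the root and functions of the subtrees of its children are all independent. -/
theorem iIndepFun_root_gaps_subtrees {y : (List ℕ × ℕ → ℝ) → ℝ} (hy : Measurable y) :
    iIndepFun (fun p : ℕ ⊕ ℕ =>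
      Sum.elim (fun i (e : List ℕ × ℕ → ℝ) => e ([], i)) (fun i e => y (subtree [i] e)) p)
      pwitMeasure := by
  let κ : ℕ ⊕ ℕ → Type := Sum.elim (fun _ => Unit) (fun _ => List ℕ × ℕ)
  -- New steps are added at the head of a list, so the subtree of child `i` consists of the lists
  -- ending in `i`. These blocks are disjoint from each other and from the root gaps.
  let f : (Σ a, κ a) → List ℕ × ℕ := fun q => match q with
    | ⟨.inl i, _⟩ => ([], i)
    | ⟨.inr i, p⟩ => (p.1 ++ [i], p.2)
  have hf : Function.Injective f := by
    rintro ⟨i | i, p⟩ ⟨j | j, q⟩ hpq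
    · obtain rfl : i = j := by simpa [f] using hpq
      rfl
    · simp [f] at hpq
    · simp [f] at hpq
    · obtain ⟨p1, p2⟩ := p
      obtain ⟨q1, q2⟩ := q
      have h1 : p1 ++ [i] = q1 ++ [j] ∧ p2 = q2 := by simpa only [f, Prod.mk.injEq] using hpq
      obtain ⟨h2, rfl⟩ := h1
      obtain ⟨rfl, h3⟩ := List.append_inj' h2 rfl
      obtain rfl : i = j := by simpa using h3
      rfl
  have hb := iIndepFun_blocks (X := fun (p : List ℕ × ℕ) (e : List ℕ × ℕ → ℝ) => e p)
    (by fun_prop) iIndepFun_eval_pwitMeasure hf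
  let g : ∀ a : ℕ ⊕ ℕ, (κ a → ℝ) → ℝ := fun a => match a with
    | .inl _ => fun z => z ()
    | .inr _ => fun z => y z
  have hg : ∀ a, Measurable (g a) := by
    rintro (i | i)
    · exact measurable_pi_apply (X := fun _ : Unit => ℝ) ()
    · exact hy
  have hc := hb.comp g hg
  convert! hc using 2 with p
  rcases p with i | i <;> rfl

/-- The law of the truncated game value at the root. -/
theorem measureReal_le_treeValue_succ {d h : ℝ} (hd : 0 < d) (hh : 0 ≤ h) (k : ℕ) {x : ℝ}
    (hx : x ∈ Icc (-h) h) :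
    pwitMeasure.real {e | x ≤ treeValue h (canonicalLength d e) (k + 1) []} =
      Real.exp (-∫ e, posPow d (x + treeValue h (canonicalLength d e) k []) ∂pwitMeasure) := by
  set y : (List ℕ × ℕ → ℝ) → ℝ := fun e => posPow d (x + treeValue h (canonicalLength d e) k [])
    with hy
  have hym : Measurable y :=
    (continuous_posPow hd.le).measurable.comp (measurable_const.add (measurable_treeValue d h k []))
  have hyb : ∀ e, y e ≤ posPow d (2 * h) := fun e =>
    posPow_mono hd.le (by linarith [hx.2, treeValue_le (ℓ := canonicalLength d e) hh k []])
  have hlaw : ∀ i : ℕ, pwitMeasure.map (fun e => y (subtree [i] e)) = pwitMeasure.map y := by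
    intro i
    rw [← Function.comp_def, ← Measure.map_map hym (measurable_subtree _), map_subtree]
  -- The root value is at least `x` exactly when each Poisson point is at least `posPow d (x + value
  -- of the child)`. These thresholds are independent, identically distributed and at most `posPow d
  -- (2 * h)`.
  have hvoid := measureReal_forall_le_poissonPoint (μ := pwitMeasure) (ν := pwitMeasure.map y)
    (R := posPow d (2 * h)) (posPow_nonneg _ _) ?_ ?_
    (U := fun i e => e ([], i)) (a := fun i e => y (subtree [i] e))
    (fun i => by fun_prop) (fun i => hym.comp (measurable_subtree _))
    (fun i => map_eval_pwitMeasure _) hlaw (iIndepFun_root_gaps_subtrees hym)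
  · have hint : ∫ z, z ∂(pwitMeasure.map y) = ∫ e, y e ∂pwitMeasure :=
      integral_map hym.aemeasurable measurable_id.aestronglyMeasurable
    rw [← hint, ← hvoid]
    refine measureReal_congr ?_
    filter_upwards [ae_pos_pwitMeasure] with e he
    refine propext ?_
    change x ≤ treeValue h (canonicalLength d e) (k + 1) [] ↔
      ∀ i, y (subtree [i] e) ≤ ∑ j ∈ Finset.range (i + 1), e ([], j)
    rw [treeValue, le_ciInf_iff (bddBelow_range_clamp h _)]
    refine forall_congr' fun i => ?_
    have hT : 0 ≤ ∑ j ∈ Finset.range (i + 1), e ([], j) := Finset.sum_nonneg fun j _ => (he _).le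
    have hz : 0 ≤ canonicalLength d e [] i := Real.rpow_nonneg hT _
    have hle := treeValue_le (ℓ := canonicalLength d e) hh k [i]
    rw [clamp_of_neg_le hh (by linarith), le_min_iff, and_iff_right hx.2, hy]
    beta_reduce
    rw [treeValue_subtree, ← le_rpow_one_div_iff hd hT]
    exact le_sub_iff_add_le
  · rw [Measure.map_apply hym measurableSet_Iio]
    convert measure_empty (μ := pwitMeasure) using 2
    ext e
    simp [hy, posPow_nonneg]
  · rw [Measure.map_apply hym measurableSet_Ioi]
    convert measure_empty (μ := pwitMeasure) using 2
    ext e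
    simp [hyb]

/-- The first `N` gaps at a vertex are all at most `R` with probability `(1 - exp (-R)) ^ N`, so
almost surely the gaps are unbounded, and a single large gap already makes the partial sums large.
-/
theorem ae_tendsto_canonicalLength {d : ℝ} (hd : 0 < d) :
    ∀ᵐ e ∂pwitMeasure, ∀ v, Tendsto (canonicalLength d e v) atTop atTop := by
  rw [ae_all_iff]
  intro v
  have hub : ∀ R : ℕ, ∀ᵐ e ∂pwitMeasure, ¬ ∀ i, e (v, i) ≤ (R : ℝ) := by
    intro R
    rw [ae_iff]
    simp only [not_not]
    rw [← measureReal_eq_zero_iff]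
    have hN : ∀ N : ℕ, pwitMeasure.real {e | ∀ i, e (v, i) ≤ (R : ℝ)} ≤ (1 - Real.exp (-(R : ℝ))) ^ N := by
      intro N
      have hind := iIndepFun_eval_pwitMeasure.precomp (g := fun i : ℕ => (v, i))
        (fun i j hij => by simpa using hij)
      have h1 := hind.measure_inter_preimage_eq_mul (Finset.range N)
        (sets := fun _ => Iic (R : ℝ)) (fun _ _ => measurableSet_Iic)
      have h2 : ∀ i : ℕ, pwitMeasure ((fun e : List ℕ × ℕ → ℝ => e (v, i)) ⁻¹' Iic (R : ℝ))
          = expMeasure 1 (Iic (R : ℝ)) := fun i => by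
        rw [← map_eval_pwitMeasure (v, i), Measure.map_apply (by fun_prop) measurableSet_Iic]
      have h3 : (expMeasure 1).real (Iic (R : ℝ)) ^ N = pwitMeasure.real
          (⋂ i ∈ Finset.range N, (fun e : List ℕ × ℕ → ℝ => e (v, i)) ⁻¹' Iic (R : ℝ)) := by
        rw [measureReal_def, measureReal_def]
        have h4 : pwitMeasure
            (⋂ i ∈ Finset.range N, (fun e : List ℕ × ℕ → ℝ => e (v, i)) ⁻¹' Iic (R : ℝ)) =
            ∏ i ∈ Finset.range N, pwitMeasure ((fun e : List ℕ × ℕ → ℝ => e (v, i)) ⁻¹' Iic (R : ℝ)) :=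
          h1
        rw [h4]
        simp [h2]
      rw [← expMeasure_one_real_Iic (Nat.cast_nonneg R), h3]
      refine measureReal_mono fun e he => ?_
      simpa using fun i _ => he i
    refine le_antisymm ?_ measureReal_nonneg
    refine ge_of_tendsto' (tendsto_pow_atTop_nhds_zero_of_lt_one ?_ ?_) hN
    · rw [sub_nonneg, Real.exp_le_one_iff]
      simp
    · linarith [Real.exp_pos (-(R : ℝ))]
  filter_upwards [ae_all_iff.2 hub, ae_pos_pwitMeasure] with e he hpos
  have hmono : Monotone fun i => ∑ j ∈ Finset.range (i + 1), e (v, j) :=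
    monotone_nat_of_le_succ fun i => by
      rw [Finset.sum_range_succ _ (i + 1)]
      linarith [hpos (v, i + 1)]
  refine (tendsto_rpow_atTop (one_div_pos.2 hd)).comp (tendsto_atTop_mono' _ ?_
    (tendsto_atTop_atTop_of_monotone hmono fun b => ?_))
  · exact Eventually.of_forall fun i => le_rfl
  · by_contra! hcon
    obtain ⟨R, hR⟩ := exists_nat_ge b
    refine he R fun i => ?_
    refine le_trans ?_ ((hcon i).le.trans hR)
    exact Finset.single_le_sum (f := fun j => e (v, j)) (fun j _ => (hpos _).le)
      (Finset.self_mem_range_succ i)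

end TreeLaw

/-! ### Moments in terms of tails, and the symmetry argument. -/

section LayerCake

variable {d h x : ℝ}

theorem intervalIntegrable_rpow_sub_one (hd : 1 ≤ d) (a b : ℝ) :
    IntervalIntegrable (fun l : ℝ => l ^ (d - 1)) volume a b :=
  (Real.continuous_rpow_const (by linarith)).intervalIntegrable a b

/-- The indicator stops the integral of `d * l ^ (d - 1)` at `x + y`. On the fixed interval from 0
to `h + x`, the expectation over `y` can be taken under the integral sign. -/
theorem posPow_eq_integral (hd : 1 ≤ d) (hx : 0 ≤ h + x) {y : ℝ} (hy : y ≤ h) :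
    posPow d (x + y) =
      d * ∫ l in (0 : ℝ)..(h + x), l ^ (d - 1) * (if l - x ≤ y then 1 else 0) := by
  have hd0 : 0 < d := by linarith
  rcases le_total (x + y) 0 with h0 | h0
  · rw [posPow_of_nonpos hd0 h0, intervalIntegral.integral_zero_ae, mul_zero]
    refine ae_of_all _ fun l hl => ?_
    rw [uIoc_of_le hx] at hl
    rw [if_neg (by linarith [hl.1]), mul_zero]
  · have h1 : IntervalIntegrable (fun l : ℝ => l ^ (d - 1) * (if l - x ≤ y then 1 else 0))
        volume 0 (x + y) := by
      refine (intervalIntegrable_rpow_sub_one hd 0 (x + y)).congr fun l hl => ?_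
      rw [uIoc_of_le h0] at hl
      rw [if_pos (by linarith [hl.2]), mul_one]
    have h2 : EqOn (fun _ : ℝ => (0 : ℝ))
        (fun l : ℝ => l ^ (d - 1) * (if l - x ≤ y then 1 else 0)) (uIoc (x + y) (h + x)) := by
      intro l hl
      rw [uIoc_of_le (by linarith)] at hl
      beta_reduce
      rw [if_neg (by linarith [hl.1]), mul_zero]
    rw [← intervalIntegral.integral_add_adjacent_intervals h1
      ((intervalIntegrable_const).congr h2), ← intervalIntegral.integral_congr_ae (ae_of_all _ h2)]
    have h3 : ∫ l in (0 : ℝ)..(x + y), l ^ (d - 1) * (if l - x ≤ y then 1 else 0)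
        = ∫ l in (0 : ℝ)..(x + y), l ^ (d - 1) := by
      refine intervalIntegral.integral_congr_ae (ae_of_all _ fun l hl => ?_)
      rw [uIoc_of_le h0] at hl
      rw [if_pos (by linarith [hl.2]), mul_one]
    rw [h3, integral_rpow (Or.inl (by linarith)), posPow_of_nonneg h0]
    simp [Real.zero_rpow hd0.ne']
    field_simp

variable {Ω : Type*} [MeasurableSpace Ω] {μ : Measure Ω} [IsProbabilityMeasure μ]

theorem integrable_rpow_mul_of_bounded (hd : 1 ≤ d) (h x : ℝ) {g : Ω → ℝ → ℝ}
    (hg : Measurable fun p : Ω × ℝ => g p.1 p.2) {C : ℝ} (hgC : ∀ ω l, |g ω l| ≤ C) :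
    Integrable (Function.uncurry fun (ω : Ω) (l : ℝ) => l ^ (d - 1) * g ω l)
      (μ.prod (volume.restrict (Ioc 0 (h + x)))) := by
  have h1 : Integrable (fun p : Ω × ℝ => p.2 ^ (d - 1)) (μ.prod (volume.restrict (Ioc 0 (h + x)))) :=
    Integrable.comp_snd (f := fun l : ℝ => l ^ (d - 1)) (by
      have := (intervalIntegrable_rpow_sub_one hd 0 (h + x)).1
      exact this) μ
  exact h1.mul_bdd (c := C) hg.aestronglyMeasurable (ae_of_all _ fun p => hgC _ _)

/-- The mean of the `d`-th power of the positive part of `x + Y`, in terms of the tail of `Y`. -/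
theorem integral_posPow_eq (hd : 1 ≤ d) (hx : 0 ≤ h + x) {Y : Ω → ℝ} (hY : Measurable Y)
    (hYh : ∀ ω, Y ω ≤ h) :
    ∫ ω, posPow d (x + Y ω) ∂μ =
      d * ∫ l in (0 : ℝ)..(h + x), l ^ (d - 1) * μ.real {ω | l - x ≤ Y ω} := by
  simp_rw [fun ω => posPow_eq_integral hd hx (hYh ω)]
  rw [integral_const_mul]
  congr 1
  simp_rw [intervalIntegral.integral_of_le hx]
  have hset : MeasurableSet {p : Ω × ℝ | p.2 - x ≤ Y p.1} :=
    measurableSet_le (by fun_prop) (by fun_prop)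
  rw [integral_integral_swap (integrable_rpow_mul_of_bounded hd h x
    (g := fun ω l => if l - x ≤ Y ω then 1 else 0)
    (Measurable.ite hset measurable_const measurable_const) (C := 1)
    (fun ω l => by split_ifs <;> simp))]
  congr 1
  ext l
  rw [integral_const_mul]
  congr 1
  have hs : MeasurableSet {ω | l - x ≤ Y ω} := measurableSet_le measurable_const hY
  rw [← integral_indicator_one hs]
  congr 1

theorem continuous_integral_posPow (hd : 0 ≤ d) {Y : Ω → ℝ} (hY : Measurable Y)
    (hYh : ∀ ω, Y ω ≤ h) : Continuous fun x => ∫ ω, posPow d (x + Y ω) ∂μ := by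
  rw [continuous_iff_continuousAt]
  intro x₀
  refine continuousAt_of_dominated (bound := fun _ => posPow d (x₀ + 1 + h)) ?_ ?_
    (integrable_const _) ?_
  · exact Eventually.of_forall fun x =>
      ((continuous_posPow hd).measurable.comp (measurable_const.add hY)).aestronglyMeasurable
  · filter_upwards [eventually_le_nhds (show x₀ < x₀ + 1 by linarith)] with x hx
    refine ae_of_all _ fun ω => ?_
    rw [Real.norm_eq_abs, abs_of_nonneg (posPow_nonneg _ _)]
    exact posPow_mono hd (by linarith [hYh ω])
  · exact ae_of_all _ fun ω =>
      ((continuous_posPow hd).comp (continuous_id.add continuous_const)).continuousAt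

theorem integrable_posPow (hd : 0 ≤ d) (x : ℝ) {Y : Ω → ℝ} (hY : Measurable Y)
    (hYh : ∀ ω, Y ω ≤ h) : Integrable (fun ω => posPow d (x + Y ω)) μ := by
  refine Integrable.of_bound ((continuous_posPow hd).measurable.comp
    (measurable_const.add hY)).aestronglyMeasurable (posPow d (x + h)) (ae_of_all _ fun ω => ?_)
  rw [Real.norm_eq_abs, abs_of_nonneg (posPow_nonneg _ _)]
  exact posPow_mono hd (by linarith [hYh ω])

theorem integral_posPow_mono (hd : 0 ≤ d) {Y : Ω → ℝ} (hY : Measurable Y)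
    (hYh : ∀ ω, Y ω ≤ h) : Monotone fun x => ∫ ω, posPow d (x + Y ω) ∂μ := fun _ _ hxy =>
  integral_mono (integrable_posPow hd _ hY hYh) (integrable_posPow hd _ hY hYh) fun _ =>
    posPow_mono hd (by linarith)

/-- If `X` has tail `exp (-φ)` on `[-h, h]`, then `φ X` is a truncated exponential variable. -/
theorem integral_comp_neg_log_tail (hh : 0 ≤ h) {X : Ω → ℝ} (hX : Measurable X)
    (hXl : ∀ ω, -h ≤ X ω) (hXh : ∀ ω, X ω ≤ h) {φ : ℝ → ℝ} (hφ : Continuous φ)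
    (hmono : Monotone φ) (hφ0 : φ (-h) = 0)
    (htail : ∀ x ∈ Icc (-h) h, μ.real {ω | x ≤ X ω} = Real.exp (-φ x)) :
    ∫ ω, φ (X ω) ∂μ = 1 - Real.exp (-φ h) := by
  have hφm : Measurable fun ω => φ (X ω) := hφ.measurable.comp hX
  have hnn : ∀ ω, 0 ≤ φ (X ω) := fun ω => hφ0 ▸ hmono (hXl ω)
  have hle : ∀ ω, φ (X ω) ≤ φ h := fun ω => hmono (hXh ω)
  have hφh : 0 ≤ φ h := hφ0 ▸ hmono (by linarith)
  have hint : Integrable (fun ω => φ (X ω)) μ :=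
    Integrable.of_bound hφm.aestronglyMeasurable (φ h) (ae_of_all _ fun ω => by
      rw [Real.norm_eq_abs, abs_of_nonneg (hnn ω)]; exact hle ω)
  rw [hint.integral_eq_integral_Ioc_meas_le (M := φ h) (ae_of_all _ hnn) (ae_of_all _ hle)]
  have hcongr : ∫ t in Ioc 0 (φ h), μ.real {ω | t ≤ φ (X ω)}
      = ∫ t in Ioc 0 (φ h), Real.exp (-t) := by
    refine integral_congr_ae ?_
    -- `φ` need not be injective. If `φ x = t`, then `{t < φ X} ⊆ {x ≤ X} ⊆ {t ≤ φ X}`, and the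
    -- outer sets have equal measure for almost every `t`.
    filter_upwards [ae_restrict_of_ae (meas_le_ae_eq_meas_lt μ volume fun ω => φ (X ω)),
      ae_restrict_mem measurableSet_Ioc] with t ht htm
    obtain ⟨x, hx, hxt⟩ := intermediate_value_Icc (by linarith : -h ≤ h) hφ.continuousOn
      (show t ∈ Icc (φ (-h)) (φ h) from ⟨hφ0 ▸ htm.1.le, htm.2⟩)
    have h1 : μ.real {ω | t < φ (X ω)} ≤ Real.exp (-t) := by
      rw [← hxt, ← htail x hx]
      refine measureReal_mono fun ω hω => ?_
      by_contra hc
      exact absurd (hmono (not_le.1 hc).le) (not_le.2 hω)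
    have h2 : Real.exp (-t) ≤ μ.real {ω | t ≤ φ (X ω)} := by
      rw [← hxt, ← htail x hx]
      exact measureReal_mono fun ω hω => hmono hω
    have h3 : μ.real {ω | t ≤ φ (X ω)} = μ.real {ω | t < φ (X ω)} := congrArg ENNReal.toReal ht
    linarith
  rw [hcongr, ← intervalIntegral.integral_of_le hφh, intervalIntegral.integral_comp_neg,
    integral_exp]
  simp

/-- Two ordered random variables in `[-h, h]`, each of which has the tail that the recursion
produces from the other one, are almost surely equal. -/
theorem ae_eq_of_mutual_tails (hd : 1 ≤ d) (hh : 0 ≤ h) {A B : Ω → ℝ} (hA : Measurable A)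
    (hB : Measurable B) (hBA : ∀ ω, B ω ≤ A ω) (hBl : ∀ ω, -h ≤ B ω) (hAh : ∀ ω, A ω ≤ h)
    (htA : ∀ x ∈ Icc (-h) h, μ.real {ω | x ≤ A ω} = Real.exp (-∫ ω, posPow d (x + B ω) ∂μ))
    (htB : ∀ x ∈ Icc (-h) h, μ.real {ω | x ≤ B ω} = Real.exp (-∫ ω, posPow d (x + A ω) ∂μ)) :
    ∀ᵐ ω ∂μ, A ω = B ω := by
  have hd0 : 0 < d := by linarith
  have hBh : ∀ ω, B ω ≤ h := fun ω => (hBA ω).trans (hAh ω)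
  have hAl : ∀ ω, -h ≤ A ω := fun ω => (hBl ω).trans (hBA ω)
  have hzero : ∀ Y : Ω → ℝ, (∀ ω, Y ω ≤ h) → ∫ ω, posPow d (-h + Y ω) ∂μ = 0 := by
    intro Y hY
    simp [fun ω => posPow_of_nonpos hd0 (by linarith [hY ω] : -h + Y ω ≤ 0)]
  have e1 := integral_comp_neg_log_tail hh hA hAl hAh (continuous_integral_posPow hd0.le hB hBh)
    (integral_posPow_mono hd0.le hB hBh) (hzero B hBh) htA
  have e2 := integral_comp_neg_log_tail hh hB hBl hBh (continuous_integral_posPow hd0.le hA hAh)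
    (integral_posPow_mono hd0.le hA hAh) (hzero A hAh) htB
  -- The crux: the left sides of `e1` and `e2` are the same double integral of `posPow d (a + b)`
  -- over independent copies, so their right sides agree.
  have hsymm : ∫ ω, ∫ ω', posPow d (A ω + B ω') ∂μ ∂μ = ∫ ω, ∫ ω', posPow d (B ω + A ω') ∂μ ∂μ := by
    rw [integral_integral_swap]
    · simp_rw [add_comm (A _) (B _)]
    · refine Integrable.of_bound (Measurable.aestronglyMeasurable ?_) (posPow d (h + h))
        (ae_of_all _ fun p => ?_)
      · exact (continuous_posPow hd0.le).measurable.comp (by fun_prop)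
      · rw [Function.uncurry, Real.norm_eq_abs, abs_of_nonneg (posPow_nonneg _ _)]
        exact posPow_mono hd0.le (by linarith [hAh p.1, hBh p.2])
  -- Equal right sides mean equal exponents at `h`. The integrand is nonnegative because `B ≤ A`, so
  -- it vanishes almost everywhere.
  have e3 : ∫ ω, posPow d (h + A ω) - posPow d (h + B ω) ∂μ = 0 := by
    rw [integral_sub (integrable_posPow hd0.le h hA hAh) (integrable_posPow hd0.le h hB hBh)]
    have : Real.exp (-∫ ω, posPow d (h + B ω) ∂μ) = Real.exp (-∫ ω, posPow d (h + A ω) ∂μ) := by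
      linarith
    have := Real.exp_injective this
    linarith
  rw [integral_eq_zero_iff_of_nonneg (fun ω => sub_nonneg.2 (posPow_mono hd0.le
    (by linarith [hBA ω]))) ((integrable_posPow hd0.le h hA hAh).sub
      (integrable_posPow hd0.le h hB hBh))] at e3
  filter_upwards [e3] with ω hω
  have h1 : posPow d (h + A ω) = posPow d (h + B ω) := sub_eq_zero.1 hω
  rw [posPow_of_nonneg (by linarith [hAl ω]), posPow_of_nonneg (by linarith [hBl ω])] at h1
  have := (Real.rpow_left_inj (by linarith [hAl ω]) (by linarith [hBl ω]) hd0.ne').1 h1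
  linarith

end LayerCake

/-! ### The limit law of the root value. -/

section RootLaw

variable {d h : ℝ}

theorem measurable_upperValue (d h : ℝ) (v : List ℕ) :
    Measurable fun e => upperValue h (canonicalLength d e) v :=
  Measurable.iInf fun k => measurable_treeValue d h (2 * k) v

theorem measurable_lowerValue (d h : ℝ) (v : List ℕ) :
    Measurable fun e => lowerValue h (canonicalLength d e) v :=
  Measurable.iSup fun k => measurable_treeValue d h (2 * k + 1) v

theorem tendsto_integral_posPow {Ω : Type*} [MeasurableSpace Ω] {μ : Measure Ω}
    [IsProbabilityMeasure μ] (hd : 0 ≤ d) (x : ℝ) {Y : ℕ → Ω → ℝ} {Z : Ω → ℝ}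
    (hY : ∀ k, Measurable (Y k)) (hYh : ∀ k ω, Y k ω ≤ h)
    (hlim : ∀ ω, Tendsto (fun k => Y k ω) atTop (𝓝 (Z ω))) :
    Tendsto (fun k => ∫ ω, posPow d (x + Y k ω) ∂μ) atTop (𝓝 (∫ ω, posPow d (x + Z ω) ∂μ)) := by
  refine tendsto_integral_of_dominated_convergence (fun _ => posPow d (x + h))
    (fun k => ((continuous_posPow hd).measurable.comp
      (measurable_const.add (hY k))).aestronglyMeasurable) (integrable_const _)
    (fun k => ae_of_all _ fun ω => ?_) (ae_of_all _ fun ω => ?_)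
  · rw [Real.norm_eq_abs, abs_of_nonneg (posPow_nonneg _ _)]
    exact posPow_mono hd (by linarith [hYh k ω])
  · exact ((continuous_posPow hd).tendsto _).comp (tendsto_const_nhds.add (hlim ω))

/-- The tail of the truncated game value at the root. -/
noncomputable def truncTail (d h : ℝ) (k : ℕ) (x : ℝ) : ℝ :=
  pwitMeasure.real {e | x ≤ treeValue h (canonicalLength d e) k []}

/-- The tail of the value of Graph Exploration at the root. -/
noncomputable def rootTail (d h : ℝ) (x : ℝ) : ℝ :=
  pwitMeasure.real {e | x ≤ upperValue h (canonicalLength d e) []}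

theorem tendsto_truncTail_even (hh : 0 ≤ h) (x : ℝ) :
    Tendsto (fun k => truncTail d h (2 * k) x) atTop (𝓝 (rootTail d h x)) := by
  have e : {e | x ≤ upperValue h (canonicalLength d e) []} =
      ⋂ k, {e | x ≤ treeValue h (canonicalLength d e) (2 * k) []} := by
    ext e
    simp only [mem_ofPred_eq, mem_iInter, upperValue]
    exact le_ciInf_iff (bddBelow_treeValue_even hh _)
  have := tendsto_measure_iInter_atTop (μ := pwitMeasure)
    (s := fun k => {e | x ≤ treeValue h (canonicalLength d e) (2 * k) []})
    (fun k => (measurableSet_le measurable_const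
      (measurable_treeValue d h (2 * k) [])).nullMeasurableSet)
    (fun j k hjk e he => le_trans he (antitone_treeValue_even hh [] hjk))
    ⟨0, measure_ne_top _ _⟩
  rw [← e] at this
  exact (ENNReal.tendsto_toReal (measure_ne_top _ _)).comp this

theorem rootTail_eq_exp_lowerValue (hd : 1 ≤ d) (hh : 0 ≤ h) {x : ℝ} (hx : x ∈ Icc (-h) h) :
    rootTail d h x =
      Real.exp (-∫ e, posPow d (x + lowerValue h (canonicalLength d e) []) ∂pwitMeasure) := by
  have h1 := (tendsto_truncTail_even (d := d) hh x).comp (tendsto_add_atTop_nat 1)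
  refine tendsto_nhds_unique h1 ?_
  have h2 : ∀ k, truncTail d h (2 * (k + 1)) x = _ := fun k =>
    measureReal_le_treeValue_succ (by linarith) hh (2 * k + 1) hx
  refine Tendsto.congr (fun k => (h2 k).symm) ?_
  exact (Real.continuous_exp.tendsto _).comp (tendsto_integral_posPow (by linarith) x
    (fun k => measurable_treeValue d h _ []) (fun k e => treeValue_le hh _ _)
    (fun e => tendsto_treeValue_odd hh [])).neg

theorem tendsto_truncTail_odd (hd : 1 ≤ d) (hh : 0 ≤ h) {x : ℝ} (hx : x ∈ Icc (-h) h) :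
    Tendsto (fun k => truncTail d h (2 * k + 1) x) atTop (𝓝 (Real.exp
      (-∫ e, posPow d (x + upperValue h (canonicalLength d e) []) ∂pwitMeasure))) := by
  refine Tendsto.congr
    (fun k => (measureReal_le_treeValue_succ (by linarith) hh (2 * k) hx).symm) ?_
  exact (Real.continuous_exp.tendsto _).comp (tendsto_integral_posPow (by linarith) x
    (fun k => measurable_treeValue d h _ []) (fun k e => treeValue_le hh _ _)
    (fun e => tendsto_treeValue_even hh [])).neg

/-- A supremum may reach `x` although no odd truncation does, so continuity from below is applied at
levels `x' < x`, and then `x'` tends to `x` in the continuous limit formula. At `x = -h` there is no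
room below, but the bound is 1. -/
theorem measureReal_le_lowerValue (hd : 1 ≤ d) (hh : 0 ≤ h) {x : ℝ} (hx : x ∈ Icc (-h) h) :
    pwitMeasure.real {e | x ≤ lowerValue h (canonicalLength d e) []} =
      Real.exp (-∫ e, posPow d (x + upperValue h (canonicalLength d e) []) ∂pwitMeasure) := by
  have hd0 : 0 < d := by linarith
  have hcont := continuous_integral_posPow (μ := pwitMeasure) hd0.le (measurable_upperValue d h [])
    (fun e => upperValue_le hh [])
  apply le_antisymm
  · rcases hx.1.eq_or_lt with rfl | hlt
    · have : ∀ e, posPow d (-h + upperValue h (canonicalLength d e) []) = 0 := fun e =>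
        posPow_of_nonpos hd0 (by linarith [upperValue_le (ℓ := canonicalLength d e) hh []])
      simp only [this, integral_zero, neg_zero, Real.exp_zero]
      exact measureReal_le_one
    · have hbound : ∀ x' ∈ Ioo (-h) x,
          pwitMeasure.real {e | x ≤ lowerValue h (canonicalLength d e) []} ≤ Real.exp
            (-∫ e, posPow d (x' + upperValue h (canonicalLength d e) []) ∂pwitMeasure) := by
        intro x' hx'
        have hlim := tendsto_measure_iUnion_atTop (μ := pwitMeasure)
          (s := fun k => {e | x' ≤ treeValue h (canonicalLength d e) (2 * k + 1) []})
          (fun j k hjk e he => le_trans he (monotone_treeValue_odd hh [] hjk))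
        have hlim2 := (ENNReal.tendsto_toReal (measure_ne_top _ _)).comp hlim
        have heq := tendsto_nhds_unique hlim2
          (tendsto_truncTail_odd hd hh ⟨hx'.1.le, hx'.2.le.trans hx.2⟩)
        rw [← heq]
        refine measureReal_mono fun e he => ?_
        obtain ⟨k, hk⟩ := exists_lt_of_lt_ciSup (hx'.2.trans_le he)
        exact mem_iUnion.2 ⟨k, hk.le⟩
      have ht : Tendsto (fun x' => Real.exp
          (-∫ e, posPow d (x' + upperValue h (canonicalLength d e) []) ∂pwitMeasure)) (𝓝[<] x)
          (𝓝 (Real.exp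
          (-∫ e, posPow d (x + upperValue h (canonicalLength d e) []) ∂pwitMeasure))) :=
        (hcont.neg.rexp.tendsto x).mono_left nhdsWithin_le_nhds
      refine ge_of_tendsto ht ?_
      filter_upwards [Ioo_mem_nhdsLT hlt] with x' hx' using hbound x' hx'
  · refine le_of_tendsto' (tendsto_truncTail_odd hd hh hx) fun k => ?_
    exact measureReal_mono fun e he => le_trans he (odd_le_lowerValue hh k [])

theorem ae_upperValue_eq_lowerValue_root (hd : 1 ≤ d) (hh : 0 ≤ h) :
    ∀ᵐ e ∂pwitMeasure,
      upperValue h (canonicalLength d e) [] = lowerValue h (canonicalLength d e) [] :=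
  ae_eq_of_mutual_tails hd hh (measurable_upperValue d h []) (measurable_lowerValue d h [])
    (fun _ => lowerValue_le_upperValue hh []) (fun _ => neg_le_lowerValue hh [])
    (fun _ => upperValue_le hh []) (fun _ hx => rootTail_eq_exp_lowerValue hd hh hx)
    (fun _ hx => measureReal_le_lowerValue hd hh hx)

/-- Every subtree has the law of the whole tree, and there are countably many vertices. -/
theorem ae_upperValue_eq_lowerValue (hd : 1 ≤ d) (hh : 0 ≤ h) :
    ∀ᵐ e ∂pwitMeasure, ∀ v,
      upperValue h (canonicalLength d e) v = lowerValue h (canonicalLength d e) v := by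
  rw [ae_all_iff]
  intro v
  have h1 := ae_upperValue_eq_lowerValue_root hd hh
  rw [← map_subtree v] at h1
  filter_upwards [ae_of_ae_map (measurable_subtree v).aemeasurable h1] with e he
  simpa only [upperValue, lowerValue, treeValue_subtree] using he

theorem rootTail_eq_exp (hd : 1 ≤ d) (hh : 0 ≤ h) {x : ℝ} (hx : x ∈ Icc (-h) h) :
    rootTail d h x =
      Real.exp (-∫ e, posPow d (x + upperValue h (canonicalLength d e) []) ∂pwitMeasure) := by
  rw [rootTail_eq_exp_lowerValue hd hh hx]
  congr 2
  refine integral_congr_ae ?_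
  filter_upwards [ae_upperValue_eq_lowerValue_root hd hh] with e he
  rw [he]

theorem tendsto_truncTail_odd_rootTail (hd : 1 ≤ d) (hh : 0 ≤ h) {x : ℝ} (hx : x ∈ Icc (-h) h) :
    Tendsto (fun k => truncTail d h (2 * k + 1) x) atTop (𝓝 (rootTail d h x)) := by
  rw [rootTail_eq_exp hd hh hx]
  exact tendsto_truncTail_odd hd hh hx

theorem antitone_truncTail (d h : ℝ) (k : ℕ) : Antitone (truncTail d h k) := fun _ _ hxy =>
  measureReal_mono fun _ he => le_trans hxy he

theorem antitone_rootTail (d h : ℝ) : Antitone (rootTail d h) := fun _ _ hxy =>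
  measureReal_mono fun _ he => le_trans hxy he

theorem truncTail_mem_Icc (d h : ℝ) (k : ℕ) (x : ℝ) : truncTail d h k x ∈ Icc (0 : ℝ) 1 :=
  ⟨measureReal_nonneg, measureReal_le_one⟩

theorem truncTail_zero {x : ℝ} (hx : x ≤ h) : truncTail d h 0 x = 1 := by
  simp [truncTail, treeValue, hx]

end RootLaw

/-! ### Fixed points of the integral operator. -/

section FixedPoint

variable {d θ : ℝ}

theorem truncTail_succ (hd : 1 ≤ d) (hθ : 0 ≤ θ) (k : ℕ) {x : ℝ}
    (hx : x ∈ Icc (-(θ / 2)) (θ / 2)) :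
    truncTail d (θ / 2) (k + 1) x = V d θ (truncTail d (θ / 2) k) x := by
  have hh : 0 ≤ θ / 2 := by linarith
  rw [truncTail, measureReal_le_treeValue_succ (by linarith) hh k hx,
    integral_posPow_eq hd (by linarith [hx.1]) (measurable_treeValue d (θ / 2) k [])
      (fun e => treeValue_le hh k []), V, neg_mul]
  rfl

theorem rootTail_eq_V (hd : 1 ≤ d) (hθ : 0 ≤ θ) {x : ℝ} (hx : x ∈ Icc (-(θ / 2)) (θ / 2)) :
    V d θ (rootTail d (θ / 2)) x = rootTail d (θ / 2) x := by
  have hh : 0 ≤ θ / 2 := by linarith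
  rw [rootTail_eq_exp hd hh hx,
    integral_posPow_eq hd (by linarith [hx.1]) (measurable_upperValue d (θ / 2) [])
      (fun e => upperValue_le hh []), V, neg_mul]
  rfl

theorem isFixedPoint_rootTail (hd : 1 ≤ d) (hθ : 0 ≤ θ) :
    IsFixedPoint d θ (rootTail d (θ / 2)) := by
  refine ⟨?_, fun x hx => rootTail_eq_V hd hθ hx⟩
  exact ((antitone_rootTail d (θ / 2)).antitoneOn _).integrableOn_isCompact isCompact_Icc

/-- The counterpart of `treeValue_succ_le_of_le` for the operator. Since `1 ≤ d`, the kernel `l ^ (d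
- 1)` is continuous, so its product with a merely integrable function is integrable. -/
theorem V_le_V (hd : 1 ≤ d) {F G : ℝ → ℝ} (hF : IntegrableOn F (Icc (-(θ / 2)) (θ / 2)))
    (hG : IntegrableOn G (Icc (-(θ / 2)) (θ / 2)))
    (hFG : ∀ x ∈ Icc (-(θ / 2)) (θ / 2), F x ≤ G x) {x : ℝ} (hx : x ∈ Icc (-(θ / 2)) (θ / 2)) :
    V d θ G x ≤ V d θ F x := by
  have hx0 : 0 ≤ θ / 2 + x := by linarith [hx.1]
  have hint : ∀ H : ℝ → ℝ, IntegrableOn H (Icc (-(θ / 2)) (θ / 2)) →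
      IntervalIntegrable (fun l => l ^ (d - 1) * H (l - x)) volume 0 (θ / 2 + x) := by
    intro H hH
    have h1 : IntervalIntegrable H volume (0 - x) (θ / 2 + x - x) := by
      rw [intervalIntegrable_iff_integrableOn_Icc_of_le (by linarith)]
      exact hH.mono_set (Icc_subset_Icc (by linarith [hx.2]) (by linarith))
    have h2 := (h1.comp_sub_right x).continuousOn_mul
      (g := fun l : ℝ => l ^ (d - 1)) (Real.continuous_rpow_const (by linarith)).continuousOn
    simpa using h2
  refine Real.exp_le_exp.2 ?_
  rw [neg_mul, neg_mul, neg_le_neg_iff]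
  refine mul_le_mul_of_nonneg_left ?_ (by linarith)
  refine intervalIntegral.integral_mono_on hx0 (hint F hF) (hint G hG) fun l hl => ?_
  exact mul_le_mul_of_nonneg_left (hFG _ ⟨by linarith [hl.1, hx.2], by linarith [hl.2]⟩)
    (Real.rpow_nonneg hl.1 _)

theorem integrableOn_truncTail (d h : ℝ) (k : ℕ) (a b : ℝ) :
    IntegrableOn (truncTail d h k) (Icc a b) :=
  ((antitone_truncTail d h k).antitoneOn _).integrableOn_isCompact isCompact_Icc

/-- On the interval a fixed point is an exponential, hence nonnegative; then its exponent is
nonpositive, so it is at most 1, the tail at depth 0. From there the alternation runs as for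
valuations. -/
theorem IsFixedPoint.between (hd : 1 ≤ d) (hθ : 0 ≤ θ) {G : ℝ → ℝ} (hG : IsFixedPoint d θ G)
    (k : ℕ) :
    (∀ x ∈ Icc (-(θ / 2)) (θ / 2), G x ≤ truncTail d (θ / 2) (2 * k) x) ∧
      (∀ x ∈ Icc (-(θ / 2)) (θ / 2), truncTail d (θ / 2) (2 * k + 1) x ≤ G x) := by
  have step1 : ∀ k, (∀ x ∈ Icc (-(θ / 2)) (θ / 2), G x ≤ truncTail d (θ / 2) k x) →
      ∀ x ∈ Icc (-(θ / 2)) (θ / 2), truncTail d (θ / 2) (k + 1) x ≤ G x := fun k hk x hx => by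
    rw [truncTail_succ hd hθ k hx, ← hG.2 hx]
    exact V_le_V hd hG.1 (integrableOn_truncTail _ _ _ _ _) hk hx
  have step2 : ∀ k, (∀ x ∈ Icc (-(θ / 2)) (θ / 2), truncTail d (θ / 2) k x ≤ G x) →
      ∀ x ∈ Icc (-(θ / 2)) (θ / 2), G x ≤ truncTail d (θ / 2) (k + 1) x := fun k hk x hx => by
    rw [truncTail_succ hd hθ k hx, ← hG.2 hx]
    exact V_le_V hd (integrableOn_truncTail _ _ _ _ _) hG.1 hk hx
  have hpos : ∀ x ∈ Icc (-(θ / 2)) (θ / 2), 0 ≤ G x := fun x hx => by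
    rw [← hG.2 hx]; exact (Real.exp_pos _).le
  have h0 : ∀ x ∈ Icc (-(θ / 2)) (θ / 2), G x ≤ truncTail d (θ / 2) 0 x := fun x hx => by
    rw [truncTail_zero hx.2, ← hG.2 hx]
    refine (V_le_V hd (integrableOn_zero (μ := volume)) hG.1 hpos hx).trans ?_
    simp [V]
  induction k with
  | zero => exact ⟨h0, step1 0 h0⟩
  | succ k ih =>
    have h1 := step2 _ ih.2
    exact ⟨h1, step1 _ h1⟩

theorem IsFixedPoint.eqOn_rootTail (hd : 1 ≤ d) (hθ : 0 ≤ θ) {G : ℝ → ℝ}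
    (hG : IsFixedPoint d θ G) : EqOn G (rootTail d (θ / 2)) (Icc (-(θ / 2)) (θ / 2)) := by
  have hh : 0 ≤ θ / 2 := by linarith
  intro x hx
  refine le_antisymm (ge_of_tendsto' (tendsto_truncTail_even hh x) fun k => ?_)
    (le_of_tendsto' (tendsto_truncTail_odd_rootTail hd hh hx) fun k => ?_)
  · exact (hG.between hd hθ k).1 x hx
  · exact (hG.between hd hθ k).2 x hx

end FixedPoint

/-! ### Truncated games on a finite complete graph. -/

section GraphGame

variable {V : Type*} [DecidableEq V]

/-- The edge lengths of a complete graph, as a function of two vertices. -/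
noncomputable def pairLength (ℓ : (⊤ : SimpleGraph V).edgeSet → ℝ) (v w : V) : ℝ :=
  if h : v ≠ w then ℓ ⟨s(v, w), by simpa using h⟩ else 0

theorem pairLength_of_ne (ℓ : (⊤ : SimpleGraph V).edgeSet → ℝ) {v w : V} (h : v ≠ w) :
    pairLength ℓ v w = ℓ ⟨s(v, w), by simpa using h⟩ := dif_pos h

/-- The value of Graph Exploration at `v` on the graph induced by `S` when the game is stopped
after `k` moves and the player who made the last move then receives `h`. -/
noncomputable def graphValue (h : ℝ) (c : V → V → ℝ) : ℕ → Finset V → V → ℝ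
  | 0, _, _ => h
  | k + 1, S, v => (S.erase v).fold min h fun w => c v w - graphValue h c k (S.erase v) w

theorem le_graphValue_succ {h : ℝ} {c : V → V → ℝ} {k : ℕ} {S : Finset V} {v : V} {x : ℝ} :
    x ≤ graphValue h c (k + 1) S v ↔
      x ≤ h ∧ ∀ w ∈ S.erase v, x ≤ c v w - graphValue h c k (S.erase v) w :=
  Finset.le_fold_min x

theorem graphValue_le (h : ℝ) (c : V → V → ℝ) (k : ℕ) (S : Finset V) (v : V) :
    graphValue h c k S v ≤ h := by
  cases k with
  | zero => exact le_rfl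
  | succ k => exact (le_graphValue_succ.1 le_rfl).1

theorem graphValue_succ_le (h : ℝ) (c : V → V → ℝ) (k : ℕ) {S : Finset V} {v w : V}
    (hw : w ∈ S.erase v) :
    graphValue h c (k + 1) S v ≤ c v w - graphValue h c k (S.erase v) w :=
  (le_graphValue_succ.1 le_rfl).2 w hw

/-- Locality: the value sees only lengths within `S`, which later yields independence of the
remaining edges. -/
theorem graphValue_congr {h : ℝ} {c c' : V → V → ℝ} (k : ℕ) (S : Finset V) {v : V} (hv : v ∈ S)
    (hc : ∀ a ∈ S, ∀ b ∈ S, c a b = c' a b) : graphValue h c k S v = graphValue h c' k S v := by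
  induction k generalizing S v with
  | zero => rfl
  | succ k ih =>
    refine Finset.fold_congr fun w hw => ?_
    rw [hc v hv w (Finset.mem_of_mem_erase hw), ih (S.erase v) hw fun a ha b hb =>
      hc a (Finset.mem_of_mem_erase ha) b (Finset.mem_of_mem_erase hb)]

theorem measurable_graphValue {β : Type*} [MeasurableSpace β] (h : ℝ) {c : β → V → V → ℝ}
    (hc : ∀ v w, Measurable fun x => c x v w) (k : ℕ) (S : Finset V) (v : V) :
    Measurable fun x => graphValue h (c x) k S v := by
  induction k generalizing S v with
  | zero => exact measurable_const
  | succ k ih =>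
    have key : ∀ T : Finset V, Measurable fun x =>
        T.fold min h fun w => c x v w - graphValue h (c x) k (S.erase v) w := by
      intro T
      induction T using Finset.induction_on with
      | empty => exact measurable_const
      | insert a T ha ihT =>
        simp only [Finset.fold_insert ha]
        exact ((hc v a).sub (ih _ a)).min ihT
    exact key (S.erase v)

end GraphGame

/-! ### Optimum matchings and cost increments. -/

section Matching

variable {V : Type*} {h : ℝ} {ℓ : (⊤ : SimpleGraph V).edgeSet → ℝ}

theorem isMatching_sup_subgraphOfAdj {M : (⊤ : SimpleGraph V).Subgraph} (hM : M.IsMatching)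
    {v w : V} (hvw : (⊤ : SimpleGraph V).Adj v w) (hv : v ∉ M.verts) (hw : w ∉ M.verts) :
    (M ⊔ SimpleGraph.subgraphOfAdj _ hvw).IsMatching := by
  refine hM.sup (SimpleGraph.Subgraph.IsMatching.subgraphOfAdj hvw) ?_
  rw [hM.support_eq_verts, (SimpleGraph.Subgraph.IsMatching.subgraphOfAdj hvw).support_eq_verts,
    SimpleGraph.subgraphOfAdj_verts, disjoint_right]
  rintro x (rfl | rfl) <;> assumption

variable [Fintype V] [DecidableEq V]

open Classical in
/-- The diluted cost of a partial matching, relative to the cost of the empty one. -/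
noncomputable def weight (h : ℝ) (ℓ : (⊤ : SimpleGraph V).edgeSet → ℝ)
    (M : (⊤ : SimpleGraph V).Subgraph) : ℝ :=
  (∑ e : (⊤ : SimpleGraph V).edgeSet, if e.1 ∈ M.edgeSet then ℓ e else 0) - h * (M.verts.ncard : ℝ)

theorem cost_eq_weight (θ : ℝ) (ℓ : (⊤ : SimpleGraph V).edgeSet → ℝ)
    (M : (⊤ : SimpleGraph V).Subgraph) :
    cost θ ℓ M = weight (θ / 2) ℓ M + θ / 2 * (Nat.card V : ℝ) := by
  rw [cost, weight, ← ncard_add_ncard_compl M.verts]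
  push_cast
  have : ∀ a b c : ℝ, a + θ / 2 * c = a - θ / 2 * b + θ / 2 * (b + c) := fun a b c => by ring
  rw [← this]
  congr!

open Classical in
theorem weight_sup_subgraphOfAdj {M : (⊤ : SimpleGraph V).Subgraph} {v w : V}
    (hvw : (⊤ : SimpleGraph V).Adj v w) (hv : v ∉ M.verts) (hw : w ∉ M.verts) :
    weight h ℓ (M ⊔ SimpleGraph.subgraphOfAdj _ hvw) = weight h ℓ M + pairLength ℓ v w - 2 * h := by
  have hne : v ≠ w := hvw.ne
  have hverts : ((M ⊔ SimpleGraph.subgraphOfAdj _ hvw).verts.ncard : ℝ)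
      = (M.verts.ncard : ℝ) + 2 := by
    rw [SimpleGraph.Subgraph.verts_sup, SimpleGraph.subgraphOfAdj_verts, ncard_union_eq,
      ncard_pair hne]
    · push_cast; ring
    · rw [disjoint_right]
      rintro x (rfl | rfl) <;> assumption
  have hmem : s(v, w) ∈ (⊤ : SimpleGraph V).edgeSet := hvw
  have hedge : ∀ e : (⊤ : SimpleGraph V).edgeSet,
      (if e.1 ∈ (M ⊔ SimpleGraph.subgraphOfAdj _ hvw).edgeSet then ℓ e else 0) =
        (if e.1 ∈ M.edgeSet then ℓ e else 0) + if e = ⟨s(v, w), hmem⟩ then ℓ e else 0 := by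
    rintro ⟨e, he⟩
    have hnot : s(v, w) ∉ M.edgeSet := fun hmem => hv (M.edge_vert hmem)
    simp only [SimpleGraph.Subgraph.edgeSet_sup, SimpleGraph.edgeSet_subgraphOfAdj, mem_union,
      mem_singleton_iff, Subtype.mk.injEq]
    by_cases h1 : e = s(v, w)
    · subst h1; simp [hnot]
    · simp [h1]
  rw [weight, weight, hverts]
  simp only [hedge, Finset.sum_add_distrib, Finset.sum_ite_eq', Finset.mem_univ, if_true]
  rw [pairLength_of_ne ℓ hne]
  ring

/-- Each endpoint has the other as its only partner, so deleting both loses no other edge and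
reverses `weight_sup_subgraphOfAdj`. -/
theorem exists_remove_edge {M : (⊤ : SimpleGraph V).Subgraph} (hM : M.IsMatching) {v w : V}
    (hvw : M.Adj v w) :
    ∃ M₀ : (⊤ : SimpleGraph V).Subgraph, M₀.IsMatching ∧ M₀.verts = M.verts \ {v, w} ∧
      weight h ℓ M = weight h ℓ M₀ + pairLength ℓ v w - 2 * h := by
  have hedge : ∀ {a b}, M.Adj a b → a ∉ ({v, w} : Set V) → b ∉ ({v, w} : Set V) := by
    rintro a b hab ha (rfl | rfl)
    · exact ha (Or.inr (hM.eq_of_adj_left hab.symm hvw))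
    · exact ha (Or.inl (hM.eq_of_adj_left hab.symm hvw.symm))
  have hM₀ : (M.deleteVerts {v, w}).IsMatching := by
    intro a ha
    rw [SimpleGraph.Subgraph.deleteVerts_verts] at ha
    obtain ⟨b, hb, huniq⟩ := hM ha.1
    refine ⟨b, ?_, fun b' hb' => huniq b' ?_⟩
    · refine SimpleGraph.Subgraph.deleteVerts_adj.2 ?_
      exact ⟨ha.1, ha.2, M.edge_vert hb.symm, hedge hb ha.2, hb⟩
    · exact (SimpleGraph.Subgraph.deleteVerts_adj.1 hb').2.2.2.2
  refine ⟨M.deleteVerts {v, w}, hM₀, rfl, ?_⟩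
  have hv : v ∉ (M.deleteVerts {v, w}).verts := by simp
  have hw : w ∉ (M.deleteVerts {v, w}).verts := by simp
  rw [← weight_sup_subgraphOfAdj hvw.adj_sub hv hw]
  congr 1
  ext a b
  · simp only [SimpleGraph.Subgraph.verts_sup, SimpleGraph.Subgraph.deleteVerts_verts,
      SimpleGraph.subgraphOfAdj_verts, sdiff_union_self, mem_union]
    refine ⟨Or.inl, ?_⟩
    rintro (h1 | rfl | rfl)
    · exact h1
    · exact M.edge_vert hvw
    · exact M.edge_vert hvw.symm
  · rw [SimpleGraph.Subgraph.sup_adj, SimpleGraph.Subgraph.deleteVerts_adj,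
      SimpleGraph.subgraphOfAdj_adj]
    constructor
    · intro hab
      by_cases ha : a ∈ ({v, w} : Set V)
      · right
        rcases ha with rfl | rfl
        · rw [hM.eq_of_adj_left hvw hab]
        · rw [hM.eq_of_adj_left hvw.symm hab, Sym2.eq_swap]
      · exact Or.inl ⟨M.edge_vert hab, ha, M.edge_vert hab.symm, hedge hab ha, hab⟩
    · rintro (h1 | h1)
      · exact h1.2.2.2.2
      · rcases Sym2.eq_iff.1 h1 with ⟨rfl, rfl⟩ | ⟨rfl, rfl⟩
        · exact hvw
        · exact hvw.symm

/-- The minimum relative cost of a partial matching of the vertices in `S`. -/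
noncomputable def minWeight (h : ℝ) (ℓ : (⊤ : SimpleGraph V).edgeSet → ℝ) (S : Finset V) : ℝ :=
  ⨅ M : {M : (⊤ : SimpleGraph V).Subgraph // M.IsMatching ∧ M.verts ⊆ S}, weight h ℓ M.1

theorem minWeight_le {S : Finset V} {M : (⊤ : SimpleGraph V).Subgraph} (hM : M.IsMatching)
    (hS : M.verts ⊆ S) : minWeight h ℓ S ≤ weight h ℓ M :=
  ciInf_le (f := fun M : {M : (⊤ : SimpleGraph V).Subgraph // M.IsMatching ∧ M.verts ⊆ S} =>
    weight h ℓ M.1) (Set.finite_range _).bddBelow ⟨M, hM, hS⟩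

theorem exists_minWeight_eq (h : ℝ) (ℓ : (⊤ : SimpleGraph V).edgeSet → ℝ) (S : Finset V) :
    ∃ M : (⊤ : SimpleGraph V).Subgraph, M.IsMatching ∧ M.verts ⊆ S ∧
      weight h ℓ M = minWeight h ℓ S := by
  have : Nonempty {M : (⊤ : SimpleGraph V).Subgraph // M.IsMatching ∧ M.verts ⊆ S} :=
    ⟨⟨⊥, fun v hv => absurd hv (by simp), by simp⟩⟩
  obtain ⟨M, hM⟩ := exists_eq_ciInf_of_finite
    (f := fun M : {M : (⊤ : SimpleGraph V).Subgraph // M.IsMatching ∧ M.verts ⊆ S} =>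
      weight h ℓ M.1)
  exact ⟨M.1, M.2.1, M.2.2, hM⟩

theorem minWeight_le_erase (S : Finset V) (v : V) :
    minWeight h ℓ S ≤ minWeight h ℓ (S.erase v) := by
  obtain ⟨M, hM, hS, hw⟩ := exists_minWeight_eq h ℓ (S.erase v)
  rw [← hw]
  exact minWeight_le hM (hS.trans (by exact_mod_cast S.erase_subset v))

theorem minWeight_le_add {S : Finset V} {v w : V} (hv : v ∈ S) (hw : w ∈ S.erase v) :
    minWeight h ℓ S ≤ minWeight h ℓ ((S.erase v).erase w) + pairLength ℓ v w - 2 * h := by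
  obtain ⟨M, hM, hS, hwt⟩ := exists_minWeight_eq h ℓ ((S.erase v).erase w)
  have hvM : v ∉ M.verts := fun hc => by simpa using hS hc
  have hwM : w ∉ M.verts := fun hc => by simpa using hS hc
  have hvw : (⊤ : SimpleGraph V).Adj v w := (Finset.ne_of_mem_erase hw).symm
  rw [← hwt, ← weight_sup_subgraphOfAdj hvw hvM hwM]
  refine minWeight_le (isMatching_sup_subgraphOfAdj hM hvw hvM hwM) ?_
  rw [SimpleGraph.Subgraph.verts_sup, SimpleGraph.subgraphOfAdj_verts]
  rintro x (hx | rfl | rfl)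
  · have := hS hx
    simp only [Finset.coe_erase, Set.mem_sdiff] at this
    exact this.1.1
  · exact hv
  · exact Finset.mem_of_mem_erase hw

/-- The increase of the minimum diluted cost of the graph induced by `S` due to the vertex `v`. -/
noncomputable def costIncrement (h : ℝ) (ℓ : (⊤ : SimpleGraph V).edgeSet → ℝ) (S : Finset V)
    (v : V) : ℝ := h + minWeight h ℓ S - minWeight h ℓ (S.erase v)

theorem costIncrement_le (S : Finset V) (v : V) : costIncrement h ℓ S v ≤ h := by
  rw [costIncrement]
  linarith [minWeight_le_erase (h := h) (ℓ := ℓ) S v]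

theorem costIncrement_le_sub {S : Finset V} {v w : V} (hv : v ∈ S) (hw : w ∈ S.erase v) :
    costIncrement h ℓ S v ≤ pairLength ℓ v w - costIncrement h ℓ (S.erase v) w := by
  rw [costIncrement, costIncrement]
  linarith [minWeight_le_add (h := h) (ℓ := ℓ) hv hw]

theorem costIncrement_eq_of_unmatched {S : Finset V} {v : V} {M : (⊤ : SimpleGraph V).Subgraph}
    (hM : M.IsMatching) (hS : M.verts ⊆ S) (hw : weight h ℓ M = minWeight h ℓ S)
    (hv : v ∉ M.verts) : costIncrement h ℓ S v = h := by
  have h1 : minWeight h ℓ (S.erase v) ≤ weight h ℓ M := minWeight_le hM fun x hx =>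
    Finset.mem_coe.2 (Finset.mem_erase.2 ⟨fun hxv => hv (hxv ▸ hx), hS hx⟩)
  refine le_antisymm (costIncrement_le S v) ?_
  rw [costIncrement]
  linarith

/-- The converse of `costIncrement_le_sub` for an edge used by an optimum: what remains after
removing the edge competes for the minimum on `S` without both endpoints. -/
theorem le_costIncrement_of_adj {S : Finset V} {v w : V} {M : (⊤ : SimpleGraph V).Subgraph}
    (hM : M.IsMatching) (hS : M.verts ⊆ S) (hwt : weight h ℓ M = minWeight h ℓ S)
    (hvw : M.Adj v w) :
    w ∈ S.erase v ∧
      pairLength ℓ v w - costIncrement h ℓ (S.erase v) w ≤ costIncrement h ℓ S v := by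
  obtain ⟨M₀, hM₀, hverts, hw₀⟩ := exists_remove_edge (h := h) (ℓ := ℓ) hM hvw
  have h1 : minWeight h ℓ ((S.erase v).erase w) ≤ weight h ℓ M₀ := minWeight_le hM₀ fun x hx => by
    rw [hverts] at hx
    have h2 := hS hx.1
    have h3 := hx.2
    simp only [mem_insert_iff, mem_singleton_iff, not_or] at h3
    exact Finset.mem_coe.2 (Finset.mem_erase.2 ⟨h3.2, Finset.mem_erase.2 ⟨h3.1, h2⟩⟩)
  refine ⟨Finset.mem_erase.2 ⟨hvw.ne.symm, hS (M.edge_vert hvw.symm)⟩, ?_⟩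
  rw [costIncrement, costIncrement]
  linarith

/-- The increments of the minimum cost solve the recursion of Graph Exploration, so they lie
between the truncated game values. -/
theorem costIncrement_between (h : ℝ) (ℓ : (⊤ : SimpleGraph V).edgeSet → ℝ) (k : ℕ) :
    (∀ (S : Finset V), ∀ v ∈ S,
      costIncrement h ℓ S v ≤ graphValue h (pairLength ℓ) (2 * k) S v) ∧
    (∀ (S : Finset V), ∀ v ∈ S,
      graphValue h (pairLength ℓ) (2 * k + 1) S v ≤ costIncrement h ℓ S v) := by
  have step1 : ∀ k, (∀ (S : Finset V), ∀ v ∈ S,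
      costIncrement h ℓ S v ≤ graphValue h (pairLength ℓ) k S v) → ∀ (S : Finset V), ∀ v ∈ S,
      graphValue h (pairLength ℓ) (k + 1) S v ≤ costIncrement h ℓ S v := by
    intro k hk S v hv
    obtain ⟨M, hM, hS, hwt⟩ := exists_minWeight_eq h ℓ S
    by_cases hvM : v ∈ M.verts
    · obtain ⟨w, hw, -⟩ := hM hvM
      obtain ⟨hwS, hle⟩ := le_costIncrement_of_adj hM hS hwt hw
      linarith [graphValue_succ_le h (pairLength ℓ) k hwS, hk _ w hwS]
    · rw [costIncrement_eq_of_unmatched hM hS hwt hvM]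
      exact graphValue_le _ _ _ _ _
  have step2 : ∀ k, (∀ (S : Finset V), ∀ v ∈ S,
      graphValue h (pairLength ℓ) k S v ≤ costIncrement h ℓ S v) → ∀ (S : Finset V), ∀ v ∈ S,
      costIncrement h ℓ S v ≤ graphValue h (pairLength ℓ) (k + 1) S v := by
    intro k hk S v hv
    refine le_graphValue_succ.2 ⟨costIncrement_le S v, fun w hw => ?_⟩
    linarith [costIncrement_le_sub (h := h) (ℓ := ℓ) hv hw, hk _ w hw]
  induction k with
  | zero =>
    have h0 : ∀ (S : Finset V), ∀ v ∈ S,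
        costIncrement h ℓ S v ≤ graphValue h (pairLength ℓ) 0 S v :=
      fun S v _ => costIncrement_le S v
    exact ⟨h0, step1 0 h0⟩
  | succ k ih =>
    have h1 := step2 _ ih.2
    exact ⟨h1, step1 _ h1⟩

theorem IsOptimal.weight_eq {θ : ℝ} {M : (⊤ : SimpleGraph V).Subgraph} (hM : IsOptimal θ ℓ M) :
    weight (θ / 2) ℓ M = minWeight (θ / 2) ℓ Finset.univ := by
  refine le_antisymm ?_ (minWeight_le hM.1 (by simp))
  obtain ⟨M', hM', -, hw⟩ := exists_minWeight_eq (θ / 2) ℓ Finset.univ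
  have := hM.2 M' hM'
  rw [cost_eq_weight, cost_eq_weight] at this
  linarith

theorem IsOptimal.le_graphValue_of_unmatched {θ : ℝ} {M : (⊤ : SimpleGraph V).Subgraph}
    (hM : IsOptimal θ ℓ M) (k : ℕ) {v : V} (hv : v ∉ M.verts) :
    θ / 2 ≤ graphValue (θ / 2) (pairLength ℓ) (2 * k) Finset.univ v := by
  refine (costIncrement_eq_of_unmatched hM.1 (by simp) hM.weight_eq hv).symm.trans_le ?_
  exact (costIncrement_between _ ℓ k).1 _ v (Finset.mem_univ v)

/-- If `w` is the partner of `v`, the odd value at `v` is at most the length of the edge minus the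
even value at `w`, which is at most the increment at `v`, hence at most `θ / 2`. Equality throughout
would be the excluded tie. -/
theorem IsOptimal.graphValue_lt_of_matched {θ : ℝ} {M : (⊤ : SimpleGraph V).Subgraph}
    (hM : IsOptimal θ ℓ M) (k : ℕ) {v : V} (hv : v ∈ M.verts)
    (htie : ∀ w ≠ v, pairLength ℓ v w ≠
      θ / 2 + graphValue (θ / 2) (pairLength ℓ) (2 * k) (Finset.univ.erase v) w) :
    graphValue (θ / 2) (pairLength ℓ) (2 * k + 1) Finset.univ v < θ / 2 := by
  obtain ⟨w, hw, -⟩ := hM.1 hv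
  obtain ⟨hwS, hle⟩ := le_costIncrement_of_adj hM.1 (S := Finset.univ) (by simp) hM.weight_eq hw
  have h1 := graphValue_succ_le (θ / 2) (pairLength ℓ) (2 * k) hwS
  have h2 := (costIncrement_between (θ / 2) ℓ k).1 _ w hwS
  have h3 := costIncrement_le (h := θ / 2) (ℓ := ℓ) Finset.univ v
  refine h1.trans_lt (lt_of_le_of_ne (by linarith) fun h4 => htie w hw.ne.symm (by linarith))

end Matching

/-! ### A weak law by second moments. -/

section SecondMoment

variable {Ω ι : Type*} [MeasurableSpace Ω] {μ : Measure Ω} [IsProbabilityMeasure μ]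

theorem sq_integral_abs_le {Y : Ω → ℝ} (hY : Measurable Y) {C : ℝ} (hC : ∀ ω, |Y ω| ≤ C) :
    (∫ ω, |Y ω| ∂μ) ^ 2 ≤ ∫ ω, Y ω ^ 2 ∂μ := by
  set m := ∫ ω, |Y ω| ∂μ with hm
  have h1 : Integrable (fun ω => |Y ω|) μ :=
    Integrable.of_bound (by fun_prop) C (ae_of_all _ fun ω => by simpa using hC ω)
  have h2 : Integrable (fun ω => Y ω ^ 2) μ :=
    Integrable.of_bound (by fun_prop) (C ^ 2) (ae_of_all _ fun ω => by
      simpa using pow_le_pow_left₀ (abs_nonneg _) (hC ω) 2)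
  have h3 : 0 ≤ ∫ ω, (Y ω ^ 2 - 2 * m * |Y ω|) + m ^ 2 ∂μ := integral_nonneg fun ω => by
    have : (Y ω ^ 2 - 2 * m * |Y ω|) + m ^ 2 = (|Y ω| - m) ^ 2 := by
      rw [← sq_abs (Y ω)]; ring
    beta_reduce
    rw [this]; exact sq_nonneg _
  have h4 : Integrable (fun ω => Y ω ^ 2 - 2 * m * |Y ω|) μ := h2.sub (h1.const_mul _)
  rw [integral_add h4 (integrable_const _), integral_sub h2 (h1.const_mul _), integral_const_mul, ← hm] at h3
  simp only [integral_const, probReal_univ, one_smul] at h3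
  nlinarith

/-- A weak law of large numbers for weakly correlated variables. -/
theorem integral_abs_average_sub_le {S : Finset ι} {Z : ι → Ω → ℝ} (hZ : ∀ i, Measurable (Z i))
    (hZ01 : ∀ i ω, Z i ω ∈ Icc (0 : ℝ) 1) {F n j a b : ℝ} (hF : F ∈ Icc (0 : ℝ) 1) (hn : 0 < n)
    (hSn : (S.card : ℝ) ≤ n) (hnS : n ≤ S.card + j) (hb : 0 ≤ b)
    (h1 : ∀ i ∈ S, |∫ ω, Z i ω ∂μ - F| ≤ a)
    (h2 : ∀ i ∈ S, ∀ k ∈ S, i ≠ k → |∫ ω, Z i ω * Z k ω ∂μ - F ^ 2| ≤ b) :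
    ∫ ω, |1 / n * ∑ i ∈ S, Z i ω - F| ∂μ ≤ √(1 / n + (b + 2 * a)) + j / n := by
  -- The main argument gets `0 ≤ a` from an element of `S`. If `S` is empty then `n ≤ j`, and the
  -- last term alone is at least 1.
  rcases S.eq_empty_or_nonempty with rfl | ⟨i₀, hi₀⟩
  · have hj : n ≤ j := by simpa using hnS
    have : 1 ≤ j / n := (one_le_div hn).2 hj
    simp only [Finset.sum_empty, mul_zero, zero_sub, abs_neg, integral_const, probReal_univ,
      one_smul, abs_of_nonneg hF.1]
    linarith [hF.2, Real.sqrt_nonneg (1 / n + (b + 2 * a))]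
  have ha : 0 ≤ a := (abs_nonneg _).trans (h1 i₀ hi₀)
  set W : ι → Ω → ℝ := fun i ω => Z i ω - F with hW
  have hWm : ∀ i, Measurable (W i) := fun i => (hZ i).sub_const F
  have hWb : ∀ i ω, |W i ω| ≤ 1 := fun i ω => by
    rw [abs_le]
    constructor <;> simp only [hW] <;> linarith [(hZ01 i ω).1, (hZ01 i ω).2, hF.1, hF.2]
  have hZi : ∀ i, Integrable (Z i) μ := fun i =>
    Integrable.of_bound (hZ i).aestronglyMeasurable 1 (ae_of_all _ fun ω => by
      rw [Real.norm_eq_abs, abs_of_nonneg (hZ01 i ω).1]; exact (hZ01 i ω).2)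
  have hZZi : ∀ i k, Integrable (fun ω => Z i ω * Z k ω) μ := fun i k =>
    Integrable.of_bound ((hZ i).mul (hZ k)).aestronglyMeasurable 1 (ae_of_all _ fun ω => by
      rw [Real.norm_eq_abs, abs_of_nonneg (mul_nonneg (hZ01 i ω).1 (hZ01 k ω).1)]
      exact mul_le_one₀ (hZ01 i ω).2 (hZ01 k ω).1 (hZ01 k ω).2)
  have hWWb : ∀ i k ω, |W i ω * W k ω| ≤ 1 := fun i k ω => by
    rw [abs_mul]
    exact mul_le_one₀ (hWb i ω) (abs_nonneg _) (hWb k ω)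
  have hWWi : ∀ i k, Integrable (fun ω => W i ω * W k ω) μ := fun i k =>
    Integrable.of_bound ((hWm i).mul (hWm k)).aestronglyMeasurable 1 (ae_of_all _ (hWWb i k))
  have hdiag : ∀ i, ∫ ω, W i ω * W i ω ∂μ ≤ 1 := fun i => by
    have := integral_mono (hWWi i i) (integrable_const (1 : ℝ)) fun ω =>
      (le_abs_self _).trans (hWWb i i ω)
    simpa using this
  have hoff : ∀ i ∈ S, ∀ k ∈ S, i ≠ k → ∫ ω, W i ω * W k ω ∂μ ≤ b + 2 * a := by
    intro i hi k hk hik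
    have e : ∀ ω, W i ω * W k ω = Z i ω * Z k ω - F * Z i ω - F * Z k ω + F ^ 2 := fun ω => by
      simp only [hW]; ring
    simp_rw [e]
    have i1 : Integrable (fun ω => Z i ω * Z k ω - F * Z i ω) μ :=
      (hZZi i k).sub ((hZi i).const_mul F)
    have i2 : Integrable (fun ω => Z i ω * Z k ω - F * Z i ω - F * Z k ω) μ :=
      i1.sub ((hZi k).const_mul F)
    rw [integral_add i2 (integrable_const _), integral_sub i1 ((hZi k).const_mul F), integral_sub (hZZi i k) ((hZi i).const_mul F), integral_const_mul,
      integral_const_mul]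
    simp only [integral_const, probReal_univ, one_smul]
    have e1 := (abs_le.1 (h2 i hi k hk hik)).2
    have e2 := (abs_le.1 (h1 i hi)).1
    have e3 := (abs_le.1 (h1 k hk)).1
    nlinarith [mul_le_mul_of_nonneg_left e2 hF.1, mul_le_mul_of_nonneg_left e3 hF.1,
      mul_le_mul_of_nonneg_right hF.2 ha]
  have hsum : ∫ ω, (∑ i ∈ S, W i ω) ^ 2 ∂μ ≤ n + n ^ 2 * (b + 2 * a) := by
    simp_rw [sq, Finset.sum_mul_sum]
    rw [integral_finsetSum _ fun i _ => integrable_finsetSum _ fun k _ => hWWi i k]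
    simp_rw [fun i => integral_finsetSum S fun k _ => hWWi i k]
    classical
    have hin : ∀ i ∈ S, ∑ k ∈ S, ∫ ω, W i ω * W k ω ∂μ ≤ 1 + n * (b + 2 * a) := by
      intro i hi
      rw [← Finset.add_sum_erase S _ hi]
      refine add_le_add (hdiag i) ?_
      refine (Finset.sum_le_card_nsmul _ _ (b + 2 * a) fun k hk => hoff i hi k
        (Finset.mem_of_mem_erase hk) (Finset.ne_of_mem_erase hk).symm).trans ?_
      rw [nsmul_eq_mul]
      refine mul_le_mul_of_nonneg_right (le_trans ?_ hSn) (by linarith)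
      exact_mod_cast Finset.card_erase_le
    refine (Finset.sum_le_card_nsmul _ _ _ hin).trans ?_
    rw [nsmul_eq_mul]
    have h0 : 0 ≤ 1 + n * (b + 2 * a) := by positivity
    calc (S.card : ℝ) * (1 + n * (b + 2 * a)) ≤ n * (1 + n * (b + 2 * a)) :=
          mul_le_mul_of_nonneg_right hSn h0
      _ = n + n * n * (b + 2 * a) := by ring
  set Y : Ω → ℝ := fun ω => 1 / n * ∑ i ∈ S, W i ω with hYdef
  have hYm : Measurable Y := by fun_prop
  have hYb : ∀ ω, |Y ω| ≤ 1 := fun ω => by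
    rw [hYdef, abs_mul, abs_of_pos (one_div_pos.2 hn), one_div, inv_mul_le_iff₀ hn, mul_one]
    refine (Finset.abs_sum_le_sum_abs _ _).trans
      ((Finset.sum_le_card_nsmul _ _ 1 fun i _ => hWb i ω).trans ?_)
    simpa using hSn
  have hY1 : ∫ ω, |Y ω| ∂μ ≤ √(1 / n + (b + 2 * a)) := by
    refine Real.le_sqrt_of_sq_le ((sq_integral_abs_le hYm hYb).trans ?_)
    simp_rw [hYdef, mul_pow]
    rw [integral_const_mul]
    calc (1 / n) ^ 2 * ∫ ω, (∑ i ∈ S, W i ω) ^ 2 ∂μ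
        ≤ (1 / n) ^ 2 * (n + n ^ 2 * (b + 2 * a)) := by gcongr
      _ = 1 / n + (b + 2 * a) := by field_simp
  -- The average divides by `n` and not by the size of `S`; the missing share costs at most `j / n`.
  have hpt : ∀ ω, |1 / n * ∑ i ∈ S, Z i ω - F| ≤ |Y ω| + j / n := by
    intro ω
    have e : 1 / n * ∑ i ∈ S, Z i ω - F = Y ω - F * ((n - S.card) / n) := by
      simp only [hYdef, hW, Finset.sum_sub_distrib, Finset.sum_const, nsmul_eq_mul]
      field_simp
      ring
    rw [e]
    refine (abs_sub _ _).trans (add_le_add_right ?_ _)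
    have hnn : 0 ≤ (n - S.card) / n := div_nonneg (by linarith) hn.le
    rw [abs_of_nonneg (mul_nonneg hF.1 hnn)]
    refine (mul_le_of_le_one_left hnn hF.2).trans ?_
    gcongr
    linarith
  have hYi : Integrable (fun ω => |Y ω|) μ :=
    Integrable.of_bound (by fun_prop) 1 (ae_of_all _ fun ω => by simpa using hYb ω)
  have := integral_mono_of_nonneg (μ := μ) (ae_of_all _ fun ω => abs_nonneg _)
    (hYi.add (integrable_const (j / n))) (ae_of_all _ hpt)
  refine this.trans ?_
  simp only [Pi.add_apply]
  rw [integral_add hYi (integrable_const _)]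
  simpa using hY1

end SecondMoment

/-! ### The mean field model and its conditional tail formulas. -/

section MeanField

variable {d h : ℝ} {n : ℕ}

/-- The edge set of the complete graph on `n` vertices. -/
abbrev CompleteEdge (n : ℕ) : Type := (⊤ : SimpleGraph (Fin n)).edgeSet

/-- The law of the independent exponential variables of the mean field model. -/
noncomputable def meanFieldMeasure (n : ℕ) : Measure (CompleteEdge n → ℝ) :=
  Measure.pi fun _ => expMeasure 1

instance isProbabilityMeasure_meanFieldMeasure : IsProbabilityMeasure (meanFieldMeasure n) := by
  unfold meanFieldMeasure; infer_instance

theorem map_eval_meanFieldMeasure (e : CompleteEdge n) :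
    (meanFieldMeasure n).map (fun x => x e) = expMeasure 1 :=
  (measurePreserving_eval (fun _ : CompleteEdge n => expMeasure 1) e).map_eq

theorem iIndepFun_eval_meanFieldMeasure :
    iIndepFun (fun (e : CompleteEdge n) (x : CompleteEdge n → ℝ) => x e) (meanFieldMeasure n) :=
  iIndepFun_pi (X := fun _ x => x) (fun _ => aemeasurable_id)

theorem ae_pos_meanFieldMeasure : ∀ᵐ x ∂meanFieldMeasure n, ∀ e, 0 < x e := by
  rw [ae_all_iff]
  intro e
  have := ae_expMeasure_one_pos
  rw [← map_eval_meanFieldMeasure e] at this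
  exact ae_of_ae_map (measurable_pi_apply e).aemeasurable this

/-- The edge between two distinct vertices. -/
def edge {v w : Fin n} (hvw : v ≠ w) : CompleteEdge n := ⟨s(v, w), by simpa using hvw⟩

/-- The truncated game value on the graph induced by `S` in the mean field model. -/
noncomputable def gameValue (d h : ℝ) (n k : ℕ) (S : Finset (Fin n)) (v : Fin n)
    (x : CompleteEdge n → ℝ) : ℝ :=
  graphValue h (pairLength (meanFieldLength d n x)) k S v

theorem measurable_pairLength (d : ℝ) (v w : Fin n) :
    Measurable fun x => pairLength (meanFieldLength d n x) v w := by
  unfold pairLength meanFieldLength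
  split_ifs
  · fun_prop
  · exact measurable_const

theorem measurable_gameValue (d h : ℝ) (n k : ℕ) (S : Finset (Fin n)) (v : Fin n) :
    Measurable (gameValue d h n k S v) := measurable_graphValue h (measurable_pairLength d) k S v

theorem gameValue_le (k : ℕ) (S : Finset (Fin n)) (v : Fin n) (x : CompleteEdge n → ℝ) :
    gameValue d h n k S v x ≤ h := graphValue_le _ _ _ _ _

theorem le_pairLength_iff (hd : 0 < d) (hn : 0 < n) {v w : Fin n} (hvw : v ≠ w)
    {x : CompleteEdge n → ℝ} (hx : 0 ≤ x (edge hvw)) (a : ℝ) :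
    a ≤ pairLength (meanFieldLength d n x) v w ↔ posPow d a / n ≤ x (edge hvw) := by
  have hn' : (0 : ℝ) < n := Nat.cast_pos.2 hn
  rw [pairLength_of_ne _ hvw]
  change a ≤ ((n : ℝ) * x (edge hvw)) ^ (1 / d) ↔ _
  rw [le_rpow_one_div_iff hd (mul_nonneg hn'.le hx), div_le_iff₀' hn']

open Classical in
/-- The variables on the edges within `S`, the other ones being replaced by `0`. -/
noncomputable def innerPart (S : Finset (Fin n)) (x : CompleteEdge n → ℝ) : CompleteEdge n → ℝ :=
  fun e => if ∀ a ∈ e.1, a ∈ S then x e else 0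

theorem gameValue_innerPart_of_subset (k : ℕ) {S T : Finset (Fin n)} (hST : S ⊆ T) {v : Fin n}
    (hv : v ∈ S) (x : CompleteEdge n → ℝ) :
    gameValue d h n k S v (innerPart T x) = gameValue d h n k S v x := by
  refine graphValue_congr k S hv fun a ha b hb => ?_
  by_cases hab : a = b
  · simp [pairLength, hab]
  · rw [pairLength_of_ne _ hab, pairLength_of_ne _ hab, meanFieldLength, meanFieldLength, innerPart,
      if_pos]
    simp [hST ha, hST hb]

theorem gameValue_innerPart (k : ℕ) {S : Finset (Fin n)} {v : Fin n} (hv : v ∈ S)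
    (x : CompleteEdge n → ℝ) : gameValue d h n k S v (innerPart S x) = gameValue d h n k S v x :=
  gameValue_innerPart_of_subset k subset_rfl hv x

theorem measurable_innerPart (S : Finset (Fin n)) : Measurable (innerPart S) := by
  refine measurable_pi_iff.2 fun e => ?_
  unfold innerPart
  split_ifs
  · exact measurable_pi_apply e
  · exact measurable_const

/-- With `gameValue_innerPart`, this makes game values on `S` independent of all edges not contained
in `S`, in particular of those at a vertex just removed. -/
theorem indepFun_innerPart {κ : Type*} (S : Finset (Fin n)) {σ : κ → CompleteEdge n}
    (hσ : ∀ k, ¬ ∀ a ∈ (σ k).1, a ∈ S) :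
    IndepFun (fun (x : CompleteEdge n → ℝ) k => x (σ k)) (innerPart S) (meanFieldMeasure n) := by
  classical
  have hd : Disjoint {e : CompleteEdge n | ¬ ∀ a ∈ e.1, a ∈ S} {e | ∀ a ∈ e.1, a ∈ S} :=
    disjoint_left.2 fun e he he' => he he'
  have := indepFun_of_disjoint_sets (X := fun (e : CompleteEdge n) (x : CompleteEdge n → ℝ) => x e)
    (fun e => measurable_pi_apply e) iIndepFun_eval_meanFieldMeasure hd
  have h1 : Measurable fun (z : {e : CompleteEdge n | ¬ ∀ a ∈ e.1, a ∈ S} → ℝ) (k : κ) =>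
      z ⟨σ k, hσ k⟩ := by fun_prop
  have h2 : Measurable fun (z : {e : CompleteEdge n | ∀ a ∈ e.1, a ∈ S} → ℝ)
      (e : CompleteEdge n) => if he : ∀ a ∈ e.1, a ∈ S then z ⟨e, he⟩ else 0 := by
    refine measurable_pi_iff.2 fun e => ?_
    split_ifs
    · exact measurable_pi_apply _
    · exact measurable_const
  convert! this.comp h1 h2 using 1

theorem indepFun_eval_innerPart {T : Finset (Fin n)} {v w : Fin n} (hvw : v ≠ w) (hv : v ∉ T) :
    IndepFun (fun x : CompleteEdge n → ℝ => x (edge hvw)) (innerPart T) (meanFieldMeasure n) := by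
  have h1 := indepFun_innerPart (κ := Unit) T (σ := fun _ => edge hvw)
    (fun _ hall => hv (hall v (by simp [edge])))
  exact h1.comp (φ := fun z => z ()) (ψ := id)
    (measurable_pi_apply (X := fun _ : Unit => ℝ) ()) measurable_id

/-- The expected number of children of a new vertex whose edge prevents the value `y`, given the
edges within `S`. -/
noncomputable def hazard (d h : ℝ) (n k : ℕ) (y : ℝ) (S : Finset (Fin n))
    (x : CompleteEdge n → ℝ) : ℝ := 1 / n * ∑ u ∈ S, posPow d (y + gameValue d h n k S u x)

theorem hazard_nonneg (k : ℕ) (y : ℝ) (S : Finset (Fin n)) (x : CompleteEdge n → ℝ) :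
    0 ≤ hazard d h n k y S x :=
  mul_nonneg (by positivity) (Finset.sum_nonneg fun _ _ => posPow_nonneg _ _)

theorem measurable_hazard (hd : 0 ≤ d) (k : ℕ) (y : ℝ) (S : Finset (Fin n)) :
    Measurable (hazard d h n k y S) := by
  unfold hazard
  refine measurable_const.mul (Finset.measurable_fun_sum _ fun u _ => ?_)
  exact (continuous_posPow hd).measurable.comp
    (measurable_const.add (measurable_gameValue d h n k S u))

/-- The probability that no edge between `R` and `T` prevents the value `y`. -/
theorem measureReal_forall_le_pairLength_sub (hd : 0 < d) (hn : 0 < n) (k : ℕ) (y : ℝ)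
    {R T : Finset (Fin n)} (hRT : Disjoint R T) :
    (meanFieldMeasure n).real {x | ∀ r ∈ R, ∀ u ∈ T,
      y ≤ pairLength (meanFieldLength d n x) r u - gameValue d h n k T u x} =
      ∫ x, Real.exp (-(R.card * hazard d h n k y T x)) ∂meanFieldMeasure n := by
  have hne : ∀ p : R × T, p.1.1 ≠ p.2.1 := fun p hp =>
    Finset.disjoint_left.1 hRT p.1.2 (hp ▸ p.2.2)
  let σ : R × T → CompleteEdge n := fun p => edge (hne p)
  -- An unordered edge between disjoint sets determines its endpoint in each, so the variables used
  -- are distinct.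
  have hσ : Function.Injective σ := by
    rintro ⟨⟨r, hr⟩, ⟨u, hu⟩⟩ ⟨⟨r', hr'⟩, ⟨u', hu'⟩⟩ hp
    have hp' : s(r, u) = s(r', u') := congrArg Subtype.val hp
    rcases Sym2.eq_iff.1 hp' with ⟨rfl, rfl⟩ | ⟨rfl, rfl⟩
    · rfl
    · exact absurd hu' (Finset.disjoint_left.1 hRT hr)
  have hσT : ∀ p, ¬ ∀ a ∈ (σ p).1, a ∈ T := fun p hp =>
    Finset.disjoint_left.1 hRT p.1.2 (hp p.1.1 (by simp [σ, edge]))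
  have key := measureReal_forall_threshold_le (μ := meanFieldMeasure n)
    (X := fun (e : CompleteEdge n) (x : CompleteEdge n → ℝ) => x e)
    (fun e => measurable_pi_apply e) map_eval_meanFieldMeasure iIndepFun_eval_meanFieldMeasure hσ
    (measurable_innerPart T) (indepFun_innerPart T hσT)
    (a := fun p z => posPow d (y + gameValue d h n k T p.2.1 z) / n)
    (fun p => ((continuous_posPow hd.le).measurable.comp
      (measurable_const.add (measurable_gameValue d h n k T p.2.1))).div_const _)
  have e1 : ∀ x, ∑ p : R × T, max (posPow d (y + gameValue d h n k T p.2.1 (innerPart T x)) / n) 0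
      = R.card * hazard d h n k y T x := by
    intro x
    have : ∀ p : R × T, max (posPow d (y + gameValue d h n k T p.2.1 (innerPart T x)) / n) 0
        = posPow d (y + gameValue d h n k T p.2.1 x) / n := fun p => by
      rw [max_eq_left (div_nonneg (posPow_nonneg _ _) n.cast_nonneg), gameValue_innerPart k p.2.2]
    simp_rw [this]
    rw [Fintype.sum_prod_type]
    simp only [Finset.sum_const, Finset.card_univ, Fintype.card_coe, nsmul_eq_mul]
    rw [hazard, ← Finset.sum_coe_sort T, ← Finset.sum_div]
    ring
  simp_rw [e1] at key
  rw [← key]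
  refine measureReal_congr ?_
  filter_upwards [ae_pos_meanFieldMeasure] with x hx
  refine propext ?_
  change (∀ r ∈ R, ∀ u ∈ T,
    y ≤ pairLength (meanFieldLength d n x) r u - gameValue d h n k T u x) ↔
    ∀ p : R × T, posPow d (y + gameValue d h n k T p.2.1 (innerPart T x)) / n ≤ x (σ p)
  have e2 : ∀ p : R × T,
      (posPow d (y + gameValue d h n k T p.2.1 (innerPart T x)) / n ≤ x (σ p) ↔
        y ≤ pairLength (meanFieldLength d n x) p.1 p.2 - gameValue d h n k T p.2 x) := fun p => by
    rw [gameValue_innerPart k p.2.2, ← le_pairLength_iff hd hn (hne p) (hx _).le, le_sub_iff_add_le]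
  simp_rw [e2]
  exact ⟨fun H p => H _ p.1.2 _ p.2.2, fun H r hr u hu => H (⟨r, hr⟩, ⟨u, hu⟩)⟩

theorem measureReal_le_gameValue_succ (hd : 0 < d) (hn : 0 < n) (k : ℕ) {y : ℝ} (hy : y ≤ h)
    (S : Finset (Fin n)) (v : Fin n) :
    (meanFieldMeasure n).real {x | y ≤ gameValue d h n (k + 1) S v x} =
      ∫ x, Real.exp (-hazard d h n k y (S.erase v) x) ∂meanFieldMeasure n := by
  have := measureReal_forall_le_pairLength_sub (h := h) hd hn k y (R := {v}) (T := S.erase v)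
    (by simp)
  simp only [Finset.card_singleton, Nat.cast_one, one_mul] at this
  rw [← this]
  congr 1
  ext x
  simp only [mem_ofPred_eq, Finset.mem_singleton, forall_eq]
  rw [gameValue, le_graphValue_succ, and_iff_right hy]
  rfl

/-- Each vertex plays with the other one deleted, so both move into the same set and the same
values. Given these, the two events use different edges, which doubles the exponent. -/
theorem measureReal_le_gameValue_succ_pair (hd : 0 < d) (hn : 0 < n) (k : ℕ) {y : ℝ} (hy : y ≤ h)
    (S : Finset (Fin n)) {v w : Fin n} (hvw : v ≠ w) :
    (meanFieldMeasure n).real {x | y ≤ gameValue d h n (k + 1) (S.erase w) v x ∧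
        y ≤ gameValue d h n (k + 1) (S.erase v) w x} =
      ∫ x, Real.exp (-(2 * hazard d h n k y ((S.erase v).erase w) x)) ∂meanFieldMeasure n := by
  have := measureReal_forall_le_pairLength_sub (h := h) hd hn k y (R := {v, w})
    (T := (S.erase v).erase w) (by simp)
  simp only [Finset.card_pair hvw, Nat.cast_ofNat] at this
  rw [← this]
  congr 1
  ext x
  simp only [mem_ofPred_eq, Finset.mem_insert, Finset.mem_singleton, forall_eq_or_imp, forall_eq]
  rw [gameValue, gameValue, le_graphValue_succ, le_graphValue_succ, and_iff_right hy,
    and_iff_right hy, Finset.erase_right_comm (a := w)]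
  rfl

/-- The edge variable is independent of the game without `v` and has no atoms, so it almost surely
misses the one value that gives a tie. -/
theorem measure_tie_eq_zero (hd : 0 < d) (hn : 0 < n) (k : ℕ) (h' : ℝ) {v w : Fin n}
    (hvw : v ≠ w) :
    ∀ᵐ x ∂meanFieldMeasure n, pairLength (meanFieldLength d n x) v w ≠
      h' + gameValue d h n k (Finset.univ.erase v) w x := by
  set T : Finset (Fin n) := Finset.univ.erase v with hT
  have hwT : w ∈ T := by simp [hT, hvw.symm]
  have hind := (indepFun_eval_innerPart (T := T) hvw (by simp [hT])).symm
  let g : (CompleteEdge n → ℝ) → ℝ := fun z => posPow d (h' + gameValue d h n k T w z) / n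
  have hg : Measurable g := ((continuous_posPow hd.le).measurable.comp
    (measurable_const.add (measurable_gameValue d h n k T w))).div_const _
  let s : Set ((CompleteEdge n → ℝ) × ℝ) := {p | p.2 = g p.1}
  have hs : MeasurableSet s := measurableSet_eq_fun measurable_snd (hg.comp measurable_fst)
  have h0 := measureReal_eq_integral_of_indepFun (measurable_innerPart T)
    (measurable_pi_apply (edge hvw)) hind hs
  have h1 : ∀ u, (meanFieldMeasure n).real {x | (u, x (edge hvw)) ∈ s} = 0 := by
    intro u
    have : {x : CompleteEdge n → ℝ | (u, x (edge hvw)) ∈ s} = (fun x => x (edge hvw)) ⁻¹' {g u} := rfl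
    rw [this, ← map_measureReal_apply (measurable_pi_apply _) (measurableSet_singleton _),
      map_eval_meanFieldMeasure, measureReal_def, expMeasure_one_singleton]
    rfl
  simp_rw [h1, integral_zero] at h0
  rw [measureReal_eq_zero_iff, measure_eq_zero_iff_ae_notMem] at h0
  filter_upwards [h0, ae_pos_meanFieldMeasure] with x hx hpos heq
  refine hx ?_
  change x (edge hvw) = posPow d (h' + gameValue d h n k T w (innerPart T x)) / n
  rw [gameValue_innerPart k hwT, ← heq, pairLength_of_ne _ hvw, meanFieldLength]
  have hn' : (0 : ℝ) < n := Nat.cast_pos.2 hn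
  have hp : 0 ≤ (n : ℝ) * x (edge hvw) := mul_nonneg hn'.le (hpos _).le
  change x (edge hvw) = posPow d (((n : ℝ) * x (edge hvw)) ^ (1 / d)) / n
  rw [posPow_of_nonneg (Real.rpow_nonneg hp _), ← Real.rpow_mul hp, one_div_mul_cancel hd.ne',
    Real.rpow_one]
  field_simp

end MeanField

/-! ### Deleting a vertex rarely changes a truncated value. -/

section Stability

variable {d h : ℝ} {n : ℕ}

/-- A bound, up to a factor `1 / n`, for the probability that the removal of another vertex changes
the truncated game value. -/
noncomputable def stabilityConst (c : ℝ) : ℕ → ℝ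
  | 0 => 0
  | k + 1 => c + c * stabilityConst c k

theorem stabilityConst_nonneg {c : ℝ} (hc : 0 ≤ c) (k : ℕ) : 0 ≤ stabilityConst c k := by
  induction k with
  | zero => exact le_rfl
  | succ k ih => exact add_nonneg hc (mul_nonneg hc ih)

theorem le_pairLength_sub_gameValue (hd : 0 < d) (hn : 0 < n) (k : ℕ) (S : Finset (Fin n))
    {v w : Fin n} (hvw : v ≠ w) {x : CompleteEdge n → ℝ} (hx : ∀ e, 0 ≤ x e)
    (hlong : posPow d (2 * h) / n < x (edge hvw)) (u : Fin n) :
    h ≤ pairLength (meanFieldLength d n x) v w - gameValue d h n k S u x := by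
  have h1 := (le_pairLength_iff hd hn hvw (hx _) (2 * h)).2 hlong.le
  linarith [gameValue_le (d := d) (h := h) k S u x]

/-- An edge longer than `2 * h` offers at least `h` and is irrelevant to the minimum. So deleting
`w` matters at `v` only through a short edge to `w`, or a short edge to some vertex whose own value
changes. -/
theorem gameValue_succ_erase_eq (hd : 0 < d) (hn : 0 < n) (k : ℕ) (S : Finset (Fin n))
    {v w : Fin n} (hvw : v ≠ w) {x : CompleteEdge n → ℝ} (hx : ∀ e, 0 ≤ x e)
    (hlong : posPow d (2 * h) / n < x (edge hvw))
    (hshort : ∀ y (hvy : v ≠ y), y ∈ (S.erase v).erase w → x (edge hvy) ≤ posPow d (2 * h) / n →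
      gameValue d h n k (S.erase v) y x = gameValue d h n k ((S.erase v).erase w) y x) :
    gameValue d h n (k + 1) S v x = gameValue d h n (k + 1) (S.erase w) v x := by
  apply le_antisymm
  · refine le_graphValue_succ.2 ⟨gameValue_le _ _ _ _, fun y hy => ?_⟩
    rw [Finset.erase_right_comm] at hy ⊢
    have hvy : v ≠ y := by rintro rfl; simp at hy
    by_cases hs : x (edge hvy) ≤ posPow d (2 * h) / n
    · have := hshort y hvy hy hs
      rw [gameValue, gameValue] at this
      rw [← this]
      exact graphValue_succ_le _ _ _ (Finset.mem_of_mem_erase hy)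
    · exact (gameValue_le _ _ _ _).trans
        (le_pairLength_sub_gameValue hd hn k _ hvy hx (not_le.1 hs) y)
  · refine le_graphValue_succ.2 ⟨gameValue_le _ _ _ _, fun y hy => ?_⟩
    have hvy : v ≠ y := by rintro rfl; simp at hy
    by_cases hs : posPow d (2 * h) / n < x (edge hvy)
    · exact (gameValue_le _ _ _ _).trans (le_pairLength_sub_gameValue hd hn k _ hvy hx hs y)
    · have hyw : y ≠ w := by rintro rfl; exact hs hlong
      have hy' : y ∈ (S.erase v).erase w := Finset.mem_erase.2 ⟨hyw, hy⟩
      have := hshort y hvy hy' (not_lt.1 hs)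
      rw [gameValue, gameValue] at this
      rw [this, Finset.erase_right_comm]
      exact graphValue_succ_le _ _ _ (by rwa [Finset.erase_right_comm])

/-- Union bound over the two causes in `gameValue_succ_erase_eq`, with `c = posPow d (2 * h)`: a
given edge is short with probability at most `c / n`, independently of the game without `v`. At most
`n` neighbours contribute, which gives the recursion of `stabilityConst`. -/
theorem measureReal_gameValue_ne_erase_le (hd : 0 < d) (hn : 0 < n) (k : ℕ)
    {S : Finset (Fin n)} {v w : Fin n} (hv : v ∈ S) (hvw : v ≠ w) :
    (meanFieldMeasure n).real {x | gameValue d h n k S v x ≠ gameValue d h n k (S.erase w) v x}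
      ≤ stabilityConst (posPow d (2 * h)) k / n := by
  have hn' : (0 : ℝ) < n := Nat.cast_pos.2 hn
  set c := posPow d (2 * h) with hc
  have hc0 : 0 ≤ c := posPow_nonneg _ _
  have hshortP : ∀ e : CompleteEdge n,
      (meanFieldMeasure n).real ((fun x => x e) ⁻¹' Iic (c / n)) ≤ c / n := fun e => by
    rw [← map_measureReal_apply (measurable_pi_apply e) measurableSet_Iic,
      map_eval_meanFieldMeasure]
    exact expMeasure_one_real_Iic_le (div_nonneg hc0 hn'.le)
  induction k generalizing S v w with
  | zero => simp [gameValue, graphValue, stabilityConst]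
  | succ k ih =>
    set T := (S.erase v).erase w with hT
    let B : Fin n → Set (CompleteEdge n → ℝ) := fun y =>
      {x | ∃ hvy : v ≠ y, x (edge hvy) ≤ c / n ∧
        gameValue d h n k (S.erase v) y x ≠ gameValue d h n k T y x}
    have hB : ∀ y ∈ T, (meanFieldMeasure n).real (B y) ≤ c / n * (stabilityConst c k / n) := by
      intro y hy
      have hy1 : y ∈ S.erase v := Finset.mem_of_mem_erase hy
      have hvy : v ≠ y := (Finset.ne_of_mem_erase hy1).symm
      let D : Set (CompleteEdge n → ℝ) :=
        {x | gameValue d h n k (S.erase v) y x ≠ gameValue d h n k T y x}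
      have hD : MeasurableSet D := (measurableSet_eq_fun (measurable_gameValue d h n k _ y)
        (measurable_gameValue d h n k _ y)).compl
      have hDpre : innerPart (S.erase v) ⁻¹' D = D := by
        ext x
        simp only [D, mem_preimage, mem_ofPred_eq]
        rw [gameValue_innerPart k hy1, gameValue_innerPart_of_subset k (Finset.erase_subset _ _) hy]
      have hBeq : B y = (fun x => x (edge hvy)) ⁻¹' Iic (c / n) ∩ innerPart (S.erase v) ⁻¹' D := by
        rw [hDpre]
        ext x
        exact ⟨fun ⟨_, h1, h2⟩ => ⟨h1, h2⟩, fun ⟨h1, h2⟩ => ⟨hvy, h1, h2⟩⟩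
      have hind := indepFun_eval_innerPart (T := S.erase v) hvy (by simp)
      rw [hBeq, measureReal_def, hind.measure_inter_preimage_eq_mul _ _ measurableSet_Iic hD,
        ENNReal.toReal_mul, hDpre]
      exact mul_le_mul (hshortP _) (ih hy1 (Finset.ne_of_mem_erase hy)) measureReal_nonneg
        (div_nonneg hc0 hn'.le)
    have hsub : {x | gameValue d h n (k + 1) S v x ≠ gameValue d h n (k + 1) (S.erase w) v x}
        ≤ᵐ[meanFieldMeasure n] ((fun x => x (edge hvw)) ⁻¹' Iic (c / n) ∪ ⋃ y ∈ T, B y : Set _) := by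
      filter_upwards [ae_pos_meanFieldMeasure] with x hx hne
      by_contra hcon
      have hcon' : x ∉ ((fun x => x (edge hvw)) ⁻¹' Iic (c / n) ∪ ⋃ y ∈ T, B y : Set _) := hcon
      simp only [mem_union, mem_preimage, mem_Iic, mem_iUnion, not_or, not_le, not_exists] at hcon'
      refine hne (gameValue_succ_erase_eq hd hn k S hvw (fun e => (hx e).le) hcon'.1
        fun y hvy hy hs => ?_)
      by_contra hne'
      exact hcon'.2 y hy ⟨hvy, hs, hne'⟩
    have h1 : (meanFieldMeasure n).real
        {x | gameValue d h n (k + 1) S v x ≠ gameValue d h n (k + 1) (S.erase w) v x} ≤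
        (meanFieldMeasure n).real ((fun x => x (edge hvw)) ⁻¹' Iic (c / n) ∪ ⋃ y ∈ T, B y) :=
      ENNReal.toReal_mono (measure_ne_top _ _) (measure_mono_ae hsub)
    refine h1.trans ((measureReal_union_le _ _).trans ?_)
    have h2 : (meanFieldMeasure n).real (⋃ y ∈ T, B y) ≤ n * (c / n * (stabilityConst c k / n)) := by
      refine (measureReal_biUnion_finset_le T B).trans ((Finset.sum_le_card_nsmul _ _ _ hB).trans ?_)
      rw [nsmul_eq_mul]
      refine mul_le_mul_of_nonneg_right ?_ (mul_nonneg (div_nonneg hc0 hn'.le)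
        (div_nonneg (stabilityConst_nonneg hc0 k) hn'.le))
      simpa using Finset.card_le_univ T
    refine (add_le_add (hshortP _) h2).trans (le_of_eq ?_)
    rw [stabilityConst]
    field_simp

end Stability

/-! ### The law of large numbers for truncated values. -/

section LawOfLargeNumbers

variable {d h : ℝ} {n : ℕ}

/-- The proportion of vertices whose truncated game value in `S` is at least `y`. -/
noncomputable def tailFraction (d h : ℝ) (n k : ℕ) (y : ℝ) (S : Finset (Fin n))
    (x : CompleteEdge n → ℝ) : ℝ :=
  1 / n * ∑ u ∈ S, if y ≤ gameValue d h n k S u x then 1 else 0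

theorem measurable_tailFraction (d h : ℝ) (n k : ℕ) (S : Finset (Fin n)) :
    Measurable fun p : (CompleteEdge n → ℝ) × ℝ => tailFraction d h n k p.2 S p.1 := by
  unfold tailFraction
  refine measurable_const.mul (Finset.measurable_fun_sum _ fun u _ => ?_)
  exact Measurable.ite (measurableSet_le measurable_snd
    ((measurable_gameValue d h n k S u).comp measurable_fst)) measurable_const measurable_const

theorem tailFraction_mem_Icc (k : ℕ) (y : ℝ) (S : Finset (Fin n)) (x : CompleteEdge n → ℝ) :
    tailFraction d h n k y S x ∈ Icc (0 : ℝ) 1 := by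
  have h0 : ∀ u, (if y ≤ gameValue d h n k S u x then (1 : ℝ) else 0) ∈ Icc (0 : ℝ) 1 := fun u => by
    split_ifs <;> simp
  refine ⟨mul_nonneg (by positivity) (Finset.sum_nonneg fun u _ => (h0 u).1), ?_⟩
  rcases n.eq_zero_or_pos with rfl | hn
  · simp [tailFraction]
  have hn' : (0 : ℝ) < n := Nat.cast_pos.2 hn
  rw [tailFraction, one_div, inv_mul_le_iff₀ hn', mul_one]
  refine (Finset.sum_le_card_nsmul _ _ 1 fun u _ => (h0 u).2).trans ?_
  simpa using Finset.card_le_univ S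

theorem intervalIntegrable_rpow_mul (hd : 1 ≤ d) (a b : ℝ) {G : ℝ → ℝ} (hG : Measurable G)
    (hGb : ∀ l, |G l| ≤ 1) : IntervalIntegrable (fun l : ℝ => l ^ (d - 1) * G l) volume a b :=
  ⟨(intervalIntegrable_rpow_sub_one hd a b).1.mul_bdd hG.aestronglyMeasurable (ae_of_all _ hGb),
    (intervalIntegrable_rpow_sub_one hd a b).2.mul_bdd hG.aestronglyMeasurable (ae_of_all _ hGb)⟩

theorem hazard_eq_integral (hd : 1 ≤ d) (k : ℕ) {y : ℝ} (hy : 0 ≤ h + y) (S : Finset (Fin n))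
    (x : CompleteEdge n → ℝ) :
    hazard d h n k y S x =
      d * ∫ l in (0 : ℝ)..(h + y), l ^ (d - 1) * tailFraction d h n k (l - y) S x := by
  have hi : ∀ u ∈ S, IntervalIntegrable
      (fun l : ℝ => l ^ (d - 1) * if l - y ≤ gameValue d h n k S u x then 1 else 0)
      volume 0 (h + y) := fun u _ => by
    refine intervalIntegrable_rpow_mul hd _ _ (Measurable.ite ?_ measurable_const measurable_const)
      fun l => ?_
    · exact measurableSet_le (by fun_prop) measurable_const
    · split_ifs <;> simp
  have e : ∀ l : ℝ, l ^ (d - 1) * tailFraction d h n k (l - y) S x = 1 / n * ∑ u ∈ S,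
      l ^ (d - 1) * if l - y ≤ gameValue d h n k S u x then 1 else 0 := fun l => by
    rw [tailFraction, ← Finset.mul_sum]; ring
  simp_rw [e]
  rw [intervalIntegral.integral_const_mul, intervalIntegral.integral_finsetSum hi, hazard,
    Finset.sum_congr rfl fun u _ => posPow_eq_integral hd hy (gameValue_le k S u x),
    ← Finset.mul_sum]
  ring

theorem hazard_le (hd : 0 ≤ d) (k : ℕ) (y : ℝ) (S : Finset (Fin n)) (x : CompleteEdge n → ℝ) :
    hazard d h n k y S x ≤ posPow d (y + h) := by
  rcases n.eq_zero_or_pos with rfl | hn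
  · simp [hazard, posPow_nonneg]
  have hn' : (0 : ℝ) < n := Nat.cast_pos.2 hn
  rw [hazard, one_div, inv_mul_le_iff₀ hn']
  refine (Finset.sum_le_card_nsmul _ _ (posPow d (y + h)) fun u _ =>
    posPow_mono hd (by linarith [gameValue_le (d := d) (h := h) k S u x])).trans ?_
  rw [nsmul_eq_mul]
  refine mul_le_mul_of_nonneg_right ?_ (posPow_nonneg _ _)
  simpa using Finset.card_le_univ S

/-- The tail error is integrated against `d * l ^ (d - 1)`, whose mass on the interval up to `h + y`
is at most `posPow d (2 * h)`. -/
theorem integral_abs_hazard_sub_le (hd : 1 ≤ d) (k : ℕ) (S : Finset (Fin n)) {F : ℝ → ℝ}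
    (hFm : Measurable F) (hF : ∀ y, F y ∈ Icc (0 : ℝ) 1) {δ : ℝ}
    (hδ : ∀ y ∈ Icc (-h) h,
      ∫ x, |tailFraction d h n k y S x - F y| ∂meanFieldMeasure n ≤ δ) {y : ℝ}
    (hy : y ∈ Icc (-h) h) :
    ∫ x, |hazard d h n k y S x - d * ∫ l in (0 : ℝ)..(h + y), l ^ (d - 1) * F (l - y)|
      ∂meanFieldMeasure n ≤ posPow d (2 * h) * δ := by
  have hd0 : 0 < d := by linarith
  have hy0 : 0 ≤ h + y := by linarith [hy.1]
  have hδ0 : 0 ≤ δ := (integral_nonneg fun _ => abs_nonneg _).trans (hδ y hy)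
  have hTm := measurable_tailFraction d h n k S
  have hshift : Measurable fun p : (CompleteEdge n → ℝ) × ℝ => tailFraction d h n k (p.2 - y) S p.1 :=
    hTm.comp (measurable_fst.prodMk (measurable_snd.sub_const y))
  have hg : Measurable fun p : (CompleteEdge n → ℝ) × ℝ =>
      |tailFraction d h n k (p.2 - y) S p.1 - F (p.2 - y)| :=
    (hshift.sub (hFm.comp (measurable_snd.sub_const y))).abs
  have hgb : ∀ (x : CompleteEdge n → ℝ) (l : ℝ),
      |tailFraction d h n k (l - y) S x - F (l - y)| ≤ 1 := fun x l => by
    have h1 := tailFraction_mem_Icc (d := d) (h := h) k (l - y) S x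
    have h2 := hF (l - y)
    rw [abs_le]
    constructor <;> linarith [h1.1, h1.2, h2.1, h2.2]
  have hprod := integrable_rpow_mul_of_bounded (μ := meanFieldMeasure n) hd h y
    (g := fun x l => |tailFraction d h n k (l - y) S x - F (l - y)|) hg (C := 1)
    (fun x l => by rw [abs_abs]; exact hgb x l)
  have habs1 : ∀ t : ℝ, t ∈ Icc (0 : ℝ) 1 → |t| ≤ 1 := fun t ht => by
    rw [abs_of_nonneg ht.1]; exact ht.2
  have hpt : ∀ x, |hazard d h n k y S x - d * ∫ l in (0 : ℝ)..(h + y), l ^ (d - 1) * F (l - y)| ≤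
      d * ∫ l in Ioc 0 (h + y),
        l ^ (d - 1) * |tailFraction d h n k (l - y) S x - F (l - y)| := by
    intro x
    have hm1 : Measurable fun l => tailFraction d h n k (l - y) S x :=
      hshift.comp measurable_prodMk_left
    rw [hazard_eq_integral hd k hy0, ← mul_sub, ← intervalIntegral.integral_sub
      (intervalIntegrable_rpow_mul hd _ _ hm1 fun l => habs1 _ (tailFraction_mem_Icc k _ S x))
      (intervalIntegrable_rpow_mul hd _ _ (G := fun l => F (l - y))
        (hFm.comp (measurable_id.sub_const y)) fun l => habs1 _ (hF _)), abs_mul,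
      abs_of_pos hd0]
    refine mul_le_mul_of_nonneg_left ?_ hd0.le
    refine (intervalIntegral.abs_integral_le_integral_abs hy0).trans (le_of_eq ?_)
    rw [intervalIntegral.integral_of_le hy0]
    refine setIntegral_congr_fun measurableSet_Ioc fun l hl => ?_
    rw [← mul_sub, abs_mul, abs_of_nonneg (Real.rpow_nonneg hl.1.le _)]
  calc ∫ x, |hazard d h n k y S x - d * ∫ l in (0 : ℝ)..(h + y), l ^ (d - 1) * F (l - y)|
      ∂meanFieldMeasure n
      ≤ ∫ x, (d * ∫ l in Ioc 0 (h + y),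
          l ^ (d - 1) * |tailFraction d h n k (l - y) S x - F (l - y)|) ∂meanFieldMeasure n :=
        integral_mono_of_nonneg (ae_of_all _ fun _ => abs_nonneg _)
          (hprod.integral_prod_left.const_mul d) (ae_of_all _ hpt)
    _ = d * ∫ l in Ioc 0 (h + y), l ^ (d - 1) *
          ∫ x, |tailFraction d h n k (l - y) S x - F (l - y)| ∂meanFieldMeasure n := by
        rw [integral_const_mul, integral_integral_swap hprod]
        simp_rw [integral_const_mul]
    _ ≤ d * ∫ l in Ioc 0 (h + y), l ^ (d - 1) * δ := by
        refine mul_le_mul_of_nonneg_left ?_ hd0.le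
        refine integral_mono_of_nonneg ?_ ?_ ?_
        · filter_upwards [ae_restrict_mem measurableSet_Ioc] with l hl
          exact mul_nonneg (Real.rpow_nonneg hl.1.le _) (integral_nonneg fun _ => abs_nonneg _)
        · exact ((intervalIntegrable_rpow_sub_one hd 0 (h + y)).1).mul_const δ
        · filter_upwards [ae_restrict_mem measurableSet_Ioc] with l hl
          exact mul_le_mul_of_nonneg_left
            (hδ _ ⟨by linarith [hl.1, hy.2], by linarith [hl.2]⟩) (Real.rpow_nonneg hl.1.le _)
    _ = posPow d (h + y) * δ := by
        rw [integral_mul_const, ← intervalIntegral.integral_of_le hy0,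
          integral_rpow (Or.inl (by linarith)), posPow_of_nonneg hy0]
        simp [Real.zero_rpow hd0.ne']
        field_simp
    _ ≤ posPow d (2 * h) * δ :=
        mul_le_mul_of_nonneg_right (posPow_mono hd0.le (by linarith [hy.2])) hδ0

theorem abs_exp_neg_sub_exp_neg_le {a b : ℝ} (ha : 0 ≤ a) (hb : 0 ≤ b) :
    |Real.exp (-a) - Real.exp (-b)| ≤ |a - b| := by
  have key : ∀ {a b : ℝ}, 0 ≤ a → a ≤ b → Real.exp (-a) - Real.exp (-b) ≤ b - a := by
    intro a b ha hab
    have h1 : Real.exp (-b) = Real.exp (-a) * Real.exp (-(b - a)) := by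
      rw [← Real.exp_add]; ring_nf
    have h2 := Real.add_one_le_exp (-(b - a))
    have h3 : Real.exp (-a) ≤ 1 := Real.exp_le_one_iff.2 (by linarith)
    have h4 := Real.exp_pos (-a)
    nlinarith
  rcases le_total a b with hab | hab
  · rw [abs_of_nonneg (sub_nonneg.2 (Real.exp_le_exp.2 (by linarith))), abs_sub_comm,
      abs_of_nonneg (sub_nonneg.2 hab)]
    exact key ha hab
  · rw [abs_sub_comm, abs_of_nonneg (sub_nonneg.2 (Real.exp_le_exp.2 (by linarith))),
      abs_of_nonneg (sub_nonneg.2 hab)]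
    exact key hb hab

theorem abs_integral_exp_neg_sub_le {Ω : Type*} [MeasurableSpace Ω] {μ : Measure Ω}
    [IsProbabilityMeasure μ] {A : Ω → ℝ} (hA : Measurable A) (hA0 : ∀ ω, 0 ≤ A ω) {C : ℝ}
    (hAC : ∀ ω, A ω ≤ C) {b : ℝ} (hb : 0 ≤ b) :
    |∫ ω, Real.exp (-A ω) ∂μ - Real.exp (-b)| ≤ ∫ ω, |A ω - b| ∂μ := by
  have h1 : Integrable (fun ω => Real.exp (-A ω)) μ :=
    Integrable.of_bound (by fun_prop) 1 (ae_of_all _ fun ω => by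
      rw [Real.norm_eq_abs, Real.abs_exp, Real.exp_le_one_iff]; linarith [hA0 ω])
  have h2 : Integrable (fun ω => |A ω - b|) μ := by
    refine Integrable.abs (Integrable.sub (Integrable.of_bound hA.aestronglyMeasurable C
      (ae_of_all _ fun ω => ?_)) (integrable_const b))
    rw [Real.norm_eq_abs, abs_of_nonneg (hA0 ω)]; exact hAC ω
  have h3 : ∫ ω, Real.exp (-A ω) ∂μ - Real.exp (-b) =
      ∫ ω, (Real.exp (-A ω) - Real.exp (-b)) ∂μ := by
    rw [integral_sub h1 (integrable_const _)]; simp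
  rw [h3]
  refine (abs_integral_le_integral_abs).trans (integral_mono_of_nonneg
    (ae_of_all _ fun _ => abs_nonneg _) h2 (ae_of_all _ fun ω => ?_))
  exact abs_exp_neg_sub_exp_neg_le (hA0 ω) hb

theorem integral_ite_one_zero {Ω : Type*} [MeasurableSpace Ω] {μ : Measure Ω} {p : Ω → Prop}
    [DecidablePred p] (hp : MeasurableSet {ω | p ω}) :
    ∫ ω, (if p ω then (1 : ℝ) else 0) ∂μ = μ.real {ω | p ω} := by
  rw [← integral_indicator_one hp]
  congr 1
  ext ω
  simp [indicator_apply]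

/-- The induction step in the depth. Means come from the one-vertex formula with error `η`; for
pairs, deleting each vertex from the other's game costs twice the stability bound, and the
two-vertex formula then costs `2 * η'`. -/
theorem integral_abs_tailFraction_succ_sub_le (hd : 1 ≤ d) (hn : 0 < n) (k : ℕ) {j : ℝ}
    {S : Finset (Fin n)} (hS : (n : ℝ) ≤ S.card + j) {y b η η' : ℝ} (hy : y ≤ h) (hb : 0 ≤ b)
    (hη0 : 0 ≤ η')
    (hη : ∀ v ∈ S, ∫ x, |hazard d h n k y (S.erase v) x - b| ∂meanFieldMeasure n ≤ η)
    (hη' : ∀ v ∈ S, ∀ w ∈ S, v ≠ w →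
      ∫ x, |hazard d h n k y ((S.erase v).erase w) x - b| ∂meanFieldMeasure n ≤ η') :
    ∫ x, |tailFraction d h n (k + 1) y S x - Real.exp (-b)| ∂meanFieldMeasure n ≤
      √(1 / n + (2 * (stabilityConst (posPow d (2 * h)) (k + 1) / n) + 2 * η' + 2 * η)) + j / n := by
  have hd0 : 0 < d := by linarith
  have hn' : (0 : ℝ) < n := Nat.cast_pos.2 hn
  set μ := meanFieldMeasure n with hμ
  set D := stabilityConst (posPow d (2 * h)) (k + 1) / n with hD
  have hD0 : 0 ≤ D := div_nonneg (stabilityConst_nonneg (posPow_nonneg _ _) _) hn'.le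
  have hms : ∀ (T : Finset (Fin n)) u, MeasurableSet {x | y ≤ gameValue d h n (k + 1) T u x} :=
    fun T u => measurableSet_le measurable_const (measurable_gameValue d h n (k + 1) T u)
  refine integral_abs_average_sub_le (μ := μ)
    (Z := fun u x => if y ≤ gameValue d h n (k + 1) S u x then 1 else 0)
    (fun u => Measurable.ite (hms S u) measurable_const measurable_const)
    (fun u x => by split_ifs <;> simp) ⟨(Real.exp_pos _).le, Real.exp_le_one_iff.2 (by linarith)⟩
    hn' (by simpa using Finset.card_le_univ S) hS (by positivity) ?_ ?_
  · intro v hv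
    rw [integral_ite_one_zero (hms S v), measureReal_le_gameValue_succ hd0 hn k hy]
    exact (abs_integral_exp_neg_sub_le (measurable_hazard hd0.le k y _)
      (hazard_nonneg k y _) (hazard_le hd0.le k y _) hb).trans (hη v hv)
  · intro v hv w hw hvw
    have e1 : ∀ x, ((if y ≤ gameValue d h n (k + 1) S v x then (1 : ℝ) else 0) *
        if y ≤ gameValue d h n (k + 1) S w x then 1 else 0) =
        if y ≤ gameValue d h n (k + 1) S v x ∧ y ≤ gameValue d h n (k + 1) S w x then 1 else 0 :=
      fun x => by split_ifs <;> simp_all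
    simp_rw [e1]
    rw [integral_ite_one_zero (p := fun x => y ≤ gameValue d h n (k + 1) S v x ∧
      y ≤ gameValue d h n (k + 1) S w x) ((hms S v).inter (hms S w))]
    set E := {x | y ≤ gameValue d h n (k + 1) S v x ∧ y ≤ gameValue d h n (k + 1) S w x} with hE
    set E' := {x | y ≤ gameValue d h n (k + 1) (S.erase w) v x ∧
      y ≤ gameValue d h n (k + 1) (S.erase v) w x} with hE'
    set D₁ := {x | gameValue d h n (k + 1) S v x ≠ gameValue d h n (k + 1) (S.erase w) v x} with hD₁
    set D₂ := {x | gameValue d h n (k + 1) S w x ≠ gameValue d h n (k + 1) (S.erase v) w x} with hD₂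
    have hD₁' : μ.real D₁ ≤ D := measureReal_gameValue_ne_erase_le hd0 hn (k + 1) hv hvw
    have hD₂' : μ.real D₂ ≤ D := measureReal_gameValue_ne_erase_le hd0 hn (k + 1) hw hvw.symm
    have hEE' : ∀ x, x ∉ D₁ ∪ D₂ → (x ∈ E ↔ x ∈ E') := by
      intro x hx
      simp only [hD₁, hD₂, mem_union, mem_ofPred_eq, not_or, not_not] at hx
      simp only [hE, hE', mem_ofPred_eq, hx.1, hx.2]
    have hU : μ.real (D₁ ∪ D₂) ≤ 2 * D := (measureReal_union_le _ _).trans (by linarith)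
    have s1 : μ.real E ≤ μ.real E' + 2 * D := by
      refine (measureReal_mono (s₂ := E' ∪ (D₁ ∪ D₂)) fun x hx => ?_).trans
        ((measureReal_union_le _ _).trans (by linarith))
      by_cases hxD : x ∈ D₁ ∪ D₂
      · exact Or.inr hxD
      · exact Or.inl ((hEE' x hxD).1 hx)
    have s2 : μ.real E' ≤ μ.real E + 2 * D := by
      refine (measureReal_mono (s₂ := E ∪ (D₁ ∪ D₂)) fun x hx => ?_).trans
        ((measureReal_union_le _ _).trans (by linarith))
      by_cases hxD : x ∈ D₁ ∪ D₂
      · exact Or.inr hxD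
      · exact Or.inl ((hEE' x hxD).2 hx)
    have s3 : |μ.real E' - Real.exp (-b) ^ 2| ≤ 2 * η' := by
      have e2 : Real.exp (-b) ^ 2 = Real.exp (-(2 * b)) := by
        rw [← Real.exp_nat_mul]; congr 1; push_cast; ring
      rw [hE', measureReal_le_gameValue_succ_pair hd0 hn k hy S hvw, e2]
      refine (abs_integral_exp_neg_sub_le ((measurable_hazard hd0.le k y _).const_mul 2)
        (fun x => mul_nonneg zero_le_two (hazard_nonneg k y _ x))
        (C := 2 * posPow d (y + h)) (fun x => by
          linarith [hazard_le (h := h) hd0.le k y ((S.erase v).erase w) x])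
        (by linarith)).trans ?_
      simp_rw [← mul_sub, abs_mul, abs_two]
      rw [integral_const_mul]
      exact mul_le_mul_of_nonneg_left (hη' v hv w hw hvw) zero_le_two
    rw [abs_le] at s3 ⊢
    constructor <;> linarith [s3.1, s3.2]

/-- The law of large numbers for the truncated game values in the mean field model. -/
theorem exists_tailFraction_rate {θ : ℝ} (hd : 1 ≤ d) (hθ : 0 ≤ θ) (k : ℕ) :
    ∀ j : ℕ, ∃ δ : ℕ → ℝ, Tendsto δ atTop (𝓝 0) ∧ ∀ n, 0 < n → ∀ S : Finset (Fin n),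
      n ≤ S.card + j → ∀ y ∈ Icc (-(θ / 2)) (θ / 2),
        ∫ x, |tailFraction d (θ / 2) n k y S x - truncTail d (θ / 2) k y| ∂meanFieldMeasure n
          ≤ δ n := by
  induction k with
  | zero =>
    intro j
    refine ⟨fun n => j / n, tendsto_const_div_atTop_nhds_zero_nat (j : ℝ), fun n hn S hS y hy => ?_⟩
    have hn' : (0 : ℝ) < n := Nat.cast_pos.2 hn
    have hS' : (n : ℝ) ≤ S.card + j := by exact_mod_cast hS
    have hcard : (S.card : ℝ) ≤ n := by simpa using Finset.card_le_univ S
    have e : ∀ x, |tailFraction d (θ / 2) n 0 y S x - truncTail d (θ / 2) 0 y| =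
        (n - S.card) / n := fun x => by
      rw [truncTail_zero hy.2]
      have h1 : tailFraction d (θ / 2) n 0 y S x = S.card / n := by
        have hg : ∀ u, y ≤ gameValue d (θ / 2) n 0 S u x := fun _ => hy.2
        rw [tailFraction, Finset.sum_congr rfl fun u _ => if_pos (hg u)]
        simp [div_eq_inv_mul]
      rw [h1, abs_sub_comm, abs_of_nonneg (sub_nonneg.2 ((div_le_one hn').2 hcard)), sub_div,
        div_self hn'.ne']
    simp_rw [e]
    simp only [integral_const, probReal_univ, one_smul]
    gcongr
    linarith
  | succ k ih =>
    intro j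
    -- One more vertex is missing in the formula for means and two more in the one for pairs, which
    -- is why the claim is uniform over sets lacking `j` vertices, for every `j`.
    obtain ⟨δ₁, hδ₁, hδ₁'⟩ := ih (j + 1)
    obtain ⟨δ₂, hδ₂, hδ₂'⟩ := ih (j + 2)
    set c := posPow d (2 * (θ / 2)) with hc
    refine ⟨fun n => √(1 / n + (2 * (stabilityConst c (k + 1) / n) + 2 * (c * δ₂ n) +
      2 * (c * δ₁ n))) + j / n, ?_, fun n hn S hS y hy => ?_⟩
    · have t0 := tendsto_const_div_atTop_nhds_zero_nat (1 : ℝ)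
      have t1 := (tendsto_const_div_atTop_nhds_zero_nat (stabilityConst c (k + 1))).const_mul 2
      have t2 := (hδ₂.const_mul c).const_mul 2
      have t3 := (hδ₁.const_mul c).const_mul 2
      have t4 := (Real.continuous_sqrt.tendsto _).comp (t0.add ((t1.add t2).add t3))
      simpa [Function.comp_def] using t4.add (tendsto_const_div_atTop_nhds_zero_nat (j : ℝ))
    · have hFm : Measurable (truncTail d (θ / 2) k) := (antitone_truncTail d (θ / 2) k).measurable
      have hmem : ∀ z, truncTail d (θ / 2) k z ∈ Icc (0 : ℝ) 1 := truncTail_mem_Icc d (θ / 2) k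
      set b := d * ∫ l in (0 : ℝ)..(θ / 2 + y), l ^ (d - 1) * truncTail d (θ / 2) k (l - y) with hb
      have hb0 : 0 ≤ b := by
        refine mul_nonneg (by linarith) (intervalIntegral.integral_nonneg (by linarith [hy.1])
          fun l hl => mul_nonneg (Real.rpow_nonneg hl.1 _) (hmem _).1)
      have hF : truncTail d (θ / 2) (k + 1) y = Real.exp (-b) := by
        rw [truncTail_succ hd hθ k hy, V, neg_mul]
      rw [hF]
      have hδ₂0 : 0 ≤ δ₂ n := (integral_nonneg fun _ => abs_nonneg _).trans
        (hδ₂' n hn S (by omega) y hy)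
      refine integral_abs_tailFraction_succ_sub_le hd hn k (by exact_mod_cast hS) hy.2 hb0
        (mul_nonneg (posPow_nonneg _ _) hδ₂0) (fun v hv => ?_) (fun v hv w hw hvw => ?_)
      · refine integral_abs_hazard_sub_le hd k _ hFm hmem (hδ₁' n hn _ ?_) hy
        rw [Finset.card_erase_of_mem hv]
        omega
      · refine integral_abs_hazard_sub_le hd k _ hFm hmem (hδ₂' n hn _ ?_) hy
        rw [Finset.card_erase_of_mem (Finset.mem_erase.2 ⟨hvw.symm, hw⟩),
          Finset.card_erase_of_mem hv]
        omega

end LawOfLargeNumbers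

/-! ### Valuations of the cluster of the tree -/

theorem canonicalLength_nonneg {d : ℝ} {e : List ℕ × ℕ → ℝ} (he : ∀ p, 0 < e p) (v : List ℕ)
    (i : ℕ) : 0 ≤ canonicalLength d e v i :=
  Real.rpow_nonneg (Finset.sum_nonneg fun _ _ => (he _).le) _

theorem ae_isValuation_iff {d θ : ℝ} (hd : 1 ≤ d) (hθ : 0 ≤ θ) :
    ∀ᵐ e ∂pwitMeasure, ∀ f, IsValuation θ (canonicalLength d e) f ↔
      f = fun v => upperValue (θ / 2) (canonicalLength d e) v.1 := by
  filter_upwards [ae_pos_pwitMeasure, ae_tendsto_canonicalLength (d := d) (by linarith),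
    ae_upperValue_eq_lowerValue (h := θ / 2) hd (by linarith)] with e hpos hlim heq f
  refine ⟨fun hf => hf.eq_upperValue hθ (canonicalLength_nonneg hpos) heq, ?_⟩
  rintro rfl
  exact isValuation_upperValue hθ (canonicalLength_nonneg hpos) hlim heq

theorem map_gaps_eq_pwitMeasure {Ω : Type*} [MeasurableSpace Ω] {Q : Measure Ω}
    {E : List ℕ → ℕ → Ω → ℝ} (hE_law : ∀ v i, HasLaw (E v i) (expMeasure 1) Q)
    (hE_indep : iIndepFun (fun p : List ℕ × ℕ => E p.1 p.2) Q) :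
    Q.map (fun ω (p : List ℕ × ℕ) => E p.1 p.2 ω) = pwitMeasure := by
  have h := hE_indep.map_fun_eq_infinitePi_map₀' fun p : List ℕ × ℕ => (hE_law p.1 p.2).aemeasurable
  simp_rw [(hE_law _ _).map_eq] at h
  exact h

/-! ### The optimum diluted matching -/

theorem map_lengths_eq_meanFieldMeasure {n : ℕ} {Ω : Type*} [MeasurableSpace Ω] {P : Measure Ω}
    {X : CompleteEdge n → Ω → ℝ} (hX_law : ∀ e, HasLaw (X e) (expMeasure 1) P)
    (hX_indep : iIndepFun X P) : P.map (fun ω e => X e ω) = meanFieldMeasure n := by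
  have h := hX_indep.map_fun_eq_infinitePi_map₀' fun e => (hX_law e).aemeasurable
  simp_rw [(hX_law _).map_eq] at h
  rw [h, Measure.infinitePi_eq_pi, meanFieldMeasure]

open Classical in
theorem unmatchedFraction_eq_sum {n : ℕ} (M : (⊤ : SimpleGraph (Fin n)).Subgraph) :
    unmatchedFraction M = 1 / n * ∑ u, if u ∉ M.verts then 1 else 0 := by
  rw [unmatchedFraction, Fintype.card_fin, Finset.sum_boole, ← Set.ncard_coe_finset, div_eq_inv_mul,
    one_div]
  congr 3
  ext u
  simp

theorem IsOptimal.unmatchedFraction_le_tailFraction {d θ : ℝ} {n : ℕ} {x : CompleteEdge n → ℝ}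
    {M : (⊤ : SimpleGraph (Fin n)).Subgraph} (hM : IsOptimal θ (meanFieldLength d n x) M) (k : ℕ) :
    unmatchedFraction M ≤ tailFraction d (θ / 2) n (2 * k) (θ / 2) Finset.univ x := by
  classical
  rw [unmatchedFraction_eq_sum, tailFraction]
  refine mul_le_mul_of_nonneg_left (Finset.sum_le_sum fun u _ => ?_) (by positivity)
  by_cases hu : u ∈ M.verts
  · rw [if_neg (not_not.2 hu)]
    split_ifs <;> simp
  · have : θ / 2 ≤ gameValue d (θ / 2) n (2 * k) Finset.univ u x :=
      hM.le_graphValue_of_unmatched k hu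
    rw [if_pos hu, if_pos this]

theorem IsOptimal.tailFraction_le_unmatchedFraction {d θ : ℝ} {n : ℕ} {x : CompleteEdge n → ℝ}
    {M : (⊤ : SimpleGraph (Fin n)).Subgraph} (hM : IsOptimal θ (meanFieldLength d n x) M) (k : ℕ)
    (htie : ∀ v w, v ≠ w → pairLength (meanFieldLength d n x) v w ≠
      θ / 2 + gameValue d (θ / 2) n (2 * k) (Finset.univ.erase v) w x) :
    tailFraction d (θ / 2) n (2 * k + 1) (θ / 2) Finset.univ x ≤ unmatchedFraction M := by
  classical
  rw [unmatchedFraction_eq_sum, tailFraction]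
  refine mul_le_mul_of_nonneg_left (Finset.sum_le_sum fun u _ => ?_) (by positivity)
  by_cases hu : u ∈ M.verts
  · have : gameValue d (θ / 2) n (2 * k + 1) Finset.univ u x < θ / 2 :=
      hM.graphValue_lt_of_matched k hu fun w hw => htie u w hw.symm
    rw [if_neg (not_not.2 hu), if_neg (not_le.2 this)]
  · rw [if_pos hu]
    split_ifs <;> simp

theorem tendsto_measure_tailFraction_sub {d θ ε : ℝ} (hd : 1 ≤ d) (hθ : 0 ≤ θ) (hε : 0 < ε)
    (k : ℕ) :
    Tendsto (fun n => meanFieldMeasure n {x | ε ≤ |tailFraction d (θ / 2) n k (θ / 2) Finset.univ x -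
      truncTail d (θ / 2) k (θ / 2)|}) atTop (𝓝 0) := by
  obtain ⟨δ, hδ, hδ'⟩ := exists_tailFraction_rate hd hθ k 0
  have hlim : Tendsto (fun n => ENNReal.ofReal (δ n / ε)) atTop (𝓝 0) := by
    simpa using ENNReal.tendsto_ofReal (hδ.div_const ε)
  refine tendsto_of_tendsto_of_tendsto_of_le_of_le' tendsto_const_nhds hlim
    (Eventually.of_forall fun _ => zero_le) ?_
  filter_upwards [eventually_gt_atTop 0] with n hn
  have hm : Measurable fun x => |tailFraction d (θ / 2) n k (θ / 2) Finset.univ x -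
      truncTail d (θ / 2) k (θ / 2)| :=
    (((measurable_tailFraction d (θ / 2) n k Finset.univ).comp
      (measurable_id.prodMk measurable_const)).sub_const _).abs
  have hint : Integrable (fun x => |tailFraction d (θ / 2) n k (θ / 2) Finset.univ x -
      truncTail d (θ / 2) k (θ / 2)|) (meanFieldMeasure n) := by
    refine Integrable.of_bound hm.aestronglyMeasurable 1 (Eventually.of_forall fun x => ?_)
    rw [Real.norm_eq_abs, abs_abs, abs_le]
    have h1 := tailFraction_mem_Icc (d := d) (h := θ / 2) k (θ / 2) (Finset.univ : Finset (Fin n)) x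
    have h2 := truncTail_mem_Icc d (θ / 2) k (θ / 2)
    constructor <;> linarith [h1.1, h1.2, h2.1, h2.2]
  rw [← ofReal_measureReal]
  refine ENNReal.ofReal_le_ofReal ((le_div_iff₀' hε).2 ?_)
  exact (mul_meas_ge_le_integral_of_nonneg (Eventually.of_forall fun _ => abs_nonneg _) hint ε).trans
    (hδ' n hn _ (by simp) _ ⟨by linarith, le_rfl⟩)

theorem tendsto_measure_unmatchedFraction {d θ ε : ℝ} (hd : 1 ≤ d) (hθ : 0 ≤ θ) (hε : 0 < ε)
    {Ω : ℕ → Type*} [∀ n, MeasurableSpace (Ω n)] {P : ∀ n, Measure (Ω n)}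
    {X : ∀ n, CompleteEdge n → Ω n → ℝ} (hX_law : ∀ n e, HasLaw (X n e) (expMeasure 1) (P n))
    (hX_indep : ∀ n, iIndepFun (X n) (P n)) {M : ∀ n, Ω n → (⊤ : SimpleGraph (Fin n)).Subgraph}
    (hM : ∀ n, ∀ᵐ ω ∂(P n), IsOptimal θ (meanFieldLength d n (fun e => X n e ω)) (M n ω)) :
    Tendsto (fun n => P n {ω | ε ≤ |unmatchedFraction (M n ω) - rootTail d (θ / 2) (θ / 2)|})
      atTop (𝓝 0) := by
  have hh : 0 ≤ θ / 2 := by linarith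
  set q := rootTail d (θ / 2) (θ / 2) with hq
  have hε2 : 0 < ε / 2 := by linarith
  -- The depth is fixed before `n` grows, both truncated tails at `θ / 2` being already within `ε /
  -- 2` of the limit.
  obtain ⟨k, hk₀, hk₁⟩ : ∃ k, |truncTail d (θ / 2) (2 * k) (θ / 2) - q| < ε / 2 ∧
      |truncTail d (θ / 2) (2 * k + 1) (θ / 2) - q| < ε / 2 := by
    have h0 := Metric.tendsto_nhds.1 (tendsto_truncTail_even (d := d) hh (θ / 2)) _ hε2
    have h1 := Metric.tendsto_nhds.1
      (tendsto_truncTail_odd_rootTail hd hh (x := θ / 2) ⟨by linarith, le_rfl⟩) _ hε2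
    exact (h0.and h1).exists
  let A : ∀ n, ℕ → Set (CompleteEdge n → ℝ) := fun n k =>
    {x | ε / 2 ≤ |tailFraction d (θ / 2) n k (θ / 2) Finset.univ x -
      truncTail d (θ / 2) k (θ / 2)|}
  have hA : ∀ n k, MeasurableSet (A n k) := fun n k => measurableSet_le measurable_const
    (((measurable_tailFraction d (θ / 2) n k Finset.univ).comp
      (measurable_id.prodMk measurable_const)).sub_const _).abs
  have hlim := (tendsto_measure_tailFraction_sub hd hθ hε2 (2 * k)).add
    (tendsto_measure_tailFraction_sub hd hθ hε2 (2 * k + 1))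
  rw [add_zero] at hlim
  refine tendsto_of_tendsto_of_tendsto_of_le_of_le' tendsto_const_nhds hlim
    (Eventually.of_forall fun _ => zero_le) ?_
  filter_upwards [eventually_gt_atTop 0] with n hn
  have hmap := map_lengths_eq_meanFieldMeasure (hX_law n) (hX_indep n)
  have hXm : AEMeasurable (fun ω e => X n e ω) (P n) :=
    aemeasurable_pi_iff.2 fun e => (hX_law n e).aemeasurable
  have htie : ∀ᵐ x ∂meanFieldMeasure n, ∀ v w, v ≠ w → pairLength (meanFieldLength d n x) v w ≠
      θ / 2 + gameValue d (θ / 2) n (2 * k) (Finset.univ.erase v) w x := by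
    simp only [ae_all_iff]
    exact fun v w hvw => measure_tie_eq_zero (by linarith) hn (2 * k) (θ / 2) hvw
  rw [← hmap] at htie
  -- The matching is not assumed measurable in `ω`, so the bad event is only enclosed, up to a null
  -- set, in two measurable events on the lengths.
  have hsub : P n {ω | ε ≤ |unmatchedFraction (M n ω) - q|} ≤
      P n ((fun ω e => X n e ω) ⁻¹' A n (2 * k) ∪ (fun ω e => X n e ω) ⁻¹' A n (2 * k + 1)) := by
    refine measure_mono_ae ?_
    filter_upwards [hM n, ae_of_ae_map hXm htie] with ω hω hωt hbad
    have hbad' : ε ≤ |unmatchedFraction (M n ω) - q| := hbad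
    have h0 := hω.unmatchedFraction_le_tailFraction k
    have h1 := hω.tailFraction_le_unmatchedFraction k hωt
    by_contra hcon
    have hcon' : (fun e => X n e ω) ∉ A n (2 * k) ∧ (fun e => X n e ω) ∉ A n (2 * k + 1) :=
      not_or.1 hcon
    simp only [A, mem_ofPred_eq, not_le, abs_lt] at hcon'
    rw [abs_lt] at hk₀ hk₁
    refine absurd hbad' (not_le.2 (abs_lt.2 ⟨?_, ?_⟩)) <;> linarith [hcon'.1.2, hcon'.2.1, hk₀.2, hk₁.1]
  refine hsub.trans ((measure_union_le _ _).trans (le_of_eq ?_))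
  rw [← Measure.map_apply_of_aemeasurable hXm (hA n _),
    ← Measure.map_apply_of_aemeasurable hXm (hA n _), hmap]

end DilutedMatching

theorem mainTheorem6 (d θ : ℝ) (hd : 1 ≤ d) (hθ : 0 ≤ θ)
    -- the mean field model on `n` vertices, for each `n`
    {Ω : ℕ → Type*} [∀ n, MeasurableSpace (Ω n)]
    (P : ∀ n, Measure (Ω n)) [∀ n, IsProbabilityMeasure (P n)]
    (X : ∀ n, (⊤ : SimpleGraph (Fin n)).edgeSet → Ω n → ℝ)
    (hX_law : ∀ n e, HasLaw (X n e) (expMeasure 1) (P n))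
    (hX_indep : ∀ n, iIndepFun (X n) (P n))
    -- the optimum diluted matching
    (M : ∀ n, Ω n → (⊤ : SimpleGraph (Fin n)).Subgraph)
    (hM : ∀ n, ∀ᵐ ω ∂(P n), DilutedMatching.IsOptimal θ
      (DilutedMatching.meanFieldLength d n (fun e => X n e ω)) (M n ω))
    -- the `d`-PWIT
    {Ω' : Type*} [MeasurableSpace Ω'] (Q : Measure Ω') [IsProbabilityMeasure Q]
    (E : List ℕ → ℕ → Ω' → ℝ)
    (hE_law : ∀ v i, HasLaw (E v i) (expMeasure 1) Q)
    (hE_indep : iIndepFun (fun p : List ℕ × ℕ => E p.1 p.2) Q) :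
    -- there is almost surely exactly one valuation
    (∀ᵐ ω ∂Q, ∃! f, DilutedMatching.IsValuation θ
      (DilutedMatching.pwitLength d (fun v i => E v i ω)) f) ∧
    -- `F` is the unique fixed point of `V_θ`
    ∃ F : ℝ → ℝ, DilutedMatching.IsFixedPoint d θ F ∧
      (∀ G : ℝ → ℝ, DilutedMatching.IsFixedPoint d θ G →
        EqOn G F (Icc (-(θ / 2)) (θ / 2))) ∧
      -- `q = P(f = θ/2) = F(θ/2)`, for the value `f` of the root
      ∃ q : ℝ,
        Q.real {ω | ∃ f, DilutedMatching.IsValuation θ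
          (DilutedMatching.pwitLength d (fun v i => E v i ω)) f ∧
            f ⟨[], DilutedMatching.InCluster.root⟩ = θ / 2} = q ∧
        q = F (θ / 2) ∧
        -- `q_n` converges in probability to `q`
        ∀ ε : ℝ, 0 < ε → Tendsto
          (fun n => P n {ω | ε ≤ |DilutedMatching.unmatchedFraction (M n ω) - q|})
          atTop (𝓝 0) := by
  open DilutedMatching in
  have hh : 0 ≤ θ / 2 := by linarith
  have hmap := map_gaps_eq_pwitMeasure hE_law hE_indep
  have hEm : AEMeasurable (fun ω (p : List ℕ × ℕ) => E p.1 p.2 ω) Q :=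
    aemeasurable_pi_iff.2 fun p => (hE_law p.1 p.2).aemeasurable
  have hval : ∀ᵐ ω ∂Q, ∀ f, IsValuation θ (pwitLength d fun v i => E v i ω) f ↔
      f = fun v => upperValue (θ / 2) (pwitLength d fun v i => E v i ω) v.1 := by
    have h := ae_isValuation_iff hd hθ
    rw [← hmap] at h
    exact ae_of_ae_map hEm h
  refine ⟨?_, rootTail d (θ / 2), isFixedPoint_rootTail hd hθ, fun G hG => hG.eqOn_rootTail hd hθ,
    rootTail d (θ / 2) (θ / 2), ?_, rfl,
    fun ε hε => tendsto_measure_unmatchedFraction hd hθ hε hX_law hX_indep hM⟩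
  · filter_upwards [hval] with ω hω
    exact ⟨_, (hω _).2 rfl, fun f hf => (hω f).1 hf⟩
  -- Values never exceed `θ / 2`, so equality with `θ / 2` at the root is the tail event at `θ / 2`.
  -- The event defined through valuations agrees with this measurable one up to a null set.
  · rw [rootTail, ← hmap, map_measureReal_apply_of_aemeasurable hEm
      (measurableSet_le measurable_const (measurable_upperValue d (θ / 2) []))]
    refine measureReal_congr ?_
    filter_upwards [hval] with ω hω
    refine propext ⟨?_, fun hle => ⟨_, (hω _).2 rfl, le_antisymm (upperValue_le hh []) hle⟩⟩
    rintro ⟨f, hf, hfr⟩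
    rw [(hω f).1 hf] at hfr
    exact hfr.ge
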